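/- **Setting.** Let $\mathcal T=[a,b]$ be a compact interval and let $P$ be a population of units with treatment indicator $D\in\{0,1\}$, covariates $X\in\mathbb R^d$, a pre-treatment curve $Y_0$, and potential post-treatment curves $Y^0_1,Y^1_1$ on $\mathcal T$. Put $\Delta Y=DY^1_1+(1-D)Y^0_1-Y_0$ (assumed to have a finite mean at each time), $p_0=P(D=1)$, $\tau_0(t)=E\{Y^1_1(t)-Y^0_1(t)\mid D=1\}$ (assumed to exist for each $t$), $\pi_0(x)=P(D=1\mid X=x)$, $\mu_0(x)(t)=E\{\Delta Y(t)\mid X=x,D=0\}$. For $W=(\Delta Y,D,X)$, $\eta=(\pi,\mu)$ let $$\psi_p(W;\eta)(t)=\frac Dp\{\Delta Y(t)-\mu(X)(t)\}-\frac{(1-D)\pi(X)}{p\{1-\pi(X)\}}\{\Delta Y(t)-\mu(X)(t)\},$$ $$\phi(W)(t)=\psi_{p_0}(W;(\pi_0,\mu_0))(t)-\frac{D}{p_0}\tau_0(t),\quad C(s,t)=\mathrm{Cov}\{\phi(W)(s),\phi(W)(t)\},\quad \sigma(t)=C(t,t)^{1/2}.$$ Let units $1,2,\dots$ be i.i.d.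 from $P$. For each $n$ the sample $\{1,\dots,n\}$ is partitioned into $K$ folds ($K$ fixed); $\hat\pi^{(-k)},\hat\mu_0^{(-k)}$ are nuisance estimators whose training information is independent of the units in fold $k$, and $\widehat{\Delta Y}_i$ are reconstructed change curves. Put $\hat p=n^{-1}\sum_i D_i$, let $\hat\psi_i$ be the score $\psi_{\hat p}$ of unit $i$ with $\Delta Y_i$ replaced by $\widehat{\Delta Y}_i$ and the nuisance fits of its fold inserted, and $$\hat\tau=\frac1n\sum_{i\le n}\hat\psi_i,\qquad \hat\phi_i=\hat\psi_i-\frac{D_i}{\hat p}\hat\tau,\qquad \bar\phi=\frac1n\sum_{i\le n}\hat\phi_i,\qquad \hat\sigma^2=\frac1n\sum_{i\le n}(\hat\phi_i-\bar\phi)^2 .$$ For multipliers $\xi_i$, i.i.d. with mean $0$ and variance $1$ and independent of the data, let $\mathbb G^*(t)=n^{-1/2}\sum_{i\le n}\xi_i\{\hat\phi_i(t)-\bar\phi(t)\}$. Let $\mathcal G_n\subset\mathcal T$ be finite deterministic grids and $T^*=\max_{t\in\mathcal G_n}|\mathbb G^*(t)/\hat\sigma(t)|$. **Theorem.** Let $\alpha\in(0,1)$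 and assume: 1. (Overlap, nuisance fits, reconstruction, envelope.) For some $c\in(0,1/2)$, $c\le\pi_0(X)\le1-c$ a.s.; for some $c\in(0,1/2)$, with probability tending to one $c\le\hat\pi^{(-k)}(X_i)\le1-c$ for all $k$ and all $i\le n$ in fold $k$; for every $k$, $\|\hat\pi^{(-k)}-\pi_0\|_{L^2}=o_p(1)$ and $\{E_X\sup_t|\hat\mu_0^{(-k)}(X)(t)-\mu_0(X)(t)|^2\}^{1/2}=o_p(1)$, where norms and $E_X$ refer to the law of $X$ with the estimators held fixed; $\max_{i\le n}\sup_t|\widehat{\Delta Y}_i(t)-\Delta Y_i(t)|=o_p(n^{-1/2})$; $\{\phi(\cdot)(t):t\in\mathcal T\}$ has a square-integrable envelope. 2. $\sqrt n(\hat\tau-\tau_0)\Rightarrow\mathbb Z$ in $\ell^\infty(\mathcal T)$ (in the sense of Hoffmann-Jørgensen), where $\mathbb Z$ is a tight mean-zero Gaussian process with covariance kernel $C$ and almost surely uniformly continuous paths. 3. $\inf_t\sigma(t)>0$ and $\sup_t|\hat\sigma(t)-\sigma(t)|=o_p(1)$. 4. The distribution function of $\sup_t|\mathbb Z(t)/\sigma(t)|$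 is continuous at its $(1-\alpha)$-quantile. 5. The Kolmogorov distance between the conditional distribution of $\sup_{t\in\mathcal T}|\mathbb G^*(t)/\hat\sigma(t)|$ given the data and the distribution of $\sup_t|\mathbb Z(t)/\sigma(t)|$ tends to zero in probability. 6. The mesh of $\mathcal G_n$ tends to zero and $$\sup_{t\in\mathcal T}\Bigl|\frac{\sqrt n\{\hat\tau(t)-\tau_0(t)\}}{\hat\sigma(t)}\Bigr|-\max_{t\in\mathcal G_n}\Bigl|\frac{\sqrt n\{\hat\tau(t)-\tau_0(t)\}}{\hat\sigma(t)}\Bigr|=o_p(1).$$ Then $$\mathbb P\Bigl(\tau_0(t)\in\bigl[\hat\tau(t)\pm\hat c_{1-\alpha}\hat\sigma(t)/\sqrt n\bigr]\ \text{for all }t\in\mathcal T\Bigr)\to1-\alpha,$$ both when $\hat c_{1-\alpha}$ is the $(1-\alpha)$-quantile of the conditional distribution of $T^*$ given the data, and when it is the empirical $(1-\alpha)$-quantile of $B_n$ bootstrap draws of $T^*$ (with independent sets of multipliers), for any $B_n\to\infty$. If the coverage event is not measurable, the limit holds for both its outer and its inner probability. -/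

import Mathlib

open MeasureTheory ProbabilityTheory Filter Topology
open scoped ENNReal

namespace FunctionalDiD

/-! ### General probabilistic notions -/

/-- Convergence to zero in (outer) probability, `R n = o_p(1)`, of `[0, ∞]`-valued quantities. -/
def IsLittleOP {Ω : Type*} [MeasurableSpace Ω] (μ : Measure Ω) (R : ℕ → Ω → ℝ≥0∞) : Prop :=
  ∀ ε : ℝ≥0∞, 0 < ε → Tendsto (fun n => μ {ω | ε ≤ R n ω}) atTop (𝓝 0)

/-- The probabilities of the events `A n` converge to `p`. Since an event that involves
uncountably many time points need not be measurable, the convergence is required both of the outer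
probabilities of `A n` and of those of the complements (that is, of the inner probabilities of
`A n`); for measurable events the second clause repeats the first. -/
def ProbTendsto {Ω : Type*} [MeasurableSpace Ω] (μ : Measure Ω) (A : ℕ → Set Ω) (p : ℝ) : Prop :=
  Tendsto (fun n => μ.real (A n)) atTop (𝓝 p) ∧
    Tendsto (fun n => μ.real (A n)ᶜ) atTop (𝓝 (1 - p))

/-- The supremum `sup_t |f t|`, as an element of `[0, ∞]`. -/
noncomputable def supAbs {T : Type*} (f : T → ℝ) : ℝ≥0∞ := ⨆ t, ‖f t‖ₑ

/-- The `p`-quantile `inf {x | p ≤ F x}` of a distribution function `F`. -/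
noncomputable def quantile (F : ℝ → ℝ) (p : ℝ) : ℝ := sInf {x | p ≤ F x}

/-- The distribution function `x ↦ P (sup_t |S t| ≤ x)` of the supremum of a process `S`. -/
noncomputable def supCdf {Ω T : Type*} [MeasurableSpace Ω] (P : Measure Ω) (S : Ω → T → ℝ)
    (x : ℝ) : ℝ :=
  P.real {ω | ∀ t, |S ω t| ≤ x}

/-- The space `ℓ^∞(T)` of bounded real functions on `T` with the supremum norm. -/
abbrev EllInfty (T : Type*) : Type _ := lp (fun _ : T => ℝ) ∞

/-- The outer expectation of a bounded real function. -/
noncomputable def outerExpectation {Ω : Type*} [MeasurableSpace Ω] (μ : Measure Ω)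
    (f : Ω → ℝ) : ℝ :=
  sInf {r | ∃ g : Ω → ℝ, Measurable g ∧ Integrable g μ ∧ (∀ ω, f ω ≤ g ω) ∧ r = ∫ ω, g ω ∂μ}

/-- Weak convergence `S n ⇒ Z` in `ℓ^∞(T)` in the sense of Hoffmann-Jørgensen: the processes
`S n` have bounded paths, and the outer expectations of `f (S n)` converge to `E f(Z)` for every
bounded continuous `f`. -/
def WeakConvEllInfty {Ω Ω₀ T : Type*} [MeasurableSpace Ω] [MeasurableSpace Ω₀]
    (μ : Measure Ω) (S : ℕ → Ω → T → ℝ) (P₀ : Measure Ω₀) (Z : Ω₀ → EllInfty T) : Prop :=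
  ∃ hS : ∀ n ω, Memℓp (S n ω) ∞, ∀ f : BoundedContinuousFunction (EllInfty T) ℝ,
    Tendsto (fun n => outerExpectation μ (fun ω => f ⟨S n ω, hS n ω⟩)) atTop
      (𝓝 (∫ ω, f (Z ω) ∂P₀))

/-- `Z` is a tight Borel random element of `ℓ^∞(T)` which is a mean-zero Gaussian process with
covariance kernel `C`. -/
structure IsTightGaussian {Ω₀ T : Type*} [MeasurableSpace Ω₀] (P₀ : Measure Ω₀)
    (Z : Ω₀ → EllInfty T) (C : T → T → ℝ) : Prop where
  measurable : @Measurable Ω₀ (EllInfty T) _ (borel (EllInfty T)) Z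
  tight : ∀ ε : ℝ≥0∞, 0 < ε → ∃ K : Set (EllInfty T), IsCompact K ∧ P₀ {ω | Z ω ∉ K} ≤ ε
  gaussian : IsGaussianProcess (fun (t : T) (ω : Ω₀) => Z ω t) P₀
  mean_zero : ∀ t, ∫ ω, Z ω t ∂P₀ = 0
  covariance : ∀ s t, covariance (fun ω => Z ω s) (fun ω => Z ω t) P₀ = C s t

/-- The norm `‖h‖_{2,∞} = (E sup_t |h(X)(t)|²)^{1/2}` of a function-valued regression, `ρ` being
the law of `X`. -/
noncomputable def normTwoInfty {𝒳 T : Type*} [MeasurableSpace 𝒳] (ρ : Measure 𝒳)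
    (h : 𝒳 → T → ℝ) : ℝ≥0∞ :=
  (∫⁻ x, (supAbs (h x)) ^ 2 ∂ρ) ^ (1 / 2 : ℝ)

/-! ### The difference-in-differences population -/

/-- A population with law `P` of units in a two-period difference-in-differences design with
outcome curves indexed by `T`. A unit has a treatment indicator `D`, covariates `X`, a
pre-treatment curve `Ypre` (the two potential pre-treatment curves coincide) and the potential
post-treatment curves `Ypost0`, `Ypost1`. The functions `prop` and `reg0` are (versions of) the
propensity score `P(D = 1 | X = x)` and the control regression `E{ΔY(t) | X = x, D = 0}`. -/
structure Population {𝒰 : Type*} [MeasurableSpace 𝒰] (P : Measure 𝒰) (T : Type*) (d : ℕ) where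
  D : 𝒰 → ℝ
  X : 𝒰 → (Fin d → ℝ)
  Ypre : 𝒰 → T → ℝ
  Ypost0 : 𝒰 → T → ℝ
  Ypost1 : 𝒰 → T → ℝ
  measurable_D : Measurable D
  measurable_X : Measurable X
  measurable_Ypre : ∀ t, Measurable (fun u => Ypre u t)
  measurable_Ypost0 : ∀ t, Measurable (fun u => Ypost0 u t)
  measurable_Ypost1 : ∀ t, Measurable (fun u => Ypost1 u t)
  D_binary : ∀ u, D u = 0 ∨ D u = 1
  /-- the observed change has a finite mean at each time -/
  integrable_change : ∀ t,
    Integrable (fun u => D u * Ypost1 u t + (1 - D u) * Ypost0 u t - Ypre u t) P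
  /-- the treatment effect on the treated has a finite mean at each time -/
  integrable_effect : ∀ t, Integrable (fun u => Ypost1 u t - Ypost0 u t) (cond P {u | D u = 1})
  prop : (Fin d → ℝ) → ℝ
  reg0 : (Fin d → ℝ) → T → ℝ
  measurable_prop : Measurable prop
  measurable_reg0 : ∀ t, Measurable (fun x => reg0 x t)
  prop_spec : (fun u => prop (X u)) =ᵐ[P]
    condExp (MeasurableSpace.comap X inferInstance) P D
  reg0_spec : ∀ t, (fun u => reg0 (X u) t) =ᵐ[cond P {u | D u = 0}]
    condExp (MeasurableSpace.comap X inferInstance) (cond P {u | D u = 0})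
      (fun u => D u * Ypost1 u t + (1 - D u) * Ypost0 u t - Ypre u t)

/-- The doubly robust score at one time point,
`(D/p) (y - m) - (1 - D) π / (p (1 - π)) (y - m)`. -/
noncomputable def drScore (p D y π m : ℝ) : ℝ :=
  D / p * (y - m) - (1 - D) * π / (p * (1 - π)) * (y - m)

namespace Population

variable {𝒰 T : Type*} [MeasurableSpace 𝒰] {P : Measure 𝒰} {d : ℕ} (M : Population P T d)

/-- The observed change `ΔY = Y_1 - Y_0`, where `Y_1 = D Y^1_1 + (1 - D) Y^0_1`. -/
def change (u : 𝒰) (t : T) : ℝ :=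
  M.D u * M.Ypost1 u t + (1 - M.D u) * M.Ypost0 u t - M.Ypre u t

/-- The treated probability `p₀ = P(D = 1)`. -/
noncomputable def treatedProb : ℝ := P.real {u | M.D u = 1}

/-- The functional average treatment effect on the treated,
`τ₀(t) = E{Y^1_1(t) - Y^0_1(t) | D = 1}`. -/
noncomputable def fATT (t : T) : ℝ :=
  ∫ u, (M.Ypost1 u t - M.Ypost0 u t) ∂(cond P {u | M.D u = 1})

/-- The influence function `φ(W; η₀)(t) = ψ_{p₀}(W; η₀)(t) - (D / p₀) τ₀(t)`. -/
noncomputable def influence (u : 𝒰) (t : T) : ℝ :=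
  drScore M.treatedProb (M.D u) (M.change u t) (M.prop (M.X u)) (M.reg0 (M.X u) t)
    - M.D u / M.treatedProb * M.fATT t

/-- The covariance kernel `C(s,t) = Cov{φ(W; η₀)(s), φ(W; η₀)(t)}`. -/
noncomputable def covKernel (s t : T) : ℝ :=
  covariance (fun u => M.influence u s) (fun u => M.influence u t) P

/-- The standard deviation `σ(t) = C(t,t)^{1/2}`. -/
noncomputable def sigma (t : T) : ℝ := Real.sqrt (M.covKernel t t)

/-- Overlap: for some `c ∈ (0, 1/2)`, the propensity score lies in `[c, 1 - c]` almost surely. -/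
def Overlap : Prop :=
  ∃ c : ℝ, 0 < c ∧ c < 1 / 2 ∧ ∀ᵐ u ∂P, c ≤ M.prop (M.X u) ∧ M.prop (M.X u) ≤ 1 - c

/-- The influence functions `φ(·; η₀)(t)` have a square-integrable envelope. -/
def HasEnvelope : Prop :=
  ∃ Φ : 𝒰 → ℝ, MemLp Φ 2 P ∧ ∀ᵐ u ∂P, ∀ t, |M.influence u t| ≤ Φ u

end Population

/-! ### Sample, cross-fitting and estimators -/

/-- An i.i.d. sequence of units from the population, and for each sample size `n` (the sample
being `unit 0, …, unit (n - 1)`): a partition of the sample into `K` folds, nuisance estimators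
for each fold, and reconstructed change curves of the units (equal to the true ones if the curves
are fully observed).

The nuisance estimators of fold `k` are measurable with respect to the training information
`train n k`, which is independent of the units in fold `k`; this is the case when they are computed
from the units outside fold `k`, with or without additional independent randomness. -/
structure CrossFitSample {𝒰 T : Type*} [MeasurableSpace 𝒰] {P : Measure 𝒰} {d : ℕ}
    (M : Population P T d) {Ω : Type*} [mΩ : MeasurableSpace Ω] (μ : Measure Ω) (K : ℕ) where
  unit : ℕ → Ω → 𝒰
  unit_law : ∀ i, MeasurePreserving (unit i) μ P
  unit_indep : iIndepFun unit μ
  fold : ℕ → ℕ → Fin K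
  propHat : ℕ → Fin K → Ω → (Fin d → ℝ) → ℝ
  reg0Hat : ℕ → Fin K → Ω → (Fin d → ℝ) → T → ℝ
  train : ℕ → Fin K → MeasurableSpace Ω
  train_le : ∀ n k, train n k ≤ mΩ
  train_indep : ∀ n k, Indep (train n k)
    (⨆ i ∈ {i : ℕ | i < n ∧ fold n i = k}, MeasurableSpace.comap (unit i) inferInstance) μ
  measurable_propHat : ∀ n k,
    Measurable[(train n k).prod inferInstance] (fun q : Ω × (Fin d → ℝ) => propHat n k q.1 q.2)
  measurable_reg0Hat : ∀ n k t,
    Measurable[(train n k).prod inferInstance] (fun q : Ω × (Fin d → ℝ) => reg0Hat n k q.1 q.2 t)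
  changeHat : ℕ → ℕ → Ω → T → ℝ
  measurable_changeHat : ∀ n i t, Measurable (fun ω => changeHat n i ω t)

namespace CrossFitSample

variable {𝒰 T : Type*} [MeasurableSpace 𝒰] {P : Measure 𝒰} {d : ℕ} {M : Population P T d}
  {Ω : Type*} [MeasurableSpace Ω] {μ : Measure Ω} {K : ℕ} (S : CrossFitSample M μ K)

/-- The proportion of treated units, `p̂ = n⁻¹ ∑ D_i`. -/
noncomputable def pHat (n : ℕ) (ω : Ω) : ℝ := (∑ i ∈ Finset.range n, M.D (S.unit i ω)) / n

/-- The cross-fitted scores `ψ̂_i(t)`. -/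
noncomputable def scoreHat (n i : ℕ) (ω : Ω) (t : T) : ℝ :=
  drScore (S.pHat n ω) (M.D (S.unit i ω)) (S.changeHat n i ω t)
    (S.propHat n (S.fold n i) ω (M.X (S.unit i ω)))
    (S.reg0Hat n (S.fold n i) ω (M.X (S.unit i ω)) t)

/-- The cross-fitted doubly robust estimator `τ̂(t) = n⁻¹ ∑ ψ̂_i(t)`. -/
noncomputable def tauHat (n : ℕ) (ω : Ω) (t : T) : ℝ :=
  (∑ i ∈ Finset.range n, S.scoreHat n i ω t) / n

/-- The estimated influence contributions `φ̂_i(t) = ψ̂_i(t) - (D_i / p̂) τ̂(t)`. -/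
noncomputable def inflHat (n i : ℕ) (ω : Ω) (t : T) : ℝ :=
  S.scoreHat n i ω t - M.D (S.unit i ω) / S.pHat n ω * S.tauHat n ω t

/-- The average of the estimated influence contributions. -/
noncomputable def inflMean (n : ℕ) (ω : Ω) (t : T) : ℝ :=
  (∑ i ∈ Finset.range n, S.inflHat n i ω t) / n

/-- The standard deviation estimator `σ̂(t) = (n⁻¹ ∑ (φ̂_i(t) - mean)²)^{1/2}`. -/
noncomputable def sigmaHat (n : ℕ) (ω : Ω) (t : T) : ℝ :=
  Real.sqrt ((∑ i ∈ Finset.range n, (S.inflHat n i ω t - S.inflMean n ω t) ^ 2) / n)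

/-- The rescaled estimation error `√n (τ̂(t) - τ₀(t))`. -/
noncomputable def rootError (n : ℕ) (ω : Ω) (t : T) : ℝ :=
  Real.sqrt n * (S.tauHat n ω t - M.fATT t)

/-- The multiplier process `G*(t) = n^{-1/2} ∑ e_i (φ̂_i(t) - mean)` for multipliers `e_i`. -/
noncomputable def multPath (n : ℕ) (ω : Ω) (e : ℕ → ℝ) (t : T) : ℝ :=
  (∑ i ∈ Finset.range n, e i * (S.inflHat n i ω t - S.inflMean n ω t)) / Real.sqrt n

/-- The studentized multiplier process `G*(t) / σ̂(t)`. -/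
noncomputable def studMult (n : ℕ) (ω : Ω) (e : ℕ → ℝ) (t : T) : ℝ :=
  S.multPath n ω e t / S.sigmaHat n ω t

/-- With probability tending to one, the fitted propensities of the evaluation units lie in
`[c, 1 - c]`, for some `c ∈ (0, 1/2)`. -/
def FittedOverlap : Prop :=
  ∃ c : ℝ, 0 < c ∧ c < 1 / 2 ∧
    Tendsto (fun n => μ {ω | ¬ ∀ i < n,
      c ≤ S.propHat n (S.fold n i) ω (M.X (S.unit i ω)) ∧
        S.propHat n (S.fold n i) ω (M.X (S.unit i ω)) ≤ 1 - c}) atTop (𝓝 0)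

/-- The distribution function, given the data, of the maximum over the grid `G` of the absolute
studentized multiplier process; `ξ i` are multipliers on a probability space `(Ξ, Q)`. -/
noncomputable def gridBootCdf {Ξ : Type*} [MeasurableSpace Ξ] (Q : Measure Ξ) (ξ : ℕ → Ξ → ℝ)
    (G : Finset T) (n : ℕ) (ω : Ω) : ℝ → ℝ :=
  supCdf Q (fun (ζ : Ξ) (t : G) => S.studMult n ω (fun i => ξ i ζ) t)

open Classical in
/-- The empirical distribution function of the grid maxima of `B` bootstrap draws, the `b`-th
draw using the multipliers `e b`. -/
noncomputable def gridBootEcdf (G : Finset T) (B n : ℕ) (ω : Ω) (e : ℕ → ℕ → ℝ) (x : ℝ) : ℝ :=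
  (((Finset.range B).filter (fun b => ∀ t ∈ G, |S.studMult n ω (e b) t| ≤ x)).card : ℝ) / B

/-- The event (as a condition on the data) that the equal-precision band
`τ̂(t) ± c σ̂(t) / √n` contains `τ₀(t)` for all `t`. -/
def Covers (n : ℕ) (ω : Ω) (c : ℝ) : Prop :=
  ∀ t, M.fATT t ∈ Set.Icc (S.tauHat n ω t - c * S.sigmaHat n ω t / Real.sqrt n)
    (S.tauHat n ω t + c * S.sigmaHat n ω t / Real.sqrt n)

end CrossFitSample

/-- `ξ b i` are i.i.d. multipliers with mean zero and unit second moment. -/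
structure IsMultiplierArray {Ξ : Type*} [MeasurableSpace Ξ] (Q : Measure Ξ)
    (ξ : ℕ → ℕ → Ξ → ℝ) : Prop where
  measurable : ∀ b i, Measurable (ξ b i)
  indep : iIndepFun (fun q : ℕ × ℕ => ξ q.1 q.2) Q
  identDistrib : ∀ b i, IdentDistrib (ξ b i) (ξ 0 0) Q Q
  mean_zero : ∫ ζ, ξ 0 0 ζ ∂Q = 0
  second_moment : ∫ ζ, ξ 0 0 ζ ^ 2 ∂Q = 1

end FunctionalDiD

/-! Write N(z) = sup_t |z(t)|/σ(t), let F be the distribution function of N(Z) and x₀ its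
(1-α)-quantile. The band covers exactly when |√n(τ̂-τ₀)(t)| ≤ ĉ σ̂(t) for all t. If ĉ tends to x₀ in
probability, uniform consistency of σ̂ sandwiches this event between {|√n(τ̂-τ₀)| ≤ xσ everywhere}
for levels x slightly below and slightly above x₀. Weak convergence and the continuity of N on
`EllInfty` then give the limit F(x₀), which is 1-α because F is continuous at x₀
(`probTendsto_of_sandwich`, `probTendsto_covers`).

So everything rests on ĉ → x₀, and ĉ is a quantile of a maximum over the grid, whereas the bootstrap
hypothesis concerns the supremum over the whole interval. The two directions need different
arguments.

A grid maximum is at most the full supremum, so the grid bootstrap distribution function is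
asymptotically at least F (`eventually_lt_gridBootCdf`). This keeps ĉ below any x' > x₀ once F(x') >
1-α. That strict increase is not assumed. It holds because rotating two independent copies of Z
joins a path with small N to one with large N continuously, without changing the law
(`IsTightGaussian.measure_studNorm_lt`).

Conversely, the grid maximum dominates the maximum over finitely many grid points converging to
points of a dense sequence. At these points a conditional multiplier central limit theorem holds
(`eventually_measure_multPath_lt`), and finite-dimensional probabilities of Z decrease to F as the
set of points grows. Hence the bootstrap distribution function at y is eventually below any number
exceeding F(x), for y < x (`eventually_gridBootCdf_lt`). This central limit theorem needs the
estimated influence contributions to be consistent in empirical mean square along moving time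
points. Cross-fitting supplies that through a conditional Markov inequality
(`tendsto_avg_crossfit`), an algebraic bound for the error of one contribution
(`sq_influence_sub_le`), and the mean-square continuity of the influence function, inherited from
the continuous paths of Z, which has the same covariance kernel.

With finitely many draws, Chebyshev's inequality conditionally on the data transfers both bounds to
the empirical distribution function. Convergence in outer probability is treated throughout as
convergence along one filter on pairs (n, ω), so the usual limit calculus applies without
measurability of suprema. -/

namespace FunctionalDiD

/-! ### Convergence in outer probability as convergence along a filter -/

section ProbFilter

variable {Ω : Type*} [MeasurableSpace Ω] {μ : Measure Ω}

/-- The filter of those conditions on the sample size and the outcome that hold with outer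
probability tending to one; convergence in outer probability is convergence along this filter. -/
def probFilter (μ : Measure Ω) : Filter (ℕ × Ω) where
  sets := {s | Tendsto (fun n => μ {ω | (n, ω) ∉ s}) atTop (𝓝 0)}
  univ_sets := by simp
  sets_of_superset {s t} hs hst :=
    tendsto_of_tendsto_of_tendsto_of_le_of_le tendsto_const_nhds hs (fun _ => zero_le)
      (fun _ => measure_mono fun _ hω h => hω (hst h))
  inter_sets {s t} hs ht := by
    have h := Tendsto.add (show Tendsto _ _ _ from hs) (show Tendsto _ _ _ from ht)
    rw [add_zero] at h
    refine tendsto_of_tendsto_of_tendsto_of_le_of_le tendsto_const_nhds h (fun _ => zero_le)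
      (fun n => (measure_mono ?_).trans (measure_union_le _ _))
    intro ω hω
    by_contra hc
    simp only [Set.mem_union, Set.mem_ofPred_eq, not_or, not_not] at hc
    exact hω hc

lemma eventually_probFilter {p : ℕ × Ω → Prop} :
    (∀ᶠ q in probFilter μ, p q) ↔ Tendsto (fun n => μ {ω | ¬ p (n, ω)}) atTop (𝓝 0) := Iff.rfl

lemma isLittleOP_iff {R : ℕ → Ω → ℝ≥0∞} :
    IsLittleOP μ R ↔ Tendsto (fun q : ℕ × Ω => R q.1 q.2) (probFilter μ) (𝓝 0) := by
  rw [ENNReal.nhds_zero_basis.tendsto_right_iff]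
  refine forall₂_congr fun ε _ => ?_
  simp only [Set.mem_Iio, eventually_probFilter, not_lt]

lemma tendsto_fst_probFilter : Tendsto Prod.fst (probFilter μ) atTop := by
  refine tendsto_atTop.2 fun N => ?_
  rw [eventually_probFilter]
  refine tendsto_const_nhds.congr' ?_
  filter_upwards [eventually_ge_atTop N] with n hn
  simp [hn]

lemma eventually_probFilter_of_ae {p : ℕ → Ω → Prop} (h : ∀ n, ∀ᵐ ω ∂μ, p n ω) :
    ∀ᶠ q in probFilter μ, p q.1 q.2 := by
  rw [eventually_probFilter]
  refine tendsto_const_nhds.congr fun n => ?_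
  exact (ae_iff.1 (h n)).symm

lemma tendsto_probFilter_iff {f : ℕ → Ω → ℝ} {c : ℝ} :
    Tendsto (fun q : ℕ × Ω => f q.1 q.2) (probFilter μ) (𝓝 c) ↔
      TendstoInMeasure μ f atTop (fun _ => c) := by
  rw [tendstoInMeasure_iff_dist, Metric.tendsto_nhds]
  refine forall₂_congr fun ε _ => ?_
  simp only [eventually_probFilter, not_lt]

/-- Markov's inequality: nonnegative variables whose means tend to zero tend to zero in
probability. -/
lemma tendsto_probFilter_of_lintegral {f : ℕ → Ω → ℝ} (hf : ∀ n, AEMeasurable (f n) μ)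
    (h : Tendsto (fun n => ∫⁻ ω, ENNReal.ofReal (f n ω) ∂μ) atTop (𝓝 0))
    (h0 : ∀ n ω, 0 ≤ f n ω) :
    Tendsto (fun q : ℕ × Ω => f q.1 q.2) (probFilter μ) (𝓝 0) := by
  rw [tendsto_probFilter_iff, tendstoInMeasure_iff_dist]
  intro ε hε
  have h1 : Tendsto (fun n => (∫⁻ ω, ENNReal.ofReal (f n ω) ∂μ) / ENNReal.ofReal ε) atTop
      (𝓝 0) := by
    have := ENNReal.Tendsto.div_const h (b := ENNReal.ofReal ε)
      (Or.inr (by simpa using hε))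
    simpa using this
  refine tendsto_of_tendsto_of_tendsto_of_le_of_le tendsto_const_nhds h1 (fun _ => zero_le)
    fun n => ?_
  refine le_trans (measure_mono ?_) (meas_ge_le_lintegral_div (hf n).ennreal_ofReal
    (by simpa using hε) (by simp))
  intro ω hω
  simp only [Set.mem_ofPred_eq, Real.dist_eq, sub_zero, abs_of_nonneg (h0 n ω)] at hω ⊢
  exact ENNReal.ofReal_le_ofReal hω

end ProbFilter

/-! ### Laws of large numbers and maxima of i.i.d. sequences -/

section IIDSequence

variable {Ω 𝒰 : Type*} [MeasurableSpace Ω] [MeasurableSpace 𝒰] {μ : Measure Ω} {P : Measure 𝒰}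
  {U : ℕ → Ω → 𝒰}

/-- The weak law of large numbers. -/
lemma tendsto_average [IsProbabilityMeasure μ] (hU : ∀ i, MeasurePreserving (U i) μ P)
    (hind : iIndepFun U μ)
    {g : 𝒰 → ℝ} (hg : Measurable g) (hint : Integrable g P) :
    Tendsto (fun q : ℕ × Ω => (∑ i ∈ Finset.range q.1, g (U i q.2)) / q.1) (probFilter μ)
      (𝓝 (∫ u, g u ∂P)) := by
  refine tendsto_probFilter_iff (f := fun n ω => (∑ i ∈ Finset.range n, g (U i ω)) / n) |>.2 ?_
  have hm : ∀ i, Measurable (fun ω => g (U i ω)) := fun i => hg.comp (hU i).measurable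
  refine tendstoInMeasure_of_tendsto_ae
    (fun n => ((Finset.measurable_fun_sum _ fun i _ => hm i).div_const _).aestronglyMeasurable) ?_
  have key := strong_law_ae_real (μ := μ) (fun i ω => g (U i ω))
    ((hU 0).integrable_comp_of_integrable hint)
    (fun i j hij => (hind.indepFun hij).comp hg hg)
    (fun i => ⟨(hm i).aemeasurable, (hm 0).aemeasurable, by
      rw [← Function.comp_def g, ← Function.comp_def g, ← Measure.map_map hg (hU i).measurable,
        ← Measure.map_map hg (hU 0).measurable, (hU i).map_eq, (hU 0).map_eq]⟩)
  have e : ∫ ω, g (U 0 ω) ∂μ = ∫ u, g u ∂P := by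
    rw [← (hU 0).map_eq, integral_map (hU 0).measurable.aemeasurable hg.aestronglyMeasurable]
  rw [e] at key
  exact key

/-- For a square-integrable function, the largest of its first `n` values is `o_p(√n)`. -/
lemma eventually_forall_abs_le (hU : ∀ i, MeasurePreserving (U i) μ P)
    {g : 𝒰 → ℝ} (hg : Measurable g) (hint : Integrable (fun u => g u ^ 2) P) {δ : ℝ}
    (hδ : 0 < δ) :
    ∀ᶠ q in probFilter μ, ∀ i < q.1, |g (U i q.2)| ≤ δ * Real.sqrt q.1 := by
  have hlim : Tendsto (fun n : ℕ => ∫⁻ u in {u | δ ^ 2 * n < g u ^ 2}, ENNReal.ofReal (g u ^ 2) ∂P)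
      atTop (𝓝 0) := by
    have hs : ∀ n : ℕ, MeasurableSet {u | δ ^ 2 * n < g u ^ 2} := fun n =>
      measurableSet_lt measurable_const (hg.pow_const 2)
    simp_rw [← lintegral_indicator (hs _)]
    rw [show (0 : ℝ≥0∞) = ∫⁻ _u, (0 : ℝ≥0∞) ∂P by simp]
    refine tendsto_lintegral_of_dominated_convergence (fun u => ENNReal.ofReal (g u ^ 2))
      (fun n => ((hg.pow_const 2).ennreal_ofReal.indicator (hs n)))
      (fun n => Eventually.of_forall fun u => Set.indicator_le_self _ _ _) ?_ ?_
    · exact (hint.lintegral_lt_top).ne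
    · refine Eventually.of_forall fun u => ?_
      obtain ⟨N, hN⟩ := exists_nat_gt (g u ^ 2 / δ ^ 2)
      refine tendsto_const_nhds.congr' ?_
      filter_upwards [eventually_ge_atTop N] with n hn
      rw [Set.indicator_of_notMem]
      simp only [Set.mem_ofPred_eq, not_lt]
      rw [div_lt_iff₀ (by positivity)] at hN
      have : (N : ℝ) ≤ n := by exact_mod_cast hn
      nlinarith [sq_nonneg δ]
  have hlim2 : Tendsto (fun n : ℕ => ENNReal.ofReal (1 / δ ^ 2) *
      ∫⁻ u in {u | δ ^ 2 * n < g u ^ 2}, ENNReal.ofReal (g u ^ 2) ∂P) atTop (𝓝 0) := by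
    have := ENNReal.Tendsto.const_mul hlim (a := ENNReal.ofReal (1 / δ ^ 2))
      (Or.inr ENNReal.ofReal_ne_top)
    rwa [mul_zero] at this
  rw [eventually_probFilter]
  refine tendsto_of_tendsto_of_tendsto_of_le_of_le' tendsto_const_nhds hlim2
    (Eventually.of_forall fun _ => zero_le) ?_
  filter_upwards [eventually_gt_atTop 0] with n hn
  have hn' : (0 : ℝ) < n := by exact_mod_cast hn
  have hs : MeasurableSet {u | δ ^ 2 * n < g u ^ 2} :=
    measurableSet_lt measurable_const (hg.pow_const 2)
  have h1 : {ω | ¬ ∀ i < n, |g (U i ω)| ≤ δ * Real.sqrt n} ⊆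
      ⋃ i ∈ Finset.range n, U i ⁻¹' {u | δ ^ 2 * n < g u ^ 2} := by
    intro ω hω
    simp only [Set.mem_ofPred_eq, not_forall, not_le] at hω
    obtain ⟨i, hi, hlt⟩ := hω
    simp only [Finset.mem_range, Set.mem_iUnion, Set.mem_preimage, Set.mem_ofPred_eq]
    refine ⟨i, hi, ?_⟩
    have := mul_self_lt_mul_self (by positivity) hlt
    rw [abs_mul_abs_self] at this
    nlinarith [Real.mul_self_sqrt hn'.le]
  -- Markov's inequality with the second moment restricted to the tail: the factor n of the union
  -- bound cancels, and the tail moment still tends to zero.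
  have h2 : P {u | δ ^ 2 * n < g u ^ 2} ≤ ENNReal.ofReal (1 / (δ ^ 2 * n)) *
      ∫⁻ u in {u | δ ^ 2 * n < g u ^ 2}, ENNReal.ofReal (g u ^ 2) ∂P := by
    rw [← lintegral_const_mul _ (hg.pow_const 2).ennreal_ofReal, ← setLIntegral_one]
    refine setLIntegral_mono' hs fun u hu => ?_
    rw [← ENNReal.ofReal_mul (by positivity), ← ENNReal.ofReal_one]
    apply ENNReal.ofReal_le_ofReal
    rw [one_div, ← div_eq_inv_mul, le_div_iff₀ (by positivity), one_mul]
    exact le_of_lt hu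
  calc μ {ω | ¬ ∀ i < n, |g (U i ω)| ≤ δ * Real.sqrt n}
      ≤ ∑ i ∈ Finset.range n, μ (U i ⁻¹' {u | δ ^ 2 * n < g u ^ 2}) :=
        (measure_mono h1).trans (measure_biUnion_finset_le _ _)
    _ = n * P {u | δ ^ 2 * n < g u ^ 2} := by
        rw [Finset.sum_congr rfl fun i _ => (hU i).measure_preimage hs.nullMeasurableSet]
        simp
    _ ≤ n * (ENNReal.ofReal (1 / (δ ^ 2 * n)) *
      ∫⁻ u in {u | δ ^ 2 * n < g u ^ 2}, ENNReal.ofReal (g u ^ 2) ∂P) := by gcongr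
    _ = _ := by
        rw [← mul_assoc]
        congr 1
        rw [← ENNReal.ofReal_natCast, ← ENNReal.ofReal_mul hn'.le]
        congr 1
        field_simp

end IIDSequence

/-! ### A central limit theorem for weighted sums of i.i.d. multipliers -/

/-- Telescoping: the factors are exchanged one at a time, and all remaining factors have norm at
most one. -/
lemma norm_prod_sub_prod_le {ι : Type*} (s : Finset ι) (a b : ι → ℂ)
    (ha : ∀ i ∈ s, ‖a i‖ ≤ 1) (hb : ∀ i ∈ s, ‖b i‖ ≤ 1) :
    ‖∏ i ∈ s, a i - ∏ i ∈ s, b i‖ ≤ ∑ i ∈ s, ‖a i - b i‖ := by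
  classical
  induction s using Finset.induction_on with
  | empty => simp
  | insert j s hj ih =>
    rw [Finset.prod_insert hj, Finset.prod_insert hj, Finset.sum_insert hj]
    have ih' := ih (fun i hi => ha i (Finset.mem_insert_of_mem hi))
      (fun i hi => hb i (Finset.mem_insert_of_mem hi))
    have h1 : ‖∏ i ∈ s, b i‖ ≤ 1 := by
      rw [norm_prod]
      exact Finset.prod_le_one (fun _ _ => norm_nonneg _)
        fun i hi => hb i (Finset.mem_insert_of_mem hi)
    have h2 := ha j (Finset.mem_insert_self _ _)
    calc ‖a j * ∏ i ∈ s, a i - b j * ∏ i ∈ s, b i‖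
        = ‖a j * (∏ i ∈ s, a i - ∏ i ∈ s, b i) + (a j - b j) * ∏ i ∈ s, b i‖ := by
          congr 1; ring
      _ ≤ ‖a j‖ * ‖∏ i ∈ s, a i - ∏ i ∈ s, b i‖ + ‖a j - b j‖ * ‖∏ i ∈ s, b i‖ := by
          refine (norm_add_le _ _).trans ?_
          rw [norm_mul, norm_mul]
      _ ≤ 1 * ‖∏ i ∈ s, a i - ∏ i ∈ s, b i‖ + ‖a j - b j‖ * 1 := by gcongr
      _ ≤ _ := by linarith

/-- Products of values of a characteristic function with a centred second order expansion. -/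
lemma tendsto_prod_of_isLittleO {f : ℝ → ℂ} (hf1 : ∀ u, ‖f u‖ ≤ 1)
    (hf : (fun u : ℝ => f u - (1 - (u : ℂ) ^ 2 / 2)) =o[𝓝 0] fun u : ℝ => u ^ 2)
    {N : ℕ → ℕ} {w : ℕ → ℕ → ℝ} {v : ℝ}
    (hv : Tendsto (fun l => ∑ i ∈ Finset.range (N l), w l i ^ 2) atTop (𝓝 v))
    (hmax : ∀ δ : ℝ, 0 < δ → ∀ᶠ l in atTop, ∀ i < N l, |w l i| ≤ δ) :
    Tendsto (fun l => ∏ i ∈ Finset.range (N l), f (w l i)) atTop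
      (𝓝 (Complex.exp (-(v : ℂ) / 2))) := by
  -- The comparison factor exp(-u²/2): its product depends on the weights only through the sum of
  -- their squares, and it agrees with f up to o(u²).
  set g : ℝ → ℂ := fun u => Complex.exp (-(u : ℂ) ^ 2 / 2) with hg
  have hprod : ∀ l, ∏ i ∈ Finset.range (N l), g (w l i) =
      Complex.exp (-((∑ i ∈ Finset.range (N l), w l i ^ 2 : ℝ) : ℂ) / 2) := by
    intro l
    rw [hg, ← Complex.exp_sum]
    congr 1
    push_cast
    rw [neg_div, Finset.sum_div, ← Finset.sum_neg_distrib]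
    exact Finset.sum_congr rfl fun i _ => by ring
  have hglim : Tendsto (fun l => ∏ i ∈ Finset.range (N l), g (w l i)) atTop
      (𝓝 (Complex.exp (-(v : ℂ) / 2))) := by
    simp_rw [hprod]
    have : Continuous fun x : ℝ => Complex.exp (-(x : ℂ) / 2) := by fun_prop
    exact (this.tendsto v).comp hv
  have hgnorm : ∀ u, ‖g u‖ ≤ 1 := by
    intro u
    rw [hg, Complex.norm_exp]
    have : (-(u : ℂ) ^ 2 / 2).re = -(u ^ 2) / 2 := by
      have : (-(u : ℂ) ^ 2 / 2) = ((-(u ^ 2) / 2 : ℝ) : ℂ) := by push_cast; ring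
      rw [this, Complex.ofReal_re]
    rw [this]
    exact Real.exp_le_one_iff.2 (by nlinarith [sq_nonneg u])
  have hfg : (fun u : ℝ => f u - g u) =o[𝓝 0] fun u : ℝ => u ^ 2 := by
    have h2 : (fun u : ℝ => g u - (1 - (u : ℂ) ^ 2 / 2)) =o[𝓝 0] fun u : ℝ => u ^ 2 := by
      have hd : HasDerivAt (fun z : ℂ => Complex.exp z) 1 0 := by
        simpa using Complex.hasDerivAt_exp 0
      have ho := hasDerivAt_iff_isLittleO_nhds_zero.1 hd
      have ht : Tendsto (fun u : ℝ => -(u : ℂ) ^ 2 / 2) (𝓝 0) (𝓝 0) := by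
        have : Continuous fun u : ℝ => -(u : ℂ) ^ 2 / 2 := by fun_prop
        simpa using this.tendsto 0
      have ho' := ho.comp_tendsto ht
      have hO : (fun u : ℝ => -(u : ℂ) ^ 2 / 2) =O[𝓝 0] fun u : ℝ => u ^ 2 := by
        refine Asymptotics.IsBigO.of_bound 1 (Eventually.of_forall fun u => ?_)
        simp only [norm_div, norm_neg, norm_pow, Complex.norm_real, Complex.norm_ofNat]
        nlinarith [sq_nonneg ‖u‖]
      refine (ho'.trans_isBigO hO).congr_left fun u => ?_
      simp only [hg, Function.comp_apply, zero_add, Complex.exp_zero, smul_eq_mul, mul_one]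
      ring
    exact (hf.sub h2).congr_left fun u => by ring
  suffices Tendsto (fun l => ∏ i ∈ Finset.range (N l), f (w l i) -
      ∏ i ∈ Finset.range (N l), g (w l i)) atTop (𝓝 0) by
    simpa using this.add hglim
  rw [Metric.tendsto_nhds]
  intro ε hε
  -- The sum of squares is eventually below |v| + 1, so the denominator |v| + 2 leaves a strict
  -- inequality at the end.
  have hc : 0 < ε / (|v| + 2) := by positivity
  obtain ⟨δ, hδ, hδf⟩ := Metric.eventually_nhds_iff.1 (hfg.def hc)
  have hvb : ∀ᶠ l in atTop, ∑ i ∈ Finset.range (N l), w l i ^ 2 < |v| + 1 :=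
    hv.eventually (gt_mem_nhds (by linarith [le_abs_self v]))
  filter_upwards [hmax (δ / 2) (by positivity), hvb] with l hl hvl
  rw [dist_zero_right]
  calc ‖∏ i ∈ Finset.range (N l), f (w l i) - ∏ i ∈ Finset.range (N l), g (w l i)‖
      ≤ ∑ i ∈ Finset.range (N l), ‖f (w l i) - g (w l i)‖ :=
        norm_prod_sub_prod_le _ _ _ (fun i _ => hf1 _) (fun i _ => hgnorm _)
    _ ≤ ∑ i ∈ Finset.range (N l), ε / (|v| + 2) * w l i ^ 2 := by
        refine Finset.sum_le_sum fun i hi => ?_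
        have := hδf (y := w l i) (by
          rw [Real.dist_eq, sub_zero]
          linarith [hl i (Finset.mem_range.1 hi)])
        simpa using this
    _ = ε / (|v| + 2) * ∑ i ∈ Finset.range (N l), w l i ^ 2 := by rw [Finset.mul_sum]
    _ ≤ ε / (|v| + 2) * (|v| + 1) := by gcongr
    _ < ε := by
        rw [div_mul_eq_mul_div, div_lt_iff₀ (by positivity)]
        nlinarith [abs_nonneg v]

section Multiplier

variable {Ξ : Type*} [MeasurableSpace Ξ] {Q : Measure Ξ} {m : ℕ}

/-- The vector of weighted multiplier sums `∑ i, w i j * e i`. -/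
noncomputable def multSum (N : ℕ) (w : ℕ → Fin m → ℝ) (e : ℕ → ℝ) : EuclideanSpace ℝ (Fin m) :=
  WithLp.toLp 2 fun j => ∑ i ∈ Finset.range N, w i j * e i

lemma measurable_multSum {ξ : ℕ → Ξ → ℝ} (hm : ∀ i, Measurable (ξ i)) (N : ℕ)
    (w : ℕ → Fin m → ℝ) : Measurable fun ζ => multSum N w (fun i => ξ i ζ) := by
  unfold multSum
  refine (WithLp.measurable_toLp 2 _).comp ?_
  exact measurable_pi_lambda _ fun j => Finset.measurable_fun_sum _ fun i _ => (hm i).const_mul _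

/-- The inner product with x collapses the vector to one weighted sum of independent variables,
whose characteristic function factorizes. -/
lemma charFun_multSum {ξ : ℕ → Ξ → ℝ} (hm : ∀ i, Measurable (ξ i)) (hind : iIndepFun ξ Q)
    (hid : ∀ i, IdentDistrib (ξ i) (ξ 0) Q Q) (N : ℕ) (w : ℕ → Fin m → ℝ)
    (x : EuclideanSpace ℝ (Fin m)) :
    charFun (Q.map fun ζ => multSum N w (fun i => ξ i ζ)) x =
      ∏ i ∈ Finset.range N, charFun (Q.map (ξ 0)) (∑ j, w i j * x j) := by
  have e1 : charFun (Q.map fun ζ => multSum N w (fun i => ξ i ζ)) x =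
      charFun (Q.map fun ζ => ∑ i ∈ Finset.range N, (∑ j, w i j * x j) * ξ i ζ) 1 := by
    rw [charFun_apply, charFun_apply,
      integral_map (measurable_multSum hm N w).aemeasurable (by fun_prop),
      integral_map (Finset.measurable_fun_sum _ fun i _ => (hm i).const_mul _).aemeasurable
        (by fun_prop)]
    congr 1
    ext ζ
    congr 3
    simp only [multSum, PiLp.inner_apply, RCLike.inner_apply, conj_trivial,
      Finset.mul_sum, Finset.sum_mul, one_mul]
    rw [Finset.sum_comm]
    exact Finset.sum_congr rfl fun i _ => Finset.sum_congr rfl fun j _ => by ring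
  have hind' : iIndepFun (fun i ζ => (∑ j, w i j * x j) * ξ i ζ) Q :=
    hind.comp (fun i y => (∑ j, w i j * x j) * y) (fun i => by fun_prop)
  rw [e1, (hind'.restrict _).charFun_map_fun_finsetSum_eq_prod
    (fun i _ => ((hm i).const_mul _).aemeasurable), Finset.prod_apply]
  refine Finset.prod_congr rfl fun i _ => ?_
  rw [charFun_map_mul_comp, mul_one, (hid i).map_eq]
  exact (hm i).aemeasurable

lemma sum_sq_eq_sum_gram (N : ℕ) (w : ℕ → Fin m → ℝ) (x : Fin m → ℝ) :
    ∑ i ∈ Finset.range N, (∑ j, w i j * x j) ^ 2 =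
      ∑ j, ∑ k, x j * x k * ∑ i ∈ Finset.range N, w i j * w i k := by
  simp_rw [pow_two, Finset.sum_mul_sum, Finset.mul_sum]
  rw [Finset.sum_comm]
  refine Finset.sum_congr rfl fun j _ => ?_
  rw [Finset.sum_comm]
  exact Finset.sum_congr rfl fun k _ => Finset.sum_congr rfl fun i _ => by ring

/-- The multiplier central limit theorem: weighted multiplier sums whose weights have a
convergent Gram matrix and are uniformly small converge to a centred Gaussian vector. -/
lemma eventually_measure_multSum_lt_seq [IsProbabilityMeasure Q] {ξ : ℕ → Ξ → ℝ}
    (hm : ∀ i, Measurable (ξ i))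
    (hind : iIndepFun ξ Q) (hid : ∀ i, IdentDistrib (ξ i) (ξ 0) Q Q) (h0 : ∫ ζ, ξ 0 ζ ∂Q = 0)
    (h1 : ∫ ζ, ξ 0 ζ ^ 2 ∂Q = 1) {ν : Measure (EuclideanSpace ℝ (Fin m))}
    [IsProbabilityMeasure ν] {Γ : Fin m → Fin m → ℝ}
    (hν : ∀ x, charFun ν x = Complex.exp (-((∑ j, ∑ k, x j * x k * Γ j k : ℝ) : ℂ) / 2))
    {N : ℕ → ℕ} {w : ℕ → ℕ → Fin m → ℝ}
    (hgram : ∀ j k, Tendsto (fun l => ∑ i ∈ Finset.range (N l), w l i j * w l i k) atTop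
      (𝓝 (Γ j k)))
    (hmax : ∀ δ : ℝ, 0 < δ → ∀ᶠ l in atTop, ∀ i < N l, ∀ j, |w l i j| ≤ δ)
    {F : Set (EuclideanSpace ℝ (Fin m))} (hF : IsClosed F) {r : ℝ≥0∞} (hr : ν F < r) :
    ∀ᶠ l in atTop, Q {ζ | multSum (N l) (w l) (fun i => ξ i ζ) ∈ F} < r := by
  have hlaw : ∀ l, IsProbabilityMeasure (Q.map fun ζ => multSum (N l) (w l) (fun i => ξ i ζ)) :=
    fun l => Measure.isProbabilityMeasure_map (measurable_multSum hm _ _).aemeasurable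
  have : IsProbabilityMeasure (Q.map (ξ 0)) :=
    Measure.isProbabilityMeasure_map (hm 0).aemeasurable
  let law : ℕ → ProbabilityMeasure (EuclideanSpace ℝ (Fin m)) := fun l =>
    ⟨Q.map fun ζ => multSum (N l) (w l) (fun i => ξ i ζ), hlaw l⟩
  let limit : ProbabilityMeasure (EuclideanSpace ℝ (Fin m)) := ⟨ν, inferInstance⟩
  have hconv : Tendsto law atTop (𝓝 limit) := by
    refine ProbabilityMeasure.tendsto_iff_tendsto_charFun.2 fun x => ?_
    have e1 : ∀ l, charFun (law l : Measure (EuclideanSpace ℝ (Fin m))) x =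
        ∏ i ∈ Finset.range (N l), charFun (Q.map (ξ 0)) (∑ j, w l i j * x j) :=
      fun l => charFun_multSum hm hind hid _ _ x
    have e2 : charFun (limit : Measure (EuclideanSpace ℝ (Fin m))) x = _ := hν x
    rw [e2, funext e1]
    refine tendsto_prod_of_isLittleO (f := charFun (Q.map (ξ 0)))
      (w := fun l i => ∑ j, w l i j * x j) (v := ∑ j, ∑ k, x j * x k * Γ j k)
      (fun u => norm_charFun_le_one _) (taylor_charFun_two (hm 0).aemeasurable h0 h1) ?_ ?_
    · have key : Tendsto (fun l => ∑ j, ∑ k, x j * x k *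
          ∑ i ∈ Finset.range (N l), w l i j * w l i k) atTop
          (𝓝 (∑ j, ∑ k, x j * x k * Γ j k)) :=
        tendsto_finsetSum _ fun j _ => tendsto_finsetSum _ fun k _ => (hgram j k).const_mul _
      exact key.congr fun l => (sum_sq_eq_sum_gram (N l) (w l) (fun j => x j)).symm
    · intro δ hδ
      have hpos : 0 < δ / (∑ j, |x j| + 1) := by positivity
      filter_upwards [hmax _ hpos] with l hl i hi
      calc |∑ j, w l i j * x j| ≤ ∑ j, |w l i j * x j| := Finset.abs_sum_le_sum_abs _ _
        _ ≤ ∑ j, δ / (∑ j, |x j| + 1) * |x j| := by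
            refine Finset.sum_le_sum fun j _ => ?_
            rw [abs_mul]
            exact mul_le_mul_of_nonneg_right (hl i hi j) (abs_nonneg _)
        _ = δ / (∑ j, |x j| + 1) * ∑ j, |x j| := by rw [Finset.mul_sum]
        _ ≤ δ := by
            rw [div_mul_eq_mul_div, div_le_iff₀ (by positivity)]
            nlinarith [Finset.sum_nonneg fun j (_ : j ∈ Finset.univ) => abs_nonneg (x j)]
  have hle : limsup (fun l => (law l : Measure (EuclideanSpace ℝ (Fin m))) F) atTop ≤ ν F :=
    ProbabilityMeasure.limsup_measure_closed_le_of_tendsto hconv hF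
  have hlt := eventually_lt_of_limsup_lt (hle.trans_lt hr)
  filter_upwards [hlt] with l hl
  have e : (law l : Measure (EuclideanSpace ℝ (Fin m))) F = _ :=
    Measure.map_apply (measurable_multSum hm _ _) hF.measurableSet
  rw [e] at hl
  exact hl

/-- The multiplier central limit theorem along an arbitrary filter. -/
lemma eventually_measure_multSum_lt [IsProbabilityMeasure Q] {ξ : ℕ → Ξ → ℝ}
    (hm : ∀ i, Measurable (ξ i))
    (hind : iIndepFun ξ Q) (hid : ∀ i, IdentDistrib (ξ i) (ξ 0) Q Q) (h0 : ∫ ζ, ξ 0 ζ ∂Q = 0)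
    (h1 : ∫ ζ, ξ 0 ζ ^ 2 ∂Q = 1) {ν : Measure (EuclideanSpace ℝ (Fin m))}
    [IsProbabilityMeasure ν] {Γ : Fin m → Fin m → ℝ}
    (hν : ∀ x, charFun ν x = Complex.exp (-((∑ j, ∑ k, x j * x k * Γ j k : ℝ) : ℂ) / 2))
    {ι : Type*} {L : Filter ι} {N : ι → ℕ} {w : ι → ℕ → Fin m → ℝ}
    (hgram : ∀ j k, Tendsto (fun l => ∑ i ∈ Finset.range (N l), w l i j * w l i k) L
      (𝓝 (Γ j k)))
    (hmax : ∀ δ : ℝ, 0 < δ → ∀ᶠ l in L, ∀ i < N l, ∀ j, |w l i j| ≤ δ)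
    {F : Set (EuclideanSpace ℝ (Fin m))} (hF : IsClosed F) {r : ℝ≥0∞} (hr : ν F < r) :
    ∀ᶠ l in L, Q {ζ | multSum (N l) (w l) (fun i => ξ i ζ) ∈ F} < r := by
  let gram : ι → Fin m → Fin m → ℝ := fun l j k => ∑ i ∈ Finset.range (N l), w l i j * w l i k
  let size : ι → NNReal := fun l => (Finset.range (N l)).sup fun i => ‖w l i‖₊
  have hsize : ∀ (l : ι) (δ : NNReal), size l ≤ δ ↔ ∀ i < N l, ∀ j, |w l i j| ≤ δ := by
    intro l δ
    simp only [size, Finset.sup_le_iff, Finset.mem_range]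
    refine forall₂_congr fun i _ => ?_
    rw [← NNReal.coe_le_coe, coe_nnnorm, pi_norm_le_iff_of_nonneg (NNReal.coe_nonneg δ)]
    rfl
  -- The filter L need not be countably generated, but the hypotheses only say that the Gram matrix
  -- and the largest weight converge. The coarser filter L' encoding just this is countably
  -- generated, so a failure would occur along a sequence, where the sequential theorem excludes it.
  -- Applied with `probFilter`, this makes a deterministic theorem a conditional one in probability.
  let L' : Filter ι := comap gram (𝓝 Γ) ⊓ comap size (𝓝 0)
  have hL : L ≤ L' := by
    refine le_inf (tendsto_iff_comap.1 (tendsto_pi_nhds.2 fun j => tendsto_pi_nhds.2 fun k =>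
      hgram j k)) (tendsto_iff_comap.1 ?_)
    rw [NNReal.nhds_zero_basis.tendsto_right_iff]
    intro ε hε
    filter_upwards [hmax (ε / 2 : NNReal) (by positivity)] with l hl
    exact ((hsize l _).2 hl).trans_lt (NNReal.half_lt_self hε.ne')
  refine hL ?_
  by_contra hcon
  obtain ⟨ns, hns, hbad⟩ := exists_seq_forall_of_frequently (l := L') (by
    simpa only [Filter.Frequently] using (not_eventually.1 hcon))
  have hns1 : Tendsto (gram ∘ ns) atTop (𝓝 Γ) :=
    tendsto_comap_iff.1 (hns.mono_right inf_le_left)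
  have hns2 : Tendsto (size ∘ ns) atTop (𝓝 0) :=
    tendsto_comap_iff.1 (hns.mono_right inf_le_right)
  have := eventually_measure_multSum_lt_seq hm hind hid h0 h1 hν (N := N ∘ ns)
    (w := fun l => w (ns l))
    (fun j k => tendsto_pi_nhds.1 (tendsto_pi_nhds.1 hns1 j) k)
    (fun δ hδ => by
      have h := hns2.eventually (ge_mem_nhds (show (0 : NNReal) < ⟨δ, hδ.le⟩ from hδ))
      filter_upwards [h] with l hl
      exact (hsize (ns l) ⟨δ, hδ.le⟩).1 hl) hF hr
  obtain ⟨l, hl⟩ := this.exists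
  exact hbad l hl

end Multiplier

/-! ### The weighted supremum norm on `ℓ^∞(T)` -/

section StudNorm

variable {T : Type*} {σ : T → ℝ} {c : ℝ}

/-- The studentized supremum norm `sup_t |z t| / σ t`. -/
noncomputable def studNorm (σ : T → ℝ) (z : EllInfty T) : ℝ := ⨆ t, |z t| / σ t

lemma abs_apply_le_norm (z : EllInfty T) (t : T) : |z t| ≤ ‖z‖ :=
  lp.norm_apply_le_norm (by simp) z t

lemma bddAbove_studNorm (hc : 0 < c) (hσ : ∀ t, c ≤ σ t) (z : EllInfty T) :
    BddAbove (Set.range fun t => |z t| / σ t) := by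
  refine ⟨‖z‖ / c, ?_⟩
  rintro _ ⟨t, rfl⟩
  exact div_le_div₀ (norm_nonneg _) (abs_apply_le_norm z t) hc (hσ t)

lemma studNorm_le_iff [Nonempty T] (hc : 0 < c) (hσ : ∀ t, c ≤ σ t) (z : EllInfty T) {x : ℝ} :
    studNorm σ z ≤ x ↔ ∀ t, |z t| ≤ x * σ t := by
  rw [studNorm, ciSup_le_iff (bddAbove_studNorm hc hσ z)]
  exact forall_congr' fun t => div_le_iff₀ (hc.trans_le (hσ t))

lemma studNorm_le_add [Nonempty T] (hc : 0 < c) (hσ : ∀ t, c ≤ σ t) (z w : EllInfty T) :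
    studNorm σ z ≤ studNorm σ w + ‖z - w‖ / c := by
  rw [studNorm_le_iff hc hσ]
  intro t
  have h1 := (studNorm_le_iff hc hσ w).1 le_rfl t
  have h2 : |z t - w t| ≤ ‖z - w‖ := by
    have := abs_apply_le_norm (z - w) t
    simpa using this
  have h3 : ‖z - w‖ ≤ ‖z - w‖ / c * σ t := by
    rw [div_mul_eq_mul_div, le_div_iff₀ hc]
    exact mul_le_mul_of_nonneg_left (hσ t) (norm_nonneg _)
  have h4 : |z t| ≤ |w t| + |z t - w t| := by
    have := abs_add_le (w t) (z t - w t)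
    simpa using this
  linarith [add_mul (studNorm σ w) (‖z - w‖ / c) (σ t)]

/-- Lipschitz with constant 1/c, since σ ≥ c. This makes sublevel and superlevel sets of the norm
closed, as the portmanteau inequality requires. -/
lemma continuous_studNorm [Nonempty T] (hc : 0 < c) (hσ : ∀ t, c ≤ σ t) :
    Continuous (studNorm σ) := by
  refine LipschitzWith.continuous (K := (Real.toNNReal (1 / c)))
    (LipschitzWith.of_dist_le_mul fun z w => ?_)
  rw [Real.dist_eq, dist_eq_norm, Real.coe_toNNReal _ (by positivity), one_div, ← div_eq_inv_mul,
    abs_sub_le_iff]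
  constructor
  · linarith [studNorm_le_add hc hσ z w]
  · rw [norm_sub_rev]
    linarith [studNorm_le_add hc hσ w z]

lemma continuous_ellInfty_eval (t : T) : Continuous fun z : EllInfty T => z t := by
  refine LipschitzWith.continuous (K := 1) (LipschitzWith.of_dist_le_mul fun z w => ?_)
  rw [Real.dist_eq, dist_eq_norm, NNReal.coe_one, one_mul]
  have := abs_apply_le_norm (z - w) t
  simpa using this

end StudNorm

/-! ### Tight Gaussian processes -/

namespace IsTightGaussian

variable {Ω₀ T : Type*} [MeasurableSpace Ω₀] {P₀ : Measure Ω₀}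
  {Z : Ω₀ → EllInfty T} {C : T → T → ℝ}

lemma measurable_eval (hZ : IsTightGaussian P₀ Z C) (t : T) : Measurable fun ω => Z ω t := by
  let _ : MeasurableSpace (EllInfty T) := borel _
  have : BorelSpace (EllInfty T) := ⟨rfl⟩
  exact (continuous_ellInfty_eval t).measurable.comp hZ.measurable

lemma memLp_eval (hZ : IsTightGaussian P₀ Z C) (t : T) : MemLp (fun ω => Z ω t) 2 P₀ :=
  (hZ.gaussian.hasGaussianLaw_eval t).memLp_two

lemma variance_eval (hZ : IsTightGaussian P₀ Z C) (t : T) : Var[fun ω => Z ω t; P₀] = C t t := by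
  rw [← hZ.covariance, covariance_self (hZ.measurable_eval t).aemeasurable]

end IsTightGaussian

section GaussianReal

variable {Ω₀ : Type*} [MeasurableSpace Ω₀] {P₀ : Measure Ω₀}

lemma charFun_one_of_hasGaussianLaw {X : Ω₀ → ℝ} (hX : HasGaussianLaw X P₀)
    (h0 : ∫ ω, X ω ∂P₀ = 0) :
    charFun (P₀.map X) 1 = Complex.exp (-(Var[X; P₀] : ℂ) / 2) := by
  rw [hX.map_eq_gaussianReal, charFun_gaussianReal, h0, Real.coe_toNNReal _ (variance_nonneg _ _)]
  congr 1
  push_cast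
  ring

/-- Almost sure convergence of centred Gaussian variables entails that of their variances. -/
lemma tendsto_variance_of_ae_tendsto [IsProbabilityMeasure P₀] {ι : Type*} {l : Filter ι}
    [l.IsCountablyGenerated] {X : ι → Ω₀ → ℝ} {Y : Ω₀ → ℝ}
    (hX : ∀ i, HasGaussianLaw (X i) P₀) (hX0 : ∀ i, ∫ ω, X i ω ∂P₀ = 0)
    (hY : HasGaussianLaw Y P₀) (hY0 : ∫ ω, Y ω ∂P₀ = 0)
    (h : ∀ᵐ ω ∂P₀, Tendsto (fun i => X i ω) l (𝓝 (Y ω))) :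
    Tendsto (fun i => Var[X i; P₀]) l (𝓝 Var[Y; P₀]) := by
  -- The characteristic function at 1 is bounded and equals exp(-Var/2). Dominated convergence
  -- therefore applies without any uniform integrability, and a logarithm recovers the variances.
  have hc : ∀ {W : Ω₀ → ℝ}, HasGaussianLaw W P₀ → ∫ ω, W ω ∂P₀ = 0 →
      ∫ ω, Complex.exp ((W ω : ℂ) * Complex.I) ∂P₀ = (Real.exp (-Var[W; P₀] / 2) : ℂ) := by
    intro W hW hW0
    have := charFun_one_of_hasGaussianLaw hW hW0
    rw [charFun_apply, integral_map hW.aemeasurable (by fun_prop)] at this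
    push_cast
    rw [← this]
    simp
  have h1 : Tendsto (fun i => ∫ ω, Complex.exp ((X i ω : ℂ) * Complex.I) ∂P₀) l
      (𝓝 (∫ ω, Complex.exp ((Y ω : ℂ) * Complex.I) ∂P₀)) := by
    refine tendsto_integral_filter_of_dominated_convergence (fun _ => 1) ?_ ?_
      (integrable_const _) ?_
    · refine Eventually.of_forall fun i => ?_
      have : Continuous fun x : ℝ => Complex.exp ((x : ℂ) * Complex.I) := by fun_prop
      exact (this.measurable.comp_aemeasurable (hX i).aemeasurable).aestronglyMeasurable
    · exact Eventually.of_forall fun i => Eventually.of_forall fun ω => by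
        rw [Complex.norm_exp_ofReal_mul_I]
    · filter_upwards [h] with ω hω
      have : Continuous fun x : ℝ => Complex.exp ((x : ℂ) * Complex.I) := by fun_prop
      exact (this.tendsto _).comp hω
  simp_rw [hc (hX _) (hX0 _), hc hY hY0] at h1
  have h2 := (Complex.continuous_re.tendsto _).comp h1
  have h3 : Tendsto (fun i => Real.exp (-Var[X i; P₀] / 2)) l (𝓝 (Real.exp (-Var[Y; P₀] / 2))) := by
    simpa only [Function.comp_def, Complex.ofReal_re] using h2
  have h4 := (Real.continuousAt_log (Real.exp_pos _).ne').tendsto.comp h3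
  simp only [Function.comp_def, Real.log_exp] at h4
  have h5 := h4.const_mul (-2)
  refine (h5.congr fun i => by ring).trans (le_of_eq ?_)
  congr 1
  ring

end GaussianReal

namespace IsTightGaussian

variable {Ω₀ T : Type*} [MeasurableSpace Ω₀] {P₀ : Measure Ω₀} [IsProbabilityMeasure P₀]
  {Z : Ω₀ → EllInfty T} {C : T → T → ℝ}

/-- Cramér–Wold: a linear combination of values of a Gaussian process is Gaussian with variance
given by the quadratic form of C. -/
lemma charFun_fidi (hZ : IsTightGaussian P₀ Z C) {m : ℕ} (t : Fin m → T)
    (x : EuclideanSpace ℝ (Fin m)) :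
    charFun (P₀.map fun ω => (WithLp.toLp 2 fun j => Z ω (t j) : EuclideanSpace ℝ (Fin m))) x =
      Complex.exp (-((∑ j, ∑ k, x j * x k * C (t j) (t k) : ℝ) : ℂ) / 2) := by
  have hgp : IsGaussianProcess (fun (j : Fin m) ω => x j * Z ω (t j)) P₀ :=
    (hZ.gaussian.comp_right t).smul fun j => x j
  have hsum : HasGaussianLaw (fun ω => ∑ j, x j * Z ω (t j)) P₀ :=
    hgp.hasGaussianLaw_fun_sum (I := Finset.univ)
  have h0 : ∫ ω, ∑ j, x j * Z ω (t j) ∂P₀ = 0 := by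
    rw [integral_finsetSum _ fun j _ => ((hZ.memLp_eval (t j)).integrable (by simp)).const_mul _]
    refine Finset.sum_eq_zero fun j _ => ?_
    rw [integral_const_mul, hZ.mean_zero, mul_zero]
  have hvar : Var[fun ω => ∑ j, x j * Z ω (t j); P₀] =
      ∑ j, ∑ k, x j * x k * C (t j) (t k) := by
    rw [variance_fun_sum fun j => (hZ.memLp_eval (t j)).const_mul (x j)]
    refine Finset.sum_congr rfl fun j _ => Finset.sum_congr rfl fun k _ => ?_
    rw [covariance_const_mul_left, covariance_const_mul_right, hZ.covariance, mul_assoc]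
  have hmeas : Measurable fun ω =>
      (WithLp.toLp 2 fun j => Z ω (t j) : EuclideanSpace ℝ (Fin m)) :=
    (WithLp.measurable_toLp 2 _).comp (measurable_pi_lambda _ fun j => hZ.measurable_eval (t j))
  rw [← hvar, ← charFun_one_of_hasGaussianLaw hsum h0, charFun_apply, charFun_apply,
    integral_map hmeas.aemeasurable (by fun_prop), integral_map hsum.aemeasurable (by fun_prop)]
  congr 1
  ext ω
  congr 3
  simp [PiLp.inner_apply]

lemma variance_sub_eval (hZ : IsTightGaussian P₀ Z C) (s t : T) :
    Var[fun ω => Z ω s - Z ω t; P₀] = C s s - 2 * C s t + C t t := by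
  rw [variance_fun_sub (hZ.memLp_eval s) (hZ.memLp_eval t), hZ.variance_eval, hZ.variance_eval,
    hZ.covariance]

/-- Path continuity passes to variances of Gaussian variables. This is the source of the continuity
of σ. -/
lemma tendsto_covariance_diag [TopologicalSpace T] [FirstCountableTopology T]
    (hZ : IsTightGaussian P₀ Z C)
    (hcont : ∀ᵐ ω ∂P₀, Continuous fun t => Z ω t) (t : T) :
    Tendsto (fun s => C s s) (𝓝 t) (𝓝 (C t t)) := by
  simp_rw [← hZ.variance_eval]
  refine tendsto_variance_of_ae_tendsto (fun s => hZ.gaussian.hasGaussianLaw_eval s)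
    hZ.mean_zero (hZ.gaussian.hasGaussianLaw_eval t) (hZ.mean_zero t) ?_
  filter_upwards [hcont] with ω hω using hω.tendsto t

/-- For the kernel of the influence function this is its mean-square continuity in t, which is not
assumed directly. -/
lemma tendsto_variance_increment [TopologicalSpace T] [FirstCountableTopology T]
    (hZ : IsTightGaussian P₀ Z C)
    (hcont : ∀ᵐ ω ∂P₀, Continuous fun t => Z ω t) (t : T) :
    Tendsto (fun s => C s s - 2 * C s t + C t t) (𝓝 t) (𝓝 0) := by
  have hz : Var[fun ω => Z ω t - Z ω t; P₀] = 0 := by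
    rw [hZ.variance_sub_eval]
    ring
  simp_rw [← hZ.variance_sub_eval]
  rw [← hz]
  have hint : ∀ s, Integrable (fun ω => Z ω s) P₀ := fun s =>
    (hZ.memLp_eval s).integrable (by simp)
  have h0 : ∀ s, ∫ ω, (Z ω s - Z ω t) ∂P₀ = 0 := fun s => by
    rw [integral_sub (hint s) (hint t), hZ.mean_zero, hZ.mean_zero, sub_zero]
  refine tendsto_variance_of_ae_tendsto (fun s => hZ.gaussian.hasGaussianLaw_fun_sub) h0
    hZ.gaussian.hasGaussianLaw_fun_sub (h0 t) ?_
  filter_upwards [hcont] with ω hω using (hω.tendsto t).sub_const _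

/-- Rotation invariance of the finite-dimensional distributions of two independent copies. -/
lemma measure_rotation (hZ : IsTightGaussian P₀ Z C) (q : ℕ → T) (b : ℕ → ℝ) (θ : ℝ) (m : ℕ) :
    (P₀.prod P₀) {p | ∀ j ∈ Finset.range m,
      |Real.cos θ * Z p.1 (q j) + Real.sin θ * Z p.2 (q j)| ≤ b j} =
      P₀ {ω | ∀ j ∈ Finset.range m, |Z ω (q j)| ≤ b j} := by
  let V : Ω₀ → (Finset.range m → ℝ) := fun ω j => Z ω (q j)
  have hV : Measurable V := measurable_pi_lambda _ fun j => hZ.measurable_eval _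
  have hG : IsGaussian (P₀.map V) :=
    ((hZ.gaussian.comp_right q).hasGaussianLaw (Finset.range m)).isGaussian_map
  have hmean : ∫ v, id v ∂(P₀.map V) = 0 := by
    rw [integral_map hV.aemeasurable (by fun_prop)]
    ext j
    simp only [id_eq]
    rw [eval_integral (fun j => (hZ.memLp_eval _).integrable (by simp))]
    exact hZ.mean_zero _
  let A : Set (Finset.range m → ℝ) := {v | ∀ j, |v j| ≤ b j}
  have hA : MeasurableSet A := by
    have : A = ⋂ j : Finset.range m, {v | |v j| ≤ b j} := by ext; simp [A]
    rw [this]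
    exact MeasurableSet.iInter fun j => measurableSet_le (by fun_prop) measurable_const
  have key := IsGaussian.map_rotation_eq_self hmean θ
  have e1 : (P₀.prod P₀) {p | ∀ j ∈ Finset.range m,
      |Real.cos θ * Z p.1 (q j) + Real.sin θ * Z p.2 (q j)| ≤ b j} =
      (((P₀.map V).prod (P₀.map V)).map (ContinuousLinearMap.rotation θ)) (A ×ˢ Set.univ) := by
    rw [Measure.map_apply (by fun_prop) (hA.prod MeasurableSet.univ),
      Measure.map_prod_map _ _ hV hV, Measure.map_apply (hV.prodMap hV)
      ((hA.prod MeasurableSet.univ).preimage (by fun_prop))]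
    congr 1
    ext p
    simp [A, V, ContinuousLinearMap.rotation_apply]
  rw [e1, key, Measure.prod_prod, measure_univ, mul_one, Measure.map_apply hV hA]
  congr 1
  ext ω
  simp [A, V]

end IsTightGaussian

/-! ### The law of the studentized supremum of a tight Gaussian process -/

section SupLaw

variable {Ω₀ T : Type*} [MeasurableSpace Ω₀] {P₀ : Measure Ω₀}
  {Z : Ω₀ → EllInfty T} {C : T → T → ℝ} {σ : T → ℝ} {c : ℝ}

lemma supCdf_eq_measureReal_studNorm [Nonempty T] (hc : 0 < c) (hσ : ∀ t, c ≤ σ t) (x : ℝ) :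
    supCdf P₀ (fun ω t => Z ω t / σ t) x = P₀.real {ω | studNorm σ (Z ω) ≤ x} := by
  rw [supCdf]
  congr 1
  ext ω
  simp only [Set.mem_ofPred_eq, studNorm_le_iff hc hσ]
  refine forall_congr' fun t => ?_
  have ht := hc.trans_le (hσ t)
  rw [abs_div, abs_of_pos ht, div_le_iff₀ ht]

lemma IsTightGaussian.measurableSet_studNorm [Nonempty T] (hZ : IsTightGaussian P₀ Z C)
    (hc : 0 < c) (hσ : ∀ t, c ≤ σ t) {A : Set ℝ} (hA : MeasurableSet A) :
    MeasurableSet {ω | studNorm σ (Z ω) ∈ A} := by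
  let _ : MeasurableSpace (EllInfty T) := borel _
  have : BorelSpace (EllInfty T) := ⟨rfl⟩
  exact ((continuous_studNorm hc hσ).measurable.comp hZ.measurable) hA

/-- For continuous z and σ the constraint defines a closed set of times, so countably many times
suffice. This reduces the supremum to finite-dimensional laws. -/
lemma studNorm_le_iff_denseSeq [TopologicalSpace T] [TopologicalSpace.SeparableSpace T] [Nonempty T]
    (hc : 0 < c) (hσ : ∀ t, c ≤ σ t) (hσc : Continuous σ) {z : EllInfty T}
    (hz : Continuous fun t => z t) {x : ℝ} :
    studNorm σ z ≤ x ↔ ∀ j, |z (TopologicalSpace.denseSeq T j)| ≤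
      x * σ (TopologicalSpace.denseSeq T j) := by
  rw [studNorm_le_iff hc hσ]
  refine ⟨fun h j => h _, fun h t => ?_⟩
  have hcl : IsClosed {t | |z t| ≤ x * σ t} := isClosed_le hz.abs (hσc.const_mul x)
  exact hcl.closure_subset_iff.2 (Set.range_subset_iff.2 h)
    (TopologicalSpace.denseRange_denseSeq T t)

variable [IsProbabilityMeasure P₀]

lemma measure_forall_eq_lim {Ω' : Type*} [MeasurableSpace Ω'] {P' : Measure Ω'}
    [IsProbabilityMeasure P'] {A : ℕ → Set Ω'} (hA : ∀ j, MeasurableSet (A j)) :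
    Tendsto (fun m => P' {ω | ∀ j ∈ Finset.range m, ω ∈ A j}) atTop
      (𝓝 (P' {ω | ∀ j, ω ∈ A j})) := by
  have h := tendsto_measure_iInter_atTop (μ := P')
    (s := fun m => {ω | ∀ j ∈ Finset.range m, ω ∈ A j})
    (fun m => by
      have : {ω | ∀ j ∈ Finset.range m, ω ∈ A j} = ⋂ j ∈ Finset.range m, A j := by ext; simp
      rw [this]
      exact (Finset.measurableSet_biInter _ fun j _ => hA j).nullMeasurableSet)
    (fun m n hmn ω hω j hj => hω j (Finset.range_mono hmn hj)) ⟨0, measure_ne_top _ _⟩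
  have e : {ω | ∀ j, ω ∈ A j} = ⋂ m : ℕ, {ω | ∀ j ∈ Finset.range m, ω ∈ A j} := by
    ext ω
    simp only [Set.mem_ofPred_eq, Set.mem_iInter, Finset.mem_range]
    exact ⟨fun h _ j _ => h j, fun h j => h (j + 1) j (Nat.lt_succ_self j)⟩
  rw [e]
  exact h

lemma IsTightGaussian.tendsto_measure_fidi [TopologicalSpace T] [TopologicalSpace.SeparableSpace T]
    [Nonempty T] (hZ : IsTightGaussian P₀ Z C) (hcont : ∀ᵐ ω ∂P₀, Continuous fun t => Z ω t)
    (hc : 0 < c) (hσ : ∀ t, c ≤ σ t) (hσc : Continuous σ) (x : ℝ) :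
    Tendsto (fun m => P₀ {ω | ∀ j ∈ Finset.range m,
      |Z ω (TopologicalSpace.denseSeq T j)| ≤ x * σ (TopologicalSpace.denseSeq T j)})
      atTop (𝓝 (P₀ {ω | studNorm σ (Z ω) ≤ x})) := by
  have e : P₀ {ω | studNorm σ (Z ω) ≤ x} =
      P₀ {ω | ∀ j, ω ∈ {ω | |Z ω (TopologicalSpace.denseSeq T j)| ≤
        x * σ (TopologicalSpace.denseSeq T j)}} := by
    refine measure_congr ?_
    filter_upwards [hcont] with ω hω
    exact propext (studNorm_le_iff_denseSeq hc hσ hσc hω)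
  rw [e]
  exact measure_forall_eq_lim fun j =>
    measurableSet_le (hZ.measurable_eval _).abs measurable_const

/-- The distribution function of the studentized supremum of a tight centred Gaussian process
is strictly increasing where it takes values in `(0, 1)`: a rotation of two independent copies
joins any two levels by a continuous path. -/
lemma IsTightGaussian.measure_studNorm_lt [TopologicalSpace T] [TopologicalSpace.SeparableSpace T]
    [Nonempty T] (hZ : IsTightGaussian P₀ Z C) (hcont : ∀ᵐ ω ∂P₀, Continuous fun t => Z ω t)
    (hc : 0 < c) (hσ : ∀ t, c ≤ σ t) (hσc : Continuous σ) {x y : ℝ} (hxy : x < y)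
    (hx : 0 < P₀ {ω | studNorm σ (Z ω) ≤ x}) (hy : P₀ {ω | studNorm σ (Z ω) ≤ y} < 1) :
    P₀ {ω | studNorm σ (Z ω) ≤ x} < P₀ {ω | studNorm σ (Z ω) ≤ y} := by
  by_contra hle
  rw [not_lt] at hle
  let q := TopologicalSpace.denseSeq T
  -- The rotated process is constrained only on the dense sequence. This keeps the event measurable
  -- on the product space although `EllInfty T` need not be separable, and lets rotation invariance
  -- enter through finite-dimensional laws.
  let A : ℝ → ℝ → Set (Ω₀ × Ω₀) := fun θ v => {p | ∀ j, p ∈ {p : Ω₀ × Ω₀ |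
    |Real.cos θ * Z p.1 (q j) + Real.sin θ * Z p.2 (q j)| ≤ v * σ (q j)}}
  have hAm' : ∀ θ v j, MeasurableSet {p : Ω₀ × Ω₀ |
      |Real.cos θ * Z p.1 (q j) + Real.sin θ * Z p.2 (q j)| ≤ v * σ (q j)} := fun θ v j => by
    have h1 : Measurable fun p : Ω₀ × Ω₀ => Z p.1 (q j) :=
      (hZ.measurable_eval (q j)).comp measurable_fst
    have h2 : Measurable fun p : Ω₀ × Ω₀ => Z p.2 (q j) :=
      (hZ.measurable_eval (q j)).comp measurable_snd
    exact measurableSet_le ((h1.const_mul _).add (h2.const_mul _)).abs measurable_const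
  have hAm : ∀ θ v, MeasurableSet (A θ v) := fun θ v => by
    have : A θ v = ⋂ j, {p : Ω₀ × Ω₀ |
        |Real.cos θ * Z p.1 (q j) + Real.sin θ * Z p.2 (q j)| ≤ v * σ (q j)} := by
      ext; simp [A]
    rw [this]
    exact MeasurableSet.iInter (hAm' θ v)
  have hA : ∀ θ v, (P₀.prod P₀) (A θ v) = P₀ {ω | studNorm σ (Z ω) ≤ v} := fun θ v => by
    have h1 := measure_forall_eq_lim (P' := P₀.prod P₀) (hAm' θ v)
    have h2 := hZ.tendsto_measure_fidi hcont hc hσ hσc v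
    refine tendsto_nhds_unique h1 (h2.congr fun m => ?_)
    exact (hZ.measure_rotation q (fun j => v * σ (q j)) θ m).symm
  -- If F does not increase from x to y, each fixed rotation almost surely has its norm outside (x,
  -- y]; rational angles make this simultaneous.
  have hnull : (P₀.prod P₀) (⋃ r : ℚ, A r y \ A r x) = 0 := by
    refine measure_iUnion_null fun r => ?_
    have hsub : A r x ⊆ A r y := fun p hp j =>
      (hp j).trans (mul_le_mul_of_nonneg_right hxy.le (hc.le.trans (hσ _)))
    rw [measure_sdiff hsub (hAm _ _).nullMeasurableSet (measure_ne_top _ _), hA, hA]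
    exact tsub_eq_zero_of_le hle
  have hpos : 0 < (P₀.prod P₀)
      ({ω | studNorm σ (Z ω) ≤ x} ×ˢ {ω | studNorm σ (Z ω) ≤ y}ᶜ) := by
    have hms : MeasurableSet {ω | studNorm σ (Z ω) ≤ y} :=
      hZ.measurableSet_studNorm hc hσ measurableSet_Iic
    rw [Measure.prod_prod, prob_compl_eq_one_sub hms]
    exact ENNReal.mul_pos hx.ne' (tsub_pos_of_lt hy).ne'
  refine hpos.ne' (measure_mono_null_ae ?_ hnull)
  have hfst : ∀ᵐ p ∂(P₀.prod P₀), Continuous fun t => Z p.1 t :=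
    Measure.quasiMeasurePreserving_fst.ae hcont
  have hsnd : ∀ᵐ p ∂(P₀.prod P₀), Continuous fun t => Z p.2 t :=
    Measure.quasiMeasurePreserving_snd.ae hcont
  filter_upwards [hfst, hsnd] with p h1 h2 hp
  obtain ⟨hp1, hp2⟩ := hp
  simp only [Set.mem_ofPred_eq, Set.mem_compl_iff, not_le] at hp1 hp2
  let w : ℝ → EllInfty T := fun θ => Real.cos θ • Z p.1 + Real.sin θ • Z p.2
  have hwcont : Continuous w := by fun_prop
  have hf : Continuous fun θ => studNorm σ (w θ) := (continuous_studNorm hc hσ).comp hwcont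
  have hf0 : studNorm σ (w 0) ≤ x := by simpa [w] using hp1
  have hf1 : y < studNorm σ (w (Real.pi / 2)) := by simpa [w] using hp2
  -- As the angle runs from 0 to π/2 the norm passes continuously from at most x to above y, so it
  -- lies in (x, y) on a nonempty open set of angles, which contains a rational one.
  obtain ⟨θ, -, hθ⟩ := intermediate_value_Icc (by positivity) hf.continuousOn
    (show (x + y) / 2 ∈ Set.Icc (studNorm σ (w 0)) (studNorm σ (w (Real.pi / 2))) from
      ⟨by linarith, by linarith⟩)
  have hop : IsOpen ((fun θ => studNorm σ (w θ)) ⁻¹' Set.Ioo x y) := isOpen_Ioo.preimage hf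
  obtain ⟨r, hr⟩ := (Rat.denseRange_cast (𝕜 := ℝ)).exists_mem_open hop
    ⟨θ, by simp only [Set.mem_preimage, hθ]; constructor <;> linarith⟩
  have hwr : Continuous fun t => w r t := by
    have : (fun t => w r t) = fun t => Real.cos r * Z p.1 t + Real.sin r * Z p.2 t := rfl
    rw [this]
    exact (h1.const_mul _).add (h2.const_mul _)
  have hmem : ∀ v, p ∈ A r v ↔ studNorm σ (w r) ≤ v := fun v => by
    rw [studNorm_le_iff_denseSeq hc hσ hσc hwr]
    rfl
  exact Set.mem_iUnion.2 ⟨r, (hmem y).2 hr.2.le, fun h => absurd ((hmem x).1 h) (not_le.2 hr.1)⟩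

end SupLaw

/-! ### Portmanteau inequalities for weak convergence in `ℓ^∞(T)` -/

section Portmanteau

variable {Ω Ω₀ T : Type*} [MeasurableSpace Ω] [MeasurableSpace Ω₀] {μ : Measure Ω}
  {P₀ : Measure Ω₀} {S : ℕ → Ω → T → ℝ} {Z : Ω₀ → EllInfty T} {σ : T → ℝ} {c : ℝ}

/-- Markov's inequality for each integrable measurable majorant, followed by the infimum; A need not
be measurable. -/
lemma measureReal_le_outerExpectation [IsProbabilityMeasure μ] {f : Ω → ℝ} {A : Set Ω}
    (h0 : ∀ ω, 0 ≤ f ω) (h1 : ∀ ω, f ω ≤ 1) (hA : ∀ ω ∈ A, 1 ≤ f ω) :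
    μ.real A ≤ outerExpectation μ f := by
  refine le_csInf ⟨∫ _, 1 ∂μ, fun _ => 1, measurable_const, integrable_const _, h1, rfl⟩ ?_
  rintro r ⟨g, hg, hgi, hfg, rfl⟩
  have := mul_meas_ge_le_integral_of_nonneg (μ := μ)
    (Eventually.of_forall fun ω => (h0 ω).trans (hfg ω)) hgi 1
  rw [one_mul] at this
  exact (measureReal_mono fun ω hω => (hA ω hω).trans (hfg ω)).trans this

/-- The portmanteau inequality for closed sets. -/
lemma WeakConvEllInfty.eventually_measureReal_lt [IsProbabilityMeasure μ]
    [IsProbabilityMeasure P₀]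
    (hZ : @Measurable Ω₀ (EllInfty T) _ (borel (EllInfty T)) Z)
    (hw : WeakConvEllInfty μ S P₀ Z) {A : Set (EllInfty T)} (hA : IsClosed A) {r : ℝ}
    (hr : P₀.real {ω | Z ω ∈ A} < r) :
    ∃ hS : ∀ n ω, Memℓp (S n ω) ∞,
      ∀ᶠ n in atTop, μ.real {ω | (⟨S n ω, hS n ω⟩ : EllInfty T) ∈ A} < r := by
  let _ : MeasurableSpace (EllInfty T) := borel _
  have : BorelSpace (EllInfty T) := ⟨rfl⟩
  obtain ⟨hS, hw⟩ := hw
  refine ⟨hS, ?_⟩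
  -- Thickened indicators of radius 1/(k+1) are continuous majorants of the indicator of A and
  -- converge to it pointwise because A is closed.
  let δ : ℕ → ℝ := fun k => 1 / ((k : ℝ) + 1)
  have hδ : ∀ k, 0 < δ k := fun k => by positivity
  let f : ℕ → BoundedContinuousFunction (EllInfty T) ℝ := fun k =>
    BoundedContinuousFunction.ofNormedAddCommGroup
      (fun z => (thickenedIndicator (hδ k) A z : ℝ))
      (NNReal.continuous_coe.comp (thickenedIndicator (hδ k) A).continuous) 1
      (fun z => by
        rw [Real.norm_eq_abs, abs_of_nonneg (NNReal.coe_nonneg _)]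
        exact_mod_cast thickenedIndicator_le_one (hδ k) A z)
  have hf0 : ∀ k z, 0 ≤ f k z := fun k z => NNReal.coe_nonneg _
  have hf1 : ∀ k z, f k z ≤ 1 := fun k z => by
    exact_mod_cast thickenedIndicator_le_one (hδ k) A z
  have hfA : ∀ k, ∀ z ∈ A, 1 ≤ f k z := fun k z hz => by
    exact_mod_cast (thickenedIndicator_one (hδ k) A hz).ge
  have hlim : Tendsto (fun k => ∫ ω, f k (Z ω) ∂P₀) atTop (𝓝 (P₀.real {ω | Z ω ∈ A})) := by
    have hms : MeasurableSet {ω | Z ω ∈ A} := hZ hA.measurableSet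
    rw [← integral_indicator_one hms]
    refine tendsto_integral_of_dominated_convergence (fun _ => 1)
      (fun k => ((f k).continuous.measurable.comp hZ).aestronglyMeasurable)
      (integrable_const _) (fun k => Eventually.of_forall fun ω => ?_)
      (Eventually.of_forall fun ω => ?_)
    · rw [Real.norm_eq_abs, abs_of_nonneg (hf0 _ _)]
      exact hf1 _ _
    · have h := tendsto_pi_nhds.1 (thickenedIndicator_tendsto_indicator_closure hδ
        tendsto_one_div_add_atTop_nhds_zero_nat A) (Z ω)
      rw [hA.closure_eq] at h
      have h' := (NNReal.continuous_coe.tendsto _).comp h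
      have e : ((A.indicator (fun _ => (1 : NNReal)) (Z ω) : NNReal) : ℝ) =
          {ω | Z ω ∈ A}.indicator 1 ω := by
        by_cases hω : Z ω ∈ A <;> simp [hω, Set.indicator]
      rw [e] at h'
      exact h'
  obtain ⟨k, hk⟩ := (hlim.eventually (gt_mem_nhds hr)).exists
  filter_upwards [(hw (f k)).eventually (gt_mem_nhds hk)] with n hn
  refine lt_of_le_of_lt ?_ hn
  exact measureReal_le_outerExpectation (fun ω => hf0 _ _) (fun ω => hf1 _ _)
    fun ω hω => hfA k _ hω

lemma WeakConvEllInfty.eventually_measureReal_forall_lt [IsProbabilityMeasure μ]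
    [IsProbabilityMeasure P₀] [Nonempty T]
    (hZ : @Measurable Ω₀ (EllInfty T) _ (borel (EllInfty T)) Z)
    (hw : WeakConvEllInfty μ S P₀ Z) (hc : 0 < c) (hσ : ∀ t, c ≤ σ t) {x r : ℝ}
    (hr : P₀.real {ω | studNorm σ (Z ω) ≤ x} < r) :
    ∀ᶠ n in atTop, μ.real {ω | ∀ t, |S n ω t| ≤ x * σ t} < r := by
  obtain ⟨hS, h⟩ := hw.eventually_measureReal_lt hZ
    (A := {z | studNorm σ z ≤ x}) (isClosed_le (continuous_studNorm hc hσ) continuous_const) hr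
  filter_upwards [h] with n hn
  simpa only [Set.mem_ofPred_eq, studNorm_le_iff hc hσ] using hn

/-- The complement of a sublevel set is not closed, so it is enlarged to {N ≥ x}; the hypothesis on
the limit carries the same non-strict inequality. -/
lemma WeakConvEllInfty.eventually_measureReal_not_forall_lt [IsProbabilityMeasure μ]
    [IsProbabilityMeasure P₀] [Nonempty T]
    (hZ : @Measurable Ω₀ (EllInfty T) _ (borel (EllInfty T)) Z)
    (hw : WeakConvEllInfty μ S P₀ Z) (hc : 0 < c) (hσ : ∀ t, c ≤ σ t) {x r : ℝ}
    (hr : P₀.real {ω | x ≤ studNorm σ (Z ω)} < r) :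
    ∀ᶠ n in atTop, μ.real {ω | ¬ ∀ t, |S n ω t| ≤ x * σ t} < r := by
  obtain ⟨hS, h⟩ := hw.eventually_measureReal_lt hZ
    (A := {z | x ≤ studNorm σ z}) (isClosed_le continuous_const (continuous_studNorm hc hσ)) hr
  filter_upwards [h] with n hn
  refine lt_of_le_of_lt (measureReal_mono fun ω hω => ?_) hn
  by_contra hlt
  exact hω ((studNorm_le_iff hc hσ (⟨S n ω, hS n ω⟩ : EllInfty T)).1 (not_le.1 hlt).le)

/-- Stochastic boundedness: the superlevel sets of the norm of Z shrink to the empty set, and one of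
small probability is transferred to S. -/
lemma WeakConvEllInfty.exists_bound [IsProbabilityMeasure μ]
    [IsProbabilityMeasure P₀] [Nonempty T]
    (hZ : @Measurable Ω₀ (EllInfty T) _ (borel (EllInfty T)) Z)
    (hw : WeakConvEllInfty μ S P₀ Z) {ε : ℝ} (hε : 0 < ε) :
    ∃ L : ℝ, ∀ᶠ n in atTop, μ.real {ω | ¬ ∀ t, |S n ω t| ≤ L} < ε := by
  let _ : MeasurableSpace (EllInfty T) := borel _
  have : BorelSpace (EllInfty T) := ⟨rfl⟩
  have hσ : ∀ _t : T, (1 : ℝ) ≤ 1 := fun _ => le_rfl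
  have hlim := tendsto_measure_iInter_atTop (μ := P₀)
    (s := fun k : ℕ => {ω | (k : ℝ) ≤ studNorm (fun _ => 1) (Z ω)})
    (fun k => (measurableSet_le measurable_const ((continuous_studNorm one_pos
      hσ).measurable.comp hZ)).nullMeasurableSet)
    (fun k l hkl ω hω => le_trans (by exact_mod_cast hkl) (Set.mem_ofPred_eq ▸ hω))
    ⟨0, measure_ne_top _ _⟩
  have hempty : ⋂ k : ℕ, {ω | (k : ℝ) ≤ studNorm (fun _ => 1) (Z ω)} = ∅ := by
    ext ω
    simp only [Set.mem_iInter, Set.mem_ofPred_eq, Set.mem_empty_iff_false, iff_false, not_forall,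
      not_le]
    exact exists_nat_gt _
  rw [hempty, measure_empty] at hlim
  obtain ⟨k, hk⟩ := (hlim.eventually (gt_mem_nhds (ENNReal.ofReal_pos.2 hε))).exists
  have hk' : P₀.real {ω | (k : ℝ) ≤ studNorm (fun _ => 1) (Z ω)} < ε := by
    rw [measureReal_def, ← ENNReal.lt_ofReal_iff_toReal_lt (measure_ne_top _ _)]
    exact hk
  refine ⟨k, ?_⟩
  simpa using hw.eventually_measureReal_not_forall_lt hZ one_pos hσ hk'

end Portmanteau

/-! ### Averages of triangular arrays -/

section Average

/-- The average of the first `n` terms. -/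
noncomputable def avg (n : ℕ) (x : ℕ → ℝ) : ℝ := (∑ i ∈ Finset.range n, x i) / n

lemma avg_nonneg {n : ℕ} {x : ℕ → ℝ} (h : ∀ i < n, 0 ≤ x i) : 0 ≤ avg n x :=
  div_nonneg (Finset.sum_nonneg fun i hi => h i (Finset.mem_range.1 hi)) (Nat.cast_nonneg _)

lemma avg_mono {n : ℕ} {x y : ℕ → ℝ} (h : ∀ i < n, x i ≤ y i) : avg n x ≤ avg n y :=
  div_le_div_of_nonneg_right (Finset.sum_le_sum fun i hi => h i (Finset.mem_range.1 hi))
    (Nat.cast_nonneg _)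

lemma avg_add (n : ℕ) (x y : ℕ → ℝ) : avg n (fun i => x i + y i) = avg n x + avg n y := by
  simp [avg, Finset.sum_add_distrib, add_div]

lemma avg_sub (n : ℕ) (x y : ℕ → ℝ) : avg n (fun i => x i - y i) = avg n x - avg n y := by
  simp [avg, Finset.sum_sub_distrib, sub_div]

lemma avg_const_mul (n : ℕ) (a : ℝ) (x : ℕ → ℝ) : avg n (fun i => a * x i) = a * avg n x := by
  simp [avg, ← Finset.mul_sum, mul_div_assoc]

lemma avg_const {n : ℕ} (hn : 0 < n) (a : ℝ) : avg n (fun _ => a) = a := by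
  have : (n : ℝ) ≠ 0 := by exact_mod_cast hn.ne'
  simp [avg]
  field_simp

lemma sq_avg_mul_le (n : ℕ) (x y : ℕ → ℝ) :
    avg n (fun i => x i * y i) ^ 2 ≤ avg n (fun i => x i ^ 2) * avg n (fun i => y i ^ 2) := by
  simp only [avg, div_pow, div_mul_div_comm, ← pow_two]
  exact div_le_div_of_nonneg_right (Finset.sum_mul_sq_le_sq_mul_sq _ _ _) (by positivity)

lemma sq_avg_le {n : ℕ} (hn : 0 < n) (x : ℕ → ℝ) : avg n x ^ 2 ≤ avg n (fun i => x i ^ 2) := by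
  simpa [avg_const hn] using sq_avg_mul_le n x (fun _ => 1)

lemma sq_le_mul_avg_sq {n i : ℕ} (hi : i < n) (x : ℕ → ℝ) :
    x i ^ 2 ≤ n * avg n (fun i => x i ^ 2) := by
  have hn : (n : ℝ) ≠ 0 := by exact_mod_cast (Nat.zero_lt_of_lt hi).ne'
  rw [avg, mul_div_cancel₀ _ hn]
  exact Finset.single_le_sum (f := fun i => x i ^ 2) (fun i _ => sq_nonneg _)
    (Finset.mem_range.2 hi)

variable {ι : Type*} {L : Filter ι} {N : ι → ℕ}

/-- Cauchy–Schwarz for empirical averages. -/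
lemma tendsto_avg_mul_zero {x y : ι → ℕ → ℝ} {a : ℝ}
    (hx : Tendsto (fun q => avg (N q) (fun i => x q i ^ 2)) L (𝓝 0))
    (hy : Tendsto (fun q => avg (N q) (fun i => y q i ^ 2)) L (𝓝 a)) :
    Tendsto (fun q => avg (N q) (fun i => x q i * y q i)) L (𝓝 0) := by
  have h : Tendsto (fun q => Real.sqrt (avg (N q) (fun i => x q i ^ 2) *
      avg (N q) (fun i => y q i ^ 2))) L (𝓝 0) := by
    simpa using (hx.mul hy).sqrt
  refine squeeze_zero_norm (fun q => ?_) h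
  exact Real.abs_le_sqrt (sq_avg_mul_le _ _ _)

/-- If two families of arrays are close in mean square, then their Gram matrices have the same
limits. -/
lemma tendsto_avg_mul_of_close {u u' v v' : ι → ℕ → ℝ} {a a' g : ℝ}
    (hd : Tendsto (fun q => avg (N q) (fun i => (v q i - u q i) ^ 2)) L (𝓝 0))
    (hd' : Tendsto (fun q => avg (N q) (fun i => (v' q i - u' q i) ^ 2)) L (𝓝 0))
    (hu : Tendsto (fun q => avg (N q) (fun i => u q i ^ 2)) L (𝓝 a))
    (hu' : Tendsto (fun q => avg (N q) (fun i => u' q i ^ 2)) L (𝓝 a'))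
    (hg : Tendsto (fun q => avg (N q) (fun i => u q i * u' q i)) L (𝓝 g)) :
    Tendsto (fun q => avg (N q) (fun i => v q i * v' q i)) L (𝓝 g) := by
  have h1 := tendsto_avg_mul_zero hd hu'
  have h2 := tendsto_avg_mul_zero hd' hu
  have h3 := tendsto_avg_mul_zero hd hd'
  have := ((hg.add h1).add h2).add h3
  simp only [add_zero] at this
  refine this.congr fun q => ?_
  rw [← avg_add, ← avg_add, ← avg_add]
  congr 1
  ext i
  ring

/-- A single squared error is at most n times the average squared error, so mean-square closeness
already gives a maximal error of smaller order than √n. -/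
lemma eventually_abs_le_of_close {u v : ι → ℕ → ℝ}
    (hd : Tendsto (fun q => avg (N q) (fun i => (v q i - u q i) ^ 2)) L (𝓝 0))
    (hu : ∀ δ : ℝ, 0 < δ → ∀ᶠ q in L, ∀ i < N q, |u q i| ≤ δ * Real.sqrt (N q)) {δ : ℝ}
    (hδ : 0 < δ) : ∀ᶠ q in L, ∀ i < N q, |v q i| ≤ δ * Real.sqrt (N q) := by
  filter_upwards [hu (δ / 2) (by positivity),
    hd.eventually (ge_mem_nhds (show (0 : ℝ) < (δ / 2) ^ 2 by positivity))] with q h1 h2 i hi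
  have h3 : |v q i - u q i| ≤ δ / 2 * Real.sqrt (N q) := by
    refine abs_le_of_sq_le_sq ?_ (by positivity)
    rw [mul_pow, Real.sq_sqrt (Nat.cast_nonneg _)]
    refine (sq_le_mul_avg_sq hi fun i => v q i - u q i).trans ?_
    rw [mul_comm]
    exact mul_le_mul_of_nonneg_right h2 (Nat.cast_nonneg _)
  have h4 : |v q i| ≤ |u q i| + |v q i - u q i| := by
    simpa using abs_add_le (u q i) (v q i - u q i)
  linarith [h1 i hi]

/-- Centring at the empirical mean is asymptotically the same as centring at the mean. -/
lemma tendsto_avg_centred_close {u b : ι → ℕ → ℝ} (hN : Tendsto N L atTop)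
    (hb : Tendsto (fun q => avg (N q) (fun i => b q i ^ 2)) L (𝓝 0))
    (hu : Tendsto (fun q => avg (N q) (u q)) L (𝓝 0)) :
    Tendsto (fun q => avg (N q) (fun i =>
      (u q i + b q i - avg (N q) (fun j => u q j + b q j) - u q i) ^ 2)) L (𝓝 0) := by
  -- The error is b - avg b - avg u. The square of three terms costs a factor 3, and (avg b)² ≤ avg
  -- b² turns 3 + 3 into 6.
  have h : Tendsto (fun q => 6 * avg (N q) (fun i => b q i ^ 2) + 3 * avg (N q) (u q) ^ 2) L
      (𝓝 0) := by
    simpa using (hb.const_mul 6).add ((hu.pow 2).const_mul 3)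
  refine tendsto_of_tendsto_of_tendsto_of_le_of_le' tendsto_const_nhds h
    (Eventually.of_forall fun q => avg_nonneg fun i _ => sq_nonneg _) ?_
  filter_upwards [hN.eventually_gt_atTop 0] with q hq
  have h1 := sq_avg_le hq (b q)
  have h2 : avg (N q) (fun i =>
      (u q i + b q i - avg (N q) (fun j => u q j + b q j) - u q i) ^ 2) ≤
      avg (N q) (fun i => 3 * b q i ^ 2 + (3 * avg (N q) (b q) ^ 2 + 3 * avg (N q) (u q) ^ 2)) := by
    refine avg_mono fun i _ => ?_
    rw [avg_add]
    nlinarith [sq_nonneg (b q i + avg (N q) (b q)), sq_nonneg (b q i + avg (N q) (u q)),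
      sq_nonneg (avg (N q) (b q) - avg (N q) (u q))]
  have h3 : avg (N q) (fun i => 3 * b q i ^ 2 +
      (3 * avg (N q) (b q) ^ 2 + 3 * avg (N q) (u q) ^ 2)) =
      3 * avg (N q) (fun i => b q i ^ 2) +
        (3 * avg (N q) (b q) ^ 2 + 3 * avg (N q) (u q) ^ 2) := by
    rw [avg_add, avg_const hq, avg_const_mul]
  linarith

end Average

/-! ### A pointwise bound for the estimated influence contributions -/

lemma sq_add_five_le (a b c d e : ℝ) :
    (a + b + c + d + e) ^ 2 ≤ 5 * (a ^ 2 + b ^ 2 + c ^ 2 + d ^ 2 + e ^ 2) := by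
  nlinarith [sq_nonneg (a - b), sq_nonneg (a - c), sq_nonneg (a - d), sq_nonneg (a - e),
    sq_nonneg (b - c), sq_nonneg (b - d), sq_nonneg (b - e), sq_nonneg (c - d),
    sq_nonneg (c - e), sq_nonneg (d - e)]

lemma sq_le_sq_mul_of_abs_le {x a y : ℝ} (h : |x| ≤ a * |y|) : x ^ 2 ≤ a ^ 2 * y ^ 2 := by
  rw [← sq_abs x, ← sq_abs y, ← mul_pow]
  exact pow_le_pow_left₀ (abs_nonneg _) h 2

/-- The influence value φ determines the residual: y - m equals pφ + τ for a treated unit and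
-p(1-π)φ/π for a control. Errors in π and p therefore multiply φ itself, and a square-integrable
envelope of φ suffices, with no separate moment bound on the residual. The five terms are the errors
of the curve, the regression, the propensity, τ and p; the fourth vanishes for controls and the
third for treated units. -/
lemma sq_influence_sub_le {p p' D y y' π π' m m' τ τ' c Φ : ℝ} (hc : 0 < c) (hp : 0 < p)
    (hp1 : p ≤ 1) (hp' : 0 < p') (hD : D = 0 ∨ D = 1) (hπ : c ≤ π ∧ π ≤ 1 - c)
    (hπ' : c ≤ π' ∧ π' ≤ 1 - c) (hΦ : |drScore p D y π m - D / p * τ| ≤ Φ) :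
    (drScore p' D y' π' m' - D / p' * τ' - (drScore p D y π m - D / p * τ)) ^ 2 ≤
      5 * ((1 / (p' * c)) ^ 2 * (y' - y) ^ 2 + (1 / (p' * c)) ^ 2 * (m' - m) ^ 2 +
        (1 / (p' * c ^ 3)) ^ 2 * ((π' - π) ^ 2 * Φ ^ 2) + (1 / p') ^ 2 * (τ' - τ) ^ 2 +
        (p / p' - 1) ^ 2 * Φ ^ 2) := by
  set φ := drScore p D y π m - D / p * τ with hφ
  have hc1 : c < 1 := by linarith
  have hφ2 : φ ^ 2 ≤ Φ ^ 2 := by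
    rw [← sq_abs φ]
    exact pow_le_pow_left₀ (abs_nonneg _) hΦ 2
  have hlast : ((p / p' - 1) * φ) ^ 2 ≤ (p / p' - 1) ^ 2 * Φ ^ 2 := by
    rw [mul_pow]
    exact mul_le_mul_of_nonneg_left hφ2 (sq_nonneg _)
  have h1π : 0 < 1 - π := by linarith
  have h1π' : 0 < 1 - π' := by linarith
  have hπ0 : 0 < π := by linarith
  have hinv : 1 / p' ≤ 1 / (p' * c) := by
    apply one_div_le_one_div_of_le (by positivity)
    nlinarith
  rcases hD with rfl | rfl
  · have hr : |π' / (p' * (1 - π'))| ≤ 1 / (p' * c) := by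
      rw [abs_of_nonneg (div_nonneg (by linarith) (by positivity)),
        div_le_div_iff₀ (by positivity) (by positivity)]
      have := mul_le_mul (show π' ≤ 1 by linarith) (show c ≤ 1 - π' by linarith) hc.le zero_le_one
      nlinarith [mul_le_mul_of_nonneg_left this hp'.le]
    have he : drScore p' 0 y' π' m' - 0 / p' * τ' - φ =
        -(π' / (p' * (1 - π'))) * (y' - y) + π' / (p' * (1 - π')) * (m' - m) +
        ((π' - π) * (p / (p' * (1 - π') * π))) * φ + 0 + (p / p' - 1) * φ := by
      rw [hφ]
      simp only [drScore]
      field_simp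
      ring
    have hA : (-(π' / (p' * (1 - π'))) * (y' - y)) ^ 2 ≤ (1 / (p' * c)) ^ 2 * (y' - y) ^ 2 :=
      sq_le_sq_mul_of_abs_le (by
        rw [abs_mul, abs_neg]
        exact mul_le_mul_of_nonneg_right hr (abs_nonneg _))
    have hB : (π' / (p' * (1 - π')) * (m' - m)) ^ 2 ≤ (1 / (p' * c)) ^ 2 * (m' - m) ^ 2 :=
      sq_le_sq_mul_of_abs_le (by
        rw [abs_mul]
        exact mul_le_mul_of_nonneg_right hr (abs_nonneg _))
    have hE : (((π' - π) * (p / (p' * (1 - π') * π))) * φ) ^ 2 ≤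
        (1 / (p' * c ^ 3)) ^ 2 * ((π' - π) ^ 2 * Φ ^ 2) := by
      have hk : (p / (p' * (1 - π') * π)) ^ 2 ≤ (1 / (p' * c ^ 3)) ^ 2 := by
        refine pow_le_pow_left₀ (by positivity) ?_ 2
        rw [div_le_div_iff₀ (by positivity) (by positivity)]
        -- Overlap gives c², which is weakened to c³ using c < 1.
        have h2 : c * c ≤ (1 - π') * π := mul_le_mul (by linarith) hπ.1 hc.le h1π'.le
        have h3 : c ^ 3 ≤ (1 - π') * π := by nlinarith [mul_pos hc hc]
        have h4 : p * (p' * c ^ 3) ≤ 1 * (p' * c ^ 3) :=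
          mul_le_mul_of_nonneg_right hp1 (by positivity)
        nlinarith [mul_le_mul_of_nonneg_left h3 hp'.le]
      calc (((π' - π) * (p / (p' * (1 - π') * π))) * φ) ^ 2
          = (p / (p' * (1 - π') * π)) ^ 2 * ((π' - π) ^ 2 * φ ^ 2) := by ring
        _ ≤ _ := by gcongr
    rw [he]
    refine (sq_add_five_le _ _ _ _ _).trans ?_
    have : (0 : ℝ) ^ 2 ≤ (1 / p') ^ 2 * (τ' - τ) ^ 2 := by
      rw [zero_pow two_ne_zero]
      positivity
    linarith
  · have he : drScore p' 1 y' π' m' - 1 / p' * τ' - φ =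
        1 / p' * (y' - y) + -(1 / p') * (m' - m) + 0 + -(1 / p') * (τ' - τ) +
        (p / p' - 1) * φ := by
      rw [hφ]
      simp only [drScore]
      field_simp
      ring
    have hsq : (1 / p') ^ 2 ≤ (1 / (p' * c)) ^ 2 := pow_le_pow_left₀ (by positivity) hinv 2
    rw [he]
    refine (sq_add_five_le _ _ _ _ _).trans ?_
    have hA := mul_le_mul_of_nonneg_right hsq (sq_nonneg (y' - y))
    have hB := mul_le_mul_of_nonneg_right hsq (sq_nonneg (m' - m))
    have hE : (0 : ℝ) ^ 2 ≤ (1 / (p' * c ^ 3)) ^ 2 * ((π' - π) ^ 2 * Φ ^ 2) := by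
      rw [zero_pow two_ne_zero]
      positivity
    rw [mul_pow (1 / p'), mul_pow (-(1 / p')), mul_pow (-(1 / p')), neg_sq]
    linarith

/-! ### Conditioning on independent training information -/

lemma lintegral_comp_of_indepFun {Ω Ω' E : Type*} [MeasurableSpace Ω] [MeasurableSpace Ω']
    [MeasurableSpace E] {μ : Measure Ω} [IsProbabilityMeasure μ] {f : Ω → Ω'} {g : Ω → E}
    (hf : Measurable f) (hg : Measurable g) (hfg : IndepFun f g μ) {H : Ω' × E → ℝ≥0∞}
    (hH : Measurable H) :
    ∫⁻ ω, H (f ω, g ω) ∂μ = ∫⁻ ω, ∫⁻ x, H (f ω, x) ∂(μ.map g) ∂μ := by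
  have := Measure.isProbabilityMeasure_map hf.aemeasurable (μ := μ)
  have := Measure.isProbabilityMeasure_map hg.aemeasurable (μ := μ)
  have key := (indepFun_iff_map_prod_eq_prod_map_map hf.aemeasurable hg.aemeasurable).1 hfg
  rw [← lintegral_map hH (hf.prodMk hg), key, lintegral_prod _ hH.aemeasurable,
    lintegral_map hH.lintegral_prod_right' hf]

/-- The identity, regarded as a map into Ω with the smaller σ-algebra, is a random element carrying
exactly the training information; independence then makes the joint law a product. -/
lemma lintegral_comp_of_indep {Ω E : Type*} {m : MeasurableSpace Ω} [mΩ : MeasurableSpace Ω]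
    [mE : MeasurableSpace E] {μ : Measure Ω} [IsProbabilityMeasure μ] (hm : m ≤ mΩ) {g : Ω → E}
    (hg : Measurable g) (hind : Indep m (MeasurableSpace.comap g inferInstance) μ)
    {H : Ω × E → ℝ≥0∞} (hH : Measurable[m.prod mE] H) :
    ∫⁻ ω, H (ω, g ω) ∂μ = ∫⁻ ω, ∫⁻ x, H (ω, x) ∂(μ.map g) ∂μ := by
  refine @lintegral_comp_of_indepFun Ω Ω E mΩ m mE μ _ id g (measurable_id'' hm) hg ?_ H hH
  refine (@IndepFun_iff_Indep Ω Ω E mΩ m mE id g μ).2 ?_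
  rwa [MeasurableSpace.comap_id]

/-! ### Population quantities -/

namespace Population

variable {𝒰 T : Type*} [MeasurableSpace 𝒰] {P : Measure 𝒰} {d : ℕ} (M : Population P T d)

lemma measurable_change (t : T) : Measurable fun u => M.change u t :=
  ((M.measurable_D.mul (M.measurable_Ypost1 t)).add
    ((measurable_const.sub M.measurable_D).mul (M.measurable_Ypost0 t))).sub (M.measurable_Ypre t)

lemma measurable_influence (t : T) : Measurable fun u => M.influence u t := by
  have h1 := M.measurable_change t
  have h2 := M.measurable_prop.comp M.measurable_X
  have h3 := (M.measurable_reg0 t).comp M.measurable_X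
  have hD := M.measurable_D
  simp only [Function.comp_def] at h2 h3
  unfold influence drScore
  fun_prop

lemma integrable_D [IsProbabilityMeasure P] : Integrable M.D P := by
  refine Integrable.of_bound M.measurable_D.aestronglyMeasurable 1
    (Eventually.of_forall fun u => ?_)
  rcases M.D_binary u with h | h <;> simp [h]

lemma integral_D : ∫ u, M.D u ∂P = M.treatedProb := by
  have hs : MeasurableSet {u | M.D u = 1} := M.measurable_D (measurableSet_singleton 1)
  rw [treatedProb, ← integral_indicator_one hs]
  refine integral_congr_ae (Eventually.of_forall fun u => ?_)
  rcases M.D_binary u with h | h <;> simp [h, Set.indicator]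

lemma treatedProb_le_one [IsProbabilityMeasure P] : M.treatedProb ≤ 1 := measureReal_le_one

/-- The treated probability is the mean of the propensity score, which overlap bounds below by c. -/
lemma treatedProb_pos [IsProbabilityMeasure P] (h : M.Overlap) : 0 < M.treatedProb := by
  obtain ⟨c, hc, -, hov⟩ := h
  have hle : MeasurableSpace.comap M.X inferInstance ≤ (inferInstance : MeasurableSpace 𝒰) :=
    M.measurable_X.comap_le
  rw [← M.integral_D, ← integral_condExp hle, ← integral_congr_ae M.prop_spec]
  have hint : Integrable (fun u => M.prop (M.X u)) P :=
    integrable_condExp.congr M.prop_spec.symm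
  have : ∫ _, c ∂P ≤ ∫ u, M.prop (M.X u) ∂P :=
    integral_mono_ae (integrable_const _) hint (hov.mono fun u hu => hu.1)
  simp only [integral_const, probReal_univ, one_smul] at this
  exact hc.trans_le this

/-- A measurable square-integrable envelope. -/
lemma HasEnvelope.exists_measurable {M : Population P T d} (h : M.HasEnvelope) :
    ∃ Φ : 𝒰 → ℝ, Measurable Φ ∧ Integrable (fun u => Φ u ^ 2) P ∧
      ∀ᵐ u ∂P, ∀ t, |M.influence u t| ≤ Φ u := by
  obtain ⟨Φ, hΦ, hb⟩ := h
  have hm := hΦ.1.aemeasurable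
  refine ⟨hm.mk Φ, hm.measurable_mk, ?_, ?_⟩
  · exact (MemLp.ae_eq hm.ae_eq_mk hΦ).integrable_sq
  · filter_upwards [hb, hm.ae_eq_mk] with u hu he t
    rw [← he]
    exact hu t

lemma memLp_influence (h : M.HasEnvelope) (t : T) : MemLp (fun u => M.influence u t) 2 P := by
  obtain ⟨Φ, hΦ, hb⟩ := h
  refine hΦ.mono (M.measurable_influence t).aestronglyMeasurable ?_
  filter_upwards [hb] with u hu
  exact (hu t).trans (le_abs_self _)

/-- The centred influence function. -/
noncomputable def centredInfl (u : 𝒰) (t : T) : ℝ :=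
  M.influence u t - ∫ u, M.influence u t ∂P

lemma measurable_centredInfl (t : T) : Measurable fun u => M.centredInfl u t :=
  (M.measurable_influence t).sub_const _

lemma memLp_centredInfl [IsProbabilityMeasure P] (h : M.HasEnvelope) (t : T) :
    MemLp (fun u => M.centredInfl u t) 2 P :=
  (M.memLp_influence h t).sub (memLp_const _)

lemma integral_centredInfl [IsProbabilityMeasure P] (h : M.HasEnvelope) (t : T) :
    ∫ u, M.centredInfl u t ∂P = 0 := by
  simp only [centredInfl]
  rw [integral_sub ((M.memLp_influence h t).integrable (by simp)) (integrable_const _)]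
  simp

lemma integrable_centredInfl_mul [IsProbabilityMeasure P] (h : M.HasEnvelope) (s t : T) :
    Integrable (fun u => M.centredInfl u s * M.centredInfl u t) P :=
  (M.memLp_centredInfl h s).integrable_mul (M.memLp_centredInfl h t)

/-- This expression in the kernel is also the variance of an increment of Z, which is how path
continuity of Z reaches the influence function. -/
lemma integral_sq_increment [IsProbabilityMeasure P] (h : M.HasEnvelope) (s t : T) :
    ∫ u, (M.centredInfl u s - M.centredInfl u t) ^ 2 ∂P =
      M.covKernel s s - 2 * M.covKernel s t + M.covKernel t t := by
  have e : ∀ u, (M.centredInfl u s - M.centredInfl u t) ^ 2 =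
      M.centredInfl u s * M.centredInfl u s - 2 * (M.centredInfl u s * M.centredInfl u t) +
        M.centredInfl u t * M.centredInfl u t := fun u => by ring
  simp_rw [e]
  have i := M.integrable_centredInfl_mul h
  have i1 : Integrable (fun u => M.centredInfl u s * M.centredInfl u s -
      2 * (M.centredInfl u s * M.centredInfl u t)) P := (i s s).sub ((i s t).const_mul 2)
  rw [integral_add i1 (i t t),
    integral_sub (i s s) ((i s t).const_mul 2), integral_const_mul]
  rfl

end Population

/-! ### Cross-fitted averages -/

lemma measurable_indicator_fst_mul {Ω E : Type*} [MeasurableSpace Ω] [MeasurableSpace E]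
    {A : Set Ω} (hA : MeasurableSet A) {H : Ω × E → ℝ≥0∞} (hH : Measurable H) :
    Measurable fun q : Ω × E => A.indicator 1 q.1 * H q :=
  ((measurable_one.indicator hA).comp measurable_fst).mul hH

namespace CrossFitSample

variable {𝒰 T : Type*} [MeasurableSpace 𝒰] {P : Measure 𝒰} {d : ℕ} {M : Population P T d}
  {Ω : Type*} [mΩ : MeasurableSpace Ω] {μ : Measure Ω} {K : ℕ} (S : CrossFitSample M μ K)

lemma measurable_X_unit (i : ℕ) : Measurable fun ω => M.X (S.unit i ω) :=
  M.measurable_X.comp (S.unit_law i).measurable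

lemma map_X_unit (i : ℕ) : μ.map (fun ω => M.X (S.unit i ω)) = P.map M.X := by
  refine (Measure.map_map M.measurable_X (S.unit_law i).measurable).symm.trans ?_
  rw [(S.unit_law i).map_eq]

lemma indep_train_X {n i : ℕ} (hi : i < n) :
    Indep (S.train n (S.fold n i)) (MeasurableSpace.comap (fun ω => M.X (S.unit i ω))
      inferInstance) μ := by
  refine indep_of_indep_of_le_right (S.train_indep n (S.fold n i)) ?_
  refine le_trans ?_ (le_iSup₂_of_le i ⟨hi, rfl⟩ le_rfl)
  rw [← Function.comp_def M.X, ← MeasurableSpace.comap_comp]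
  exact MeasurableSpace.comap_mono M.measurable_X.comap_le

/-- Conditional Markov inequality for cross-fitted averages: if the integral of a nonnegative
function of training information and covariates over the law of the covariates tends to zero in
probability, then so does its cross-fitted average. -/
lemma tendsto_avg_crossfit [IsProbabilityMeasure μ] {h : ℕ → Fin K → Ω → (Fin d → ℝ) → ℝ}
    (hm : ∀ n k, Measurable[(S.train n k).prod inferInstance]
      (fun q : Ω × (Fin d → ℝ) => h n k q.1 q.2))
    (h0 : ∀ n k ω x, 0 ≤ h n k ω x)
    (hlim : ∀ k, Tendsto (fun q : ℕ × Ω => ∫⁻ x, ENNReal.ofReal (h q.1 k q.2 x) ∂(P.map M.X))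
      (probFilter μ) (𝓝 0)) :
    Tendsto (fun q : ℕ × Ω => avg q.1 fun i => h q.1 (S.fold q.1 i) q.2 (M.X (S.unit i q.2)))
      (probFilter μ) (𝓝 0) := by
  have : IsProbabilityMeasure P := by
    rw [← (S.unit_law 0).map_eq]
    exact Measure.isProbabilityMeasure_map (S.unit_law 0).measurable.aemeasurable
  have : IsProbabilityMeasure (P.map M.X) :=
    Measure.isProbabilityMeasure_map M.measurable_X.aemeasurable
  rw [Metric.tendsto_nhds]
  intro ε hε
  rw [eventually_probFilter, ENNReal.tendsto_nhds_zero]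
  intro η hη
  obtain ⟨η', hη', hηle⟩ : ∃ η' : ℝ, 0 < η' ∧ ENNReal.ofReal η' ≤ η / 2 := by
    have h2 : 0 < min (η / 2) 1 := lt_min (ENNReal.half_pos hη.ne') one_pos
    have htop : min (η / 2) 1 ≠ ∞ := ne_top_of_le_ne_top ENNReal.one_ne_top (min_le_right _ _)
    refine ⟨(min (η / 2) 1).toReal, ENNReal.toReal_pos h2.ne' htop, ?_⟩
    rw [ENNReal.ofReal_toReal htop]
    exact min_le_left _ _
  -- Markov's inequality at level ε divides by ε, so conditional means below εη' leave probability
  -- at most η' ≤ η/2.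
  set δ : ℝ≥0∞ := ENNReal.ofReal (ε * η') with hδ
  have hδpos : 0 < δ := ENNReal.ofReal_pos.2 (by positivity)
  let I : ℕ → Fin K → Ω → ℝ≥0∞ := fun n k ω => ∫⁻ x, ENNReal.ofReal (h n k ω x) ∂(P.map M.X)
  have hbad : ∀ᶠ q in probFilter μ, ∀ k, I q.1 k q.2 < δ :=
    eventually_all.2 fun k => (hlim k).eventually (gt_mem_nhds hδpos)
  rw [eventually_probFilter, ENNReal.tendsto_nhds_zero] at hbad
  filter_upwards [hbad (η / 2) (ENNReal.half_pos hη.ne'), eventually_gt_atTop 0] with n hn hn0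
  have hn' : (0 : ℝ) < n := by exact_mod_cast hn0
  have hHm : ∀ k, Measurable[(S.train n k).prod inferInstance]
      (fun q : Ω × (Fin d → ℝ) => ENNReal.ofReal (h n k q.1 q.2)) := fun k =>
    ENNReal.measurable_ofReal.comp (hm n k)
  have hIm : ∀ k, Measurable[S.train n k] (I n k) := fun k =>
    @Measurable.lintegral_prod_right' Ω (Fin d → ℝ) (S.train n k) _ _ _ _ (hHm k)
  have hAm : ∀ k, MeasurableSet[S.train n k] {ω | I n k ω < δ} := fun k =>
    (hIm k) measurableSet_Iio
  -- Truncation to the event that the conditional mean is below δ. The event belongs to the training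
  -- information, so conditioning still applies and bounds the mean of each truncated term by δ,
  -- with no integrability assumption on the fits.
  let g : ℕ → Ω → ℝ≥0∞ := fun i ω => {ω | I n (S.fold n i) ω < δ}.indicator
    (fun ω => ENNReal.ofReal (h n (S.fold n i) ω (M.X (S.unit i ω)))) ω
  have hgm : ∀ i, Measurable (g i) := fun i => by
    refine Measurable.indicator ?_ (S.train_le n _ _ (hAm _))
    have h1 : Measurable fun ω : Ω => (ω, M.X (S.unit i ω)) :=
      measurable_id.prodMk (S.measurable_X_unit i)
    have h2 : Measurable (fun q : Ω × (Fin d → ℝ) =>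
        ENNReal.ofReal (h n (S.fold n i) q.1 q.2)) :=
      (hHm _).mono (sup_le_sup (MeasurableSpace.comap_mono (S.train_le n _)) le_rfl) le_rfl
    exact h2.comp h1
  have hgint : ∀ i < n, ∫⁻ ω, g i ω ∂μ ≤ δ := by
    intro i hi
    let H : Ω × (Fin d → ℝ) → ℝ≥0∞ := fun q => {ω | I n (S.fold n i) ω < δ}.indicator 1 q.1 *
      ENNReal.ofReal (h n (S.fold n i) q.1 q.2)
    have hHH : Measurable[(S.train n (S.fold n i)).prod inferInstance] H :=
      @measurable_indicator_fst_mul Ω (Fin d → ℝ) (S.train n (S.fold n i)) _ _ (hAm _) _ (hHm _)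
    have e := lintegral_comp_of_indep (S.train_le n _) (S.measurable_X_unit i)
      (S.indep_train_X hi) hHH
    have e1 : ∀ ω, g i ω = H (ω, M.X (S.unit i ω)) := fun ω => by
      by_cases hω : I n (S.fold n i) ω < δ <;> simp [g, H, hω, Set.indicator]
    simp_rw [e1]
    rw [e, S.map_X_unit]
    calc ∫⁻ ω, ∫⁻ x, H (ω, x) ∂(P.map M.X) ∂μ ≤ ∫⁻ _, δ ∂μ := by
          refine lintegral_mono fun ω => ?_
          by_cases hω : I n (S.fold n i) ω < δ
          · simpa [H, hω, Set.indicator] using hω.le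
          · simp [H, hω, Set.indicator]
      _ = δ := by simp
  have hsub : {ω | ¬ dist (avg n fun i => h n (S.fold n i) ω (M.X (S.unit i ω))) 0 < ε} ⊆
      {ω | ¬ ∀ k, I n k ω < δ} ∪
        {ω | ENNReal.ofReal (ε * n) ≤ ∑ i ∈ Finset.range n, g i ω} := by
    intro ω hω
    by_cases hk : ∀ k, I n k ω < δ
    · right
      simp only [Set.mem_ofPred_eq, not_lt] at hω ⊢
      rw [Real.dist_eq, sub_zero, abs_of_nonneg (avg_nonneg fun i _ => h0 _ _ _ _), avg,
        le_div_iff₀ hn'] at hω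
      refine (ENNReal.ofReal_le_ofReal hω).trans ?_
      rw [ENNReal.ofReal_sum_of_nonneg fun i _ => h0 _ _ _ _]
      refine Finset.sum_le_sum fun i _ => ?_
      simp [g, hk, Set.indicator]
    · exact Or.inl hk
  have hmarkov : μ {ω | ENNReal.ofReal (ε * n) ≤ ∑ i ∈ Finset.range n, g i ω} ≤ η / 2 := by
    refine (meas_ge_le_lintegral_div
      (Finset.measurable_fun_sum _ fun i _ => hgm i).aemeasurable (by simp; positivity)
      ENNReal.ofReal_ne_top).trans ?_
    rw [lintegral_finsetSum _ fun i _ => hgm i]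
    have hsum : ∑ i ∈ Finset.range n, ∫⁻ ω, g i ω ∂μ ≤ ENNReal.ofReal (n * (ε * η')) := by
      refine (Finset.sum_le_sum fun i hi => hgint i (Finset.mem_range.1 hi)).trans ?_
      rw [Finset.sum_const, Finset.card_range, nsmul_eq_mul, ENNReal.ofReal_mul hn'.le,
        ENNReal.ofReal_natCast]
    refine (ENNReal.div_le_div_right hsum _).trans (le_trans ?_ hηle)
    rw [← ENNReal.ofReal_div_of_pos (by positivity)]
    apply ENNReal.ofReal_le_ofReal
    rw [div_le_iff₀ (by positivity)]
    linarith
  calc _ ≤ μ {ω | ¬ ∀ k, I n k ω < δ} +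
        μ {ω | ENNReal.ofReal (ε * n) ≤ ∑ i ∈ Finset.range n, g i ω} :=
        (measure_mono hsub).trans (measure_union_le _ _)
    _ ≤ η / 2 + η / 2 := add_le_add hn hmarkov
    _ = η := ENNReal.add_halves η

end CrossFitSample

lemma ofReal_sq_eq_enorm_sq (a : ℝ) : ENNReal.ofReal (a ^ 2) = ‖a‖ₑ ^ 2 := by
  rw [Real.enorm_eq_ofReal_abs, ← ENNReal.ofReal_pow (abs_nonneg a), sq_abs]

/-! ### Consistency of the estimated influence contributions -/

namespace CrossFitSample

variable {𝒰 T : Type*} [MeasurableSpace 𝒰] {P : Measure 𝒰} {d : ℕ} {M : Population P T d}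
  {Ω : Type*} [mΩ : MeasurableSpace Ω] {μ : Measure Ω} {K : ℕ} (S : CrossFitSample M μ K)

/-- The law of large numbers for functions of the units. -/
lemma tendsto_avg_unit [IsProbabilityMeasure μ] {g : 𝒰 → ℝ} (hg : Measurable g)
    (hint : Integrable g P) :
    Tendsto (fun q : ℕ × Ω => avg q.1 fun i => g (S.unit i q.2)) (probFilter μ)
      (𝓝 (∫ u, g u ∂P)) :=
  tendsto_average S.unit_law S.unit_indep hg hint

lemma tendsto_pHat [IsProbabilityMeasure P] [IsProbabilityMeasure μ] :
    Tendsto (fun q : ℕ × Ω => S.pHat q.1 q.2) (probFilter μ) (𝓝 M.treatedProb) := by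
  rw [← M.integral_D]
  exact tendsto_average S.unit_law S.unit_indep M.measurable_D M.integrable_D

/-- A weakly convergent √n-error is stochastically bounded, so the unscaled error tends to zero
uniformly in t. -/
lemma eventually_abs_tauHat_sub_le [IsProbabilityMeasure μ] [Nonempty T] {Ω₀ : Type*}
    [MeasurableSpace Ω₀] {P₀ : Measure Ω₀} [IsProbabilityMeasure P₀] {Z : Ω₀ → EllInfty T}
    (hZ : @Measurable Ω₀ (EllInfty T) _ (borel (EllInfty T)) Z)
    (hw : WeakConvEllInfty μ S.rootError P₀ Z) {η : ℝ} (hη : 0 < η) :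
    ∀ᶠ q in probFilter μ, ∀ t, |S.tauHat q.1 q.2 t - M.fATT t| ≤ η := by
  rw [eventually_probFilter, ENNReal.tendsto_nhds_zero]
  intro ε hε
  have h1 : 0 < min ε 1 := lt_min hε one_pos
  have htop : min ε 1 ≠ ∞ := ne_top_of_le_ne_top ENNReal.one_ne_top (min_le_right _ _)
  obtain ⟨B, hB⟩ := hw.exists_bound hZ (ENNReal.toReal_pos h1.ne' htop)
  have hsqrt : ∀ᶠ n : ℕ in atTop, B ≤ η * Real.sqrt n := by
    have : Tendsto (fun n : ℕ => η * Real.sqrt n) atTop atTop :=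
      (Real.tendsto_sqrt_atTop.comp tendsto_natCast_atTop_atTop).const_mul_atTop hη
    exact this.eventually_ge_atTop B
  filter_upwards [hB, hsqrt, eventually_gt_atTop 0] with n hn hs hn0
  have hs0 : 0 < Real.sqrt n := Real.sqrt_pos.2 (by exact_mod_cast hn0)
  have hsub : {ω | ¬ ∀ t, |S.tauHat n ω t - M.fATT t| ≤ η} ⊆
      {ω | ¬ ∀ t, |S.rootError n ω t| ≤ B} := by
    intro ω hω hb
    refine hω fun t => ?_
    have := (hb t).trans hs
    rw [rootError, abs_mul, abs_of_pos hs0, mul_comm η] at this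
    exact le_of_mul_le_mul_left this hs0
  refine (measure_mono hsub).trans (le_trans ?_ (min_le_left ε 1))
  rw [← ENNReal.ofReal_toReal htop, ← ENNReal.ofReal_toReal (measure_ne_top μ _)]
  exact ENNReal.ofReal_le_ofReal hn.le

/-- The time point may move with n because the regression error is controlled with the supremum over
t inside the norm; fixing a deterministic s n keeps the integrand measurable. -/
lemma tendsto_avg_sq_reg0Hat_sub [IsProbabilityMeasure μ]
    (h : ∀ k, IsLittleOP μ (fun n ω =>
      normTwoInfty (P.map M.X) (fun x t => S.reg0Hat n k ω x t - M.reg0 x t))) (s : ℕ → T) :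
    Tendsto (fun q : ℕ × Ω => avg q.1 fun i =>
      (S.reg0Hat q.1 (S.fold q.1 i) q.2 (M.X (S.unit i q.2)) (s q.1) -
        M.reg0 (M.X (S.unit i q.2)) (s q.1)) ^ 2) (probFilter μ) (𝓝 0) := by
  refine S.tendsto_avg_crossfit
    (h := fun n k ω x => (S.reg0Hat n k ω x (s n) - M.reg0 x (s n)) ^ 2)
    (fun n k => ?_) (fun _ _ _ _ => sq_nonneg _) fun k => ?_
  · have h2 : Measurable[(S.train n k).prod inferInstance]
        (fun q : Ω × (Fin d → ℝ) => M.reg0 q.2 (s n)) :=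
      (M.measurable_reg0 (s n)).comp (@measurable_snd _ _ (S.train n k) _)
    exact ((S.measurable_reg0Hat n k (s n)).sub h2).pow_const 2
  · have h1 := ENNReal.Tendsto.pow (n := 2) (isLittleOP_iff.1 (h k))
    rw [zero_pow two_ne_zero] at h1
    refine tendsto_of_tendsto_of_tendsto_of_le_of_le tendsto_const_nhds h1 (fun _ => zero_le)
      fun q => ?_
    rw [normTwoInfty, ← ENNReal.rpow_natCast, ← ENNReal.rpow_mul]
    norm_num
    refine lintegral_mono fun x => ?_
    rw [ofReal_sq_eq_enorm_sq]
    exact pow_le_pow_left₀ zero_le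
      (le_iSup (fun t => ‖S.reg0Hat q.1 k q.2 x t - M.reg0 x t‖ₑ) (s q.1)) 2

lemma tendsto_avg_sq_propHat_sub [IsProbabilityMeasure μ]
    (h : ∀ k, IsLittleOP μ (fun n ω =>
      eLpNorm (fun x => S.propHat n k ω x - M.prop x) 2 (P.map M.X))) :
    Tendsto (fun q : ℕ × Ω => avg q.1 fun i =>
      (S.propHat q.1 (S.fold q.1 i) q.2 (M.X (S.unit i q.2)) - M.prop (M.X (S.unit i q.2))) ^ 2)
      (probFilter μ) (𝓝 0) := by
  refine S.tendsto_avg_crossfit (h := fun n k ω x => (S.propHat n k ω x - M.prop x) ^ 2)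
    (fun n k => ?_) (fun _ _ _ _ => sq_nonneg _) fun k => ?_
  · have h2 : Measurable[(S.train n k).prod inferInstance]
        (fun q : Ω × (Fin d → ℝ) => M.prop q.2) :=
      M.measurable_prop.comp (@measurable_snd _ _ (S.train n k) _)
    exact ((S.measurable_propHat n k).sub h2).pow_const 2
  · have h1 := ENNReal.Tendsto.pow (n := 2) (isLittleOP_iff.1 (h k))
    rw [zero_pow two_ne_zero] at h1
    refine h1.congr fun q => ?_
    rw [eLpNorm_eq_lintegral_rpow_enorm_toReal (by norm_num) (by norm_num),
      ← ENNReal.rpow_natCast, ← ENNReal.rpow_mul]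
    norm_num
    simp_rw [ofReal_sq_eq_enorm_sq]

/-- Products of the squared error of the fitted propensities and an integrable weight are
asymptotically negligible on average. -/
lemma tendsto_avg_propHat_mul [IsProbabilityMeasure P] [IsProbabilityMeasure μ]
    (hoverlap : M.Overlap) (hfitted : S.FittedOverlap)
    (h : ∀ k, IsLittleOP μ (fun n ω =>
      eLpNorm (fun x => S.propHat n k ω x - M.prop x) 2 (P.map M.X)))
    {W : 𝒰 → ℝ} (hW : Measurable W) (hW0 : ∀ u, 0 ≤ W u) (hWi : Integrable W P) :
    Tendsto (fun q : ℕ × Ω => avg q.1 fun i =>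
      (S.propHat q.1 (S.fold q.1 i) q.2 (M.X (S.unit i q.2)) - M.prop (M.X (S.unit i q.2))) ^ 2 *
        W (S.unit i q.2)) (probFilter μ) (𝓝 0) := by
  obtain ⟨c, hc, -, hov⟩ := hoverlap
  obtain ⟨c', hc', -, hfit⟩ := hfitted
  have hfit' := eventually_probFilter (p := fun q : ℕ × Ω => ∀ i < q.1,
      c' ≤ S.propHat q.1 (S.fold q.1 i) q.2 (M.X (S.unit i q.2)) ∧
        S.propHat q.1 (S.fold q.1 i) q.2 (M.X (S.unit i q.2)) ≤ 1 - c').2 hfit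
  have hov' : ∀ᶠ q in probFilter μ, ∀ i, c ≤ M.prop (M.X (S.unit i q.2)) ∧
      M.prop (M.X (S.unit i q.2)) ≤ 1 - c := eventually_probFilter_of_ae fun n =>
    ae_all_iff.2 fun i => (S.unit_law i).quasiMeasurePreserving.ae hov
  have hprop := S.tendsto_avg_sq_propHat_sub h
  -- the tail of the weight
  have htail : Tendsto (fun k : ℕ => ∫ u, {u | (k : ℝ) < W u}.indicator W u ∂P) atTop (𝓝 0) := by
    have hs : ∀ k : ℕ, MeasurableSet {u | (k : ℝ) < W u} := fun k =>
      measurableSet_lt measurable_const hW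
    have := tendsto_integral_of_dominated_convergence (μ := P)
      (F := fun k : ℕ => {u | (k : ℝ) < W u}.indicator W) (f := fun _ => 0) W
      (fun k => (hW.indicator (hs k)).aestronglyMeasurable) hWi
      (fun k => Eventually.of_forall fun u => ?_) (Eventually.of_forall fun u => ?_)
    · simpa using this
    · rw [Real.norm_eq_abs, abs_of_nonneg (Set.indicator_nonneg (fun u _ => hW0 u) u)]
      exact Set.indicator_le_self' (fun u _ => hW0 u) u
    · obtain ⟨k₀, hk₀⟩ := exists_nat_gt (W u)
      refine tendsto_const_nhds.congr' ?_
      filter_upwards [eventually_ge_atTop k₀] with k hk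
      rw [Set.indicator_of_notMem]
      simp only [Set.mem_ofPred_eq, not_lt]
      exact hk₀.le.trans (by exact_mod_cast hk)
  rw [Metric.tendsto_nhds]
  intro ε hε
  -- Truncation of the weight at k: where W ≤ k the term is at most k times the squared propensity
  -- error; where W > k that error is at most 1, since both propensities lie in [0, 1], and the tail
  -- average has mean below ε/2.
  obtain ⟨k, hk⟩ := (htail.eventually (gt_mem_nhds (half_pos hε))).exists
  have hs : MeasurableSet {u | (k : ℝ) < W u} := measurableSet_lt measurable_const hW
  have hlln := S.tendsto_avg_unit (hW.indicator hs) (hWi.indicator hs)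
  have hsum := (hprop.const_mul (k : ℝ)).add hlln
  rw [mul_zero, zero_add] at hsum
  filter_upwards [hfit', hov', hsum.eventually (gt_mem_nhds (hk.trans (half_lt_self hε)))]
    with q h1 h2 h3
  rw [Real.dist_eq, sub_zero, abs_of_nonneg (avg_nonneg fun i _ =>
    mul_nonneg (sq_nonneg _) (hW0 _))]
  refine lt_of_le_of_lt ?_ h3
  rw [← avg_const_mul]
  refine (avg_mono fun i hi => ?_).trans (avg_add _ _ _).le
  obtain ⟨a1, a2⟩ := h1 i hi
  obtain ⟨b1, b2⟩ := h2 i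
  have hle : (S.propHat q.1 (S.fold q.1 i) q.2 (M.X (S.unit i q.2)) -
      M.prop (M.X (S.unit i q.2))) ^ 2 ≤ 1 := by
    rw [sq_le_one_iff_abs_le_one, abs_le]
    constructor <;> linarith
  have hn := sq_nonneg (S.propHat q.1 (S.fold q.1 i) q.2 (M.X (S.unit i q.2)) -
      M.prop (M.X (S.unit i q.2)))
  by_cases hw : (k : ℝ) < W (S.unit i q.2)
  · rw [Set.indicator_of_mem (show S.unit i q.2 ∈ {u | (k : ℝ) < W u} from hw)]
    nlinarith [hW0 (S.unit i q.2), mul_nonneg (Nat.cast_nonneg (α := ℝ) k) hn]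
  · rw [Set.indicator_of_notMem (show S.unit i q.2 ∉ {u | (k : ℝ) < W u} from hw)]
    nlinarith [not_lt.1 hw]

lemma sq_inflHat_sub_influence_le [IsProbabilityMeasure P] {n i : ℕ} {ω : Ω} {t : T} {c Φ r : ℝ}
    (hc : 0 < c) (hp0 : 0 < M.treatedProb) (hp : 0 < S.pHat n ω)
    (hπ : c ≤ M.prop (M.X (S.unit i ω)) ∧ M.prop (M.X (S.unit i ω)) ≤ 1 - c)
    (hπ' : c ≤ S.propHat n (S.fold n i) ω (M.X (S.unit i ω)) ∧
      S.propHat n (S.fold n i) ω (M.X (S.unit i ω)) ≤ 1 - c)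
    (hΦ : |M.influence (S.unit i ω) t| ≤ Φ)
    (hr : (S.changeHat n i ω t - M.change (S.unit i ω) t) ^ 2 ≤ r) :
    (S.inflHat n i ω t - M.influence (S.unit i ω) t) ^ 2 ≤
      5 * ((1 / S.pHat n ω * (1 / c)) ^ 2 * r +
      (1 / S.pHat n ω * (1 / c)) ^ 2 *
        (S.reg0Hat n (S.fold n i) ω (M.X (S.unit i ω)) t - M.reg0 (M.X (S.unit i ω)) t) ^ 2 +
      (1 / S.pHat n ω * (1 / c ^ 3)) ^ 2 *
        ((S.propHat n (S.fold n i) ω (M.X (S.unit i ω)) - M.prop (M.X (S.unit i ω))) ^ 2 *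
          Φ ^ 2) +
      (1 / S.pHat n ω) ^ 2 * (S.tauHat n ω t - M.fATT t) ^ 2 +
      (M.treatedProb * (1 / S.pHat n ω) - 1) ^ 2 * Φ ^ 2) := by
  unfold Population.influence at hΦ ⊢
  unfold inflHat scoreHat
  generalize S.tauHat n ω t = τ'
  refine (sq_influence_sub_le hc hp0 M.treatedProb_le_one hp (M.D_binary _) hπ hπ' hΦ).trans ?_
  rw [← one_div_mul_one_div, ← one_div_mul_one_div, ← div_eq_mul_one_div M.treatedProb]
  have := mul_le_mul_of_nonneg_left hr (sq_nonneg (1 / S.pHat n ω * (1 / c)))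
  linarith

/-- Since √n ≥ 1 when the sample is nonempty, the √n-scaled bound dominates the plain error, which
is all that mean-square consistency needs. -/
lemma enorm_changeHat_sub_le {n i : ℕ} (hi : i < n) (ω : Ω) (t : T) :
    ‖S.changeHat n i ω t - M.change (S.unit i ω) t‖ₑ ≤ ENNReal.ofReal (Real.sqrt n) *
      ⨆ i : Fin n, supAbs (fun t => S.changeHat n i ω t - M.change (S.unit i ω) t) := by
  have e1 : ‖S.changeHat n i ω t - M.change (S.unit i ω) t‖ₑ ≤
      ⨆ i : Fin n, supAbs (fun t => S.changeHat n i ω t - M.change (S.unit i ω) t) :=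
    le_trans (le_iSup (fun t => ‖S.changeHat n i ω t - M.change (S.unit i ω) t‖ₑ) t)
      (le_iSup (fun i : Fin n =>
        supAbs (fun t => S.changeHat n i ω t - M.change (S.unit i ω) t)) ⟨i, hi⟩)
  have e2 : (1 : ℝ≥0∞) ≤ ENNReal.ofReal (Real.sqrt n) := by
    rw [← ENNReal.ofReal_one]
    apply ENNReal.ofReal_le_ofReal
    rw [Real.one_le_sqrt]
    exact_mod_cast Nat.one_le_iff_ne_zero.2 (Nat.ne_zero_of_lt hi)
  exact e1.trans (le_mul_of_one_le_left zero_le e2)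

/-- The estimated influence contributions are consistent in empirical mean square along any
sequence of time points. -/
lemma tendsto_avg_sq_inflHat_sub [IsProbabilityMeasure P] [IsProbabilityMeasure μ]
    (hoverlap : M.Overlap) (hfitted : S.FittedOverlap)
    (hprop : ∀ k, IsLittleOP μ (fun n ω =>
      eLpNorm (fun x => S.propHat n k ω x - M.prop x) 2 (P.map M.X)))
    (hreg0 : ∀ k, IsLittleOP μ (fun n ω =>
      normTwoInfty (P.map M.X) (fun x t => S.reg0Hat n k ω x t - M.reg0 x t)))
    {R : ℕ → Ω → ℝ≥0∞} (hrecon : IsLittleOP μ R)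
    (hle : ∀ n ω, ∀ i < n, ∀ t, ‖S.changeHat n i ω t - M.change (S.unit i ω) t‖ₑ ≤ R n ω)
    (henvelope : M.HasEnvelope)
    (htau : ∀ η : ℝ, 0 < η → ∀ᶠ q in probFilter μ, ∀ t, |S.tauHat q.1 q.2 t - M.fATT t| ≤ η)
    (s : ℕ → T) :
    Tendsto (fun q : ℕ × Ω => avg q.1 fun i =>
      (S.inflHat q.1 i q.2 (s q.1) - M.influence (S.unit i q.2) (s q.1)) ^ 2)
      (probFilter μ) (𝓝 0) := by
  obtain ⟨Φ, hΦm, hΦi, hΦb⟩ := henvelope.exists_measurable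
  have hp0 := M.treatedProb_pos hoverlap
  have hA := S.tendsto_avg_sq_reg0Hat_sub hreg0 s
  have hB := S.tendsto_avg_propHat_mul hoverlap hfitted hprop (W := fun u => Φ u ^ 2)
    (hΦm.pow_const 2) (fun u => sq_nonneg _) hΦi
  have hW := S.tendsto_avg_unit (g := fun u => Φ u ^ 2) (hΦm.pow_const 2) hΦi
  have hpH := S.tendsto_pHat
  have hT : Tendsto (fun q : ℕ × Ω => (S.tauHat q.1 q.2 (s q.1) - M.fATT (s q.1)) ^ 2)
      (probFilter μ) (𝓝 0) := by
    have : Tendsto (fun q : ℕ × Ω => S.tauHat q.1 q.2 (s q.1) - M.fATT (s q.1))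
        (probFilter μ) (𝓝 0) := by
      rw [Metric.tendsto_nhds]
      intro ε hε
      filter_upwards [htau (ε / 2) (half_pos hε)] with q hq
      rw [Real.dist_eq, sub_zero]
      linarith [hq (s q.1)]
    simpa using this.pow 2
  have hR := isLittleOP_iff.1 hrecon
  have hR2 : Tendsto (fun q : ℕ × Ω => (R q.1 q.2).toReal ^ 2) (probFilter μ) (𝓝 0) := by
    have := ((ENNReal.tendsto_toReal ENNReal.zero_ne_top).comp hR).pow 2
    rw [ENNReal.toReal_zero, zero_pow two_ne_zero] at this
    exact this
  obtain ⟨c₁, hc₁, -, hov⟩ := hoverlap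
  obtain ⟨c₂, hc₂, -, hfit⟩ := hfitted
  set c := min c₁ c₂ with hcdef
  have hc : 0 < c := lt_min hc₁ hc₂
  have hfit' := eventually_probFilter (p := fun q : ℕ × Ω => ∀ i < q.1,
      c₂ ≤ S.propHat q.1 (S.fold q.1 i) q.2 (M.X (S.unit i q.2)) ∧
        S.propHat q.1 (S.fold q.1 i) q.2 (M.X (S.unit i q.2)) ≤ 1 - c₂).2 hfit
  have hov' : ∀ᶠ q in probFilter μ, ∀ i, (c₁ ≤ M.prop (M.X (S.unit i q.2)) ∧
      M.prop (M.X (S.unit i q.2)) ≤ 1 - c₁) ∧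
      ∀ t, |M.influence (S.unit i q.2) t| ≤ Φ (S.unit i q.2) :=
    eventually_probFilter_of_ae fun n =>
      ae_all_iff.2 fun i => (S.unit_law i).quasiMeasurePreserving.ae (hov.and hΦb)
  have hinv : Tendsto (fun q : ℕ × Ω => 1 / S.pHat q.1 q.2) (probFilter μ)
      (𝓝 (1 / M.treatedProb)) := by
    simpa using hpH.inv₀ hp0.ne'
  have hbound : Tendsto (fun q : ℕ × Ω => 5 * (
      (1 / S.pHat q.1 q.2 * (1 / c)) ^ 2 * (R q.1 q.2).toReal ^ 2 +
      (1 / S.pHat q.1 q.2 * (1 / c)) ^ 2 * (avg q.1 fun i =>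
        (S.reg0Hat q.1 (S.fold q.1 i) q.2 (M.X (S.unit i q.2)) (s q.1) -
          M.reg0 (M.X (S.unit i q.2)) (s q.1)) ^ 2) +
      (1 / S.pHat q.1 q.2 * (1 / c ^ 3)) ^ 2 * (avg q.1 fun i =>
        (S.propHat q.1 (S.fold q.1 i) q.2 (M.X (S.unit i q.2)) -
          M.prop (M.X (S.unit i q.2))) ^ 2 * Φ (S.unit i q.2) ^ 2) +
      (1 / S.pHat q.1 q.2) ^ 2 * (S.tauHat q.1 q.2 (s q.1) - M.fATT (s q.1)) ^ 2 +
      (M.treatedProb * (1 / S.pHat q.1 q.2) - 1) ^ 2 *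
        (avg q.1 fun i => Φ (S.unit i q.2) ^ 2))) (probFilter μ) (𝓝 0) := by
    -- In the first four terms a bounded coefficient meets a vanishing average; in the last the
    -- average of Φ² only converges, and the coefficient (p₀/p̂ - 1)² vanishes.
    have h1 := (hinv.mul_const (1 / c)).pow 2
    have h3 := (hinv.mul_const (1 / c ^ 3)).pow 2
    have h5 := ((hinv.const_mul M.treatedProb).sub_const 1).pow 2
    have h6 := (((((h1.mul hR2).add (h1.mul hA)).add (h3.mul hB)).add
      ((hinv.pow 2).mul hT)).add (h5.mul hW)).const_mul 5
    have hz : M.treatedProb * (1 / M.treatedProb) - 1 = 0 := by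
      rw [mul_one_div_cancel hp0.ne', sub_self]
    rw [hz] at h6
    simpa only [mul_zero, add_zero, zero_mul, ne_eq, OfNat.ofNat_ne_zero, not_false_eq_true,
      zero_pow] using h6
  refine tendsto_of_tendsto_of_tendsto_of_le_of_le' tendsto_const_nhds hbound
    (Eventually.of_forall fun q => avg_nonneg fun i _ => sq_nonneg _) ?_
  filter_upwards [hfit', hov', hpH.eventually (lt_mem_nhds hp0),
    hR.eventually (gt_mem_nhds ENNReal.zero_lt_top),
    tendsto_fst_probFilter.eventually_gt_atTop 0] with q h1 h2 h3 h4 h5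
  -- Finiteness of R at q matters here: `toReal` would send an infinite bound to zero.
  have hrec : ∀ i < q.1, (S.changeHat q.1 i q.2 (s q.1) - M.change (S.unit i q.2) (s q.1)) ^ 2 ≤
      (R q.1 q.2).toReal ^ 2 := by
    intro i hi
    rw [← sq_abs]
    refine pow_le_pow_left₀ (abs_nonneg _) ?_ 2
    rw [← Real.norm_eq_abs, ← toReal_enorm]
    refine ENNReal.toReal_mono h4.ne ?_
    exact hle _ _ i hi _
  have key : ∀ i < q.1, (S.inflHat q.1 i q.2 (s q.1) - M.influence (S.unit i q.2) (s q.1)) ^ 2 ≤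
      5 * ((1 / S.pHat q.1 q.2 * (1 / c)) ^ 2 * (R q.1 q.2).toReal ^ 2 +
      (1 / S.pHat q.1 q.2 * (1 / c)) ^ 2 *
        (S.reg0Hat q.1 (S.fold q.1 i) q.2 (M.X (S.unit i q.2)) (s q.1) -
          M.reg0 (M.X (S.unit i q.2)) (s q.1)) ^ 2 +
      (1 / S.pHat q.1 q.2 * (1 / c ^ 3)) ^ 2 *
        ((S.propHat q.1 (S.fold q.1 i) q.2 (M.X (S.unit i q.2)) -
          M.prop (M.X (S.unit i q.2))) ^ 2 * Φ (S.unit i q.2) ^ 2) +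
      (1 / S.pHat q.1 q.2) ^ 2 * (S.tauHat q.1 q.2 (s q.1) - M.fATT (s q.1)) ^ 2 +
      (M.treatedProb * (1 / S.pHat q.1 q.2) - 1) ^ 2 * Φ (S.unit i q.2) ^ 2) := by
    intro i hi
    have hcl : c ≤ c₁ := min_le_left _ _
    have hcr : c ≤ c₂ := min_le_right _ _
    exact S.sq_inflHat_sub_influence_le hc hp0 h3
      ⟨hcl.trans (h2 i).1.1, (h2 i).1.2.trans (by linarith)⟩
      ⟨hcr.trans (h1 i hi).1, (h1 i hi).2.trans (by linarith)⟩ ((h2 i).2 (s q.1)) (hrec i hi)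
  refine (avg_mono key).trans (le_of_eq ?_)
  rw [avg_const_mul, avg_add, avg_add, avg_add, avg_add, avg_const h5, avg_const h5,
    avg_const_mul, avg_const_mul, avg_const_mul]

end CrossFitSample

/-! ### The multiplier bootstrap on the grid -/

lemma exists_seq_mem_grid {T : Type*} [PseudoMetricSpace T] {grid : ℕ → Finset T}
    (hmesh : ∀ δ : ℝ, 0 < δ → ∀ᶠ n in atTop, ∀ t : T, ∃ s ∈ grid n, dist t s < δ) (t : T) :
    ∃ s : ℕ → T, Tendsto s atTop (𝓝 t) ∧ ∀ᶠ n in atTop, s n ∈ grid n := by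
  have h : ∀ n, ∃ s : T, (grid n).Nonempty → s ∈ grid n ∧ ∀ s' ∈ grid n, dist t s ≤ dist t s' := by
    intro n
    by_cases hn : (grid n).Nonempty
    · obtain ⟨s, hs, hs'⟩ := (grid n).exists_min_image (dist t) hn
      exact ⟨s, fun _ => ⟨hs, hs'⟩⟩
    · exact ⟨t, fun h => absurd h hn⟩
  choose s hs using h
  refine ⟨s, ?_, ?_⟩
  · rw [Metric.tendsto_nhds]
    intro ε hε
    filter_upwards [hmesh ε hε] with n hn
    obtain ⟨s', h1, h2⟩ := hn t
    rw [dist_comm]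
    exact ((hs n ⟨s', h1⟩).2 s' h1).trans_lt h2
  · filter_upwards [hmesh 1 one_pos] with n hn
    obtain ⟨s', h1, -⟩ := hn t
    exact (hs n ⟨s', h1⟩).1

namespace CrossFitSample

variable {𝒰 T : Type*} [MeasurableSpace 𝒰] {P : Measure 𝒰} {d : ℕ} {M : Population P T d}
  {Ω : Type*} [mΩ : MeasurableSpace Ω] {μ : Measure Ω} {K : ℕ} (S : CrossFitSample M μ K)

/-- The mean of the average is exactly the kernel increment between s n and t, so Markov's
inequality suffices and no uniform law of large numbers is needed. -/
lemma tendsto_avg_sq_increment [IsProbabilityMeasure P] (henvelope : M.HasEnvelope)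
    {s : ℕ → T} {t : T}
    (hincr : Tendsto (fun n => M.covKernel (s n) (s n) - 2 * M.covKernel (s n) t +
      M.covKernel t t) atTop (𝓝 0)) :
    Tendsto (fun q : ℕ × Ω => avg q.1 fun i =>
      (M.centredInfl (S.unit i q.2) (s q.1) - M.centredInfl (S.unit i q.2) t) ^ 2)
      (probFilter μ) (𝓝 0) := by
  have hm : ∀ n, Measurable fun u => (M.centredInfl u (s n) - M.centredInfl u t) ^ 2 := fun n =>
    ((M.measurable_centredInfl _).sub (M.measurable_centredInfl _)).pow_const 2
  have hi : ∀ n, Integrable (fun u => (M.centredInfl u (s n) - M.centredInfl u t) ^ 2) P :=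
    fun n => ((M.memLp_centredInfl henvelope _).sub (M.memLp_centredInfl henvelope _)).integrable_sq
  have hiu : ∀ n i, Integrable (fun ω =>
      (M.centredInfl (S.unit i ω) (s n) - M.centredInfl (S.unit i ω) t) ^ 2) μ := fun n i =>
    (S.unit_law i).integrable_comp_of_integrable (hi n)
  refine tendsto_probFilter_of_lintegral (f := fun n ω => avg n fun i =>
    (M.centredInfl (S.unit i ω) (s n) - M.centredInfl (S.unit i ω) t) ^ 2) (fun n => ?_) ?_
    fun n ω => avg_nonneg fun i _ => sq_nonneg _
  · exact ((Finset.measurable_fun_sum _ fun i _ =>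
      (hm n).comp (S.unit_law i).measurable).div_const _).aemeasurable
  · have hint : ∀ n, ∫⁻ ω, ENNReal.ofReal (avg n fun i =>
        (M.centredInfl (S.unit i ω) (s n) - M.centredInfl (S.unit i ω) t) ^ 2) ∂μ =
        ENNReal.ofReal (avg n fun _ => M.covKernel (s n) (s n) - 2 * M.covKernel (s n) t +
          M.covKernel t t) := by
      intro n
      rw [← ofReal_integral_eq_lintegral_ofReal]
      · congr 1
        unfold avg
        rw [integral_div, integral_finsetSum _ fun i _ => hiu n i]
        congr 1
        refine Finset.sum_congr rfl fun i _ => ?_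
        have e := integral_map (μ := μ) (S.unit_law i).measurable.aemeasurable
          (hm n).aestronglyMeasurable
        rw [(S.unit_law i).map_eq, M.integral_sq_increment henvelope] at e
        exact e.symm
      · exact (integrable_finsetSum _ fun i _ => hiu n i).div_const _
      · exact Eventually.of_forall fun ω => avg_nonneg fun i _ => sq_nonneg _
    simp_rw [hint]
    rw [← ENNReal.ofReal_zero]
    refine (ENNReal.continuous_ofReal.tendsto 0).comp (hincr.congr' ?_)
    filter_upwards [eventually_gt_atTop 0] with n hn
    rw [avg_const hn]

/-- The centred estimated influence contributions at `s n → t` approximate the centred influence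
function at `t` in empirical mean square. -/
lemma tendsto_avg_sq_centred_inflHat_sub [IsProbabilityMeasure P] [IsProbabilityMeasure μ]
    (henvelope : M.HasEnvelope) {s : ℕ → T} {t : T}
    (hinfl : Tendsto (fun q : ℕ × Ω => avg q.1 fun i =>
      (S.inflHat q.1 i q.2 (s q.1) - M.influence (S.unit i q.2) (s q.1)) ^ 2)
      (probFilter μ) (𝓝 0))
    (hincr : Tendsto (fun n => M.covKernel (s n) (s n) - 2 * M.covKernel (s n) t +
      M.covKernel t t) atTop (𝓝 0)) :
    Tendsto (fun q : ℕ × Ω => avg q.1 fun i =>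
      (S.inflHat q.1 i q.2 (s q.1) - S.inflMean q.1 q.2 (s q.1) -
        M.centredInfl (S.unit i q.2) t) ^ 2) (probFilter μ) (𝓝 0) := by
  have hinc := S.tendsto_avg_sq_increment henvelope hincr
  have hb : Tendsto (fun q : ℕ × Ω => avg q.1 fun i =>
      ((S.inflHat q.1 i q.2 (s q.1) - M.influence (S.unit i q.2) (s q.1)) +
      (M.centredInfl (S.unit i q.2) (s q.1) - M.centredInfl (S.unit i q.2) t)) ^ 2)
      (probFilter μ) (𝓝 0) := by
    have hsum := (hinfl.const_mul 2).add (hinc.const_mul 2)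
    rw [mul_zero, add_zero] at hsum
    refine tendsto_of_tendsto_of_tendsto_of_le_of_le tendsto_const_nhds hsum
      (fun q => avg_nonneg fun i _ => sq_nonneg _) fun q => ?_
    simp only [← avg_const_mul]
    rw [← avg_add]
    refine avg_mono fun i _ => ?_
    nlinarith [sq_nonneg ((S.inflHat q.1 i q.2 (s q.1) - M.influence (S.unit i q.2) (s q.1)) -
      (M.centredInfl (S.unit i q.2) (s q.1) - M.centredInfl (S.unit i q.2) t))]
  have hu := S.tendsto_avg_unit (g := fun u => M.centredInfl u t) (M.measurable_centredInfl t)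
    ((M.memLp_centredInfl henvelope t).integrable one_le_two)
  rw [M.integral_centredInfl henvelope] at hu
  refine (tendsto_avg_centred_close tendsto_fst_probFilter hb hu).congr' ?_
  filter_upwards [tendsto_fst_probFilter.eventually_gt_atTop 0] with q hq
  have key : ∀ i, M.centredInfl (S.unit i q.2) t +
      ((S.inflHat q.1 i q.2 (s q.1) - M.influence (S.unit i q.2) (s q.1)) +
      (M.centredInfl (S.unit i q.2) (s q.1) - M.centredInfl (S.unit i q.2) t)) =
      S.inflHat q.1 i q.2 (s q.1) - ∫ u, M.influence u (s q.1) ∂P := by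
    intro i
    unfold Population.centredInfl
    ring
  simp_rw [key]
  rw [avg_sub, avg_const hq]
  congr 1
  funext i
  unfold inflMean avg
  ring

/-- Conditional central limit theorem for the multiplier process at finitely many convergent
sequences of time points. -/
lemma eventually_measure_multPath_lt [IsProbabilityMeasure P] [IsProbabilityMeasure μ]
    {Ω₀ : Type*} [MeasurableSpace Ω₀] {P₀ : Measure Ω₀} [IsProbabilityMeasure P₀]
    {Z : Ω₀ → EllInfty T} (hZ : IsTightGaussian P₀ Z M.covKernel)
    {Ξ : Type*} [MeasurableSpace Ξ] {Q : Measure Ξ} [IsProbabilityMeasure Q]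
    {ξ : ℕ → Ξ → ℝ} (hm : ∀ i, Measurable (ξ i)) (hind : iIndepFun ξ Q)
    (hid : ∀ i, IdentDistrib (ξ i) (ξ 0) Q Q) (h0 : ∫ ζ, ξ 0 ζ ∂Q = 0)
    (h1 : ∫ ζ, ξ 0 ζ ^ 2 ∂Q = 1)
    (henvelope : M.HasEnvelope) {m : ℕ} {t : Fin m → T} {s : Fin m → ℕ → T}
    (hclose : ∀ j, Tendsto (fun q : ℕ × Ω => avg q.1 fun i =>
      (S.inflHat q.1 i q.2 (s j q.1) - S.inflMean q.1 q.2 (s j q.1) -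
        M.centredInfl (S.unit i q.2) (t j)) ^ 2) (probFilter μ) (𝓝 0))
    {y : Fin m → ℝ} {r : ℝ≥0∞} (hr : P₀ {ω | ∀ j, |Z ω (t j)| ≤ y j} < r) :
    ∀ᶠ q in probFilter μ,
      Q {ζ | ∀ j, |S.multPath q.1 q.2 (fun i => ξ i ζ) (s j q.1)| ≤ y j} < r := by
  have hev : Measurable fun ω =>
      (WithLp.toLp 2 fun j => Z ω (t j) : EuclideanSpace ℝ (Fin m)) :=
    (WithLp.measurable_toLp 2 _).comp (measurable_pi_lambda _ fun j => hZ.measurable_eval _)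
  have := Measure.isProbabilityMeasure_map (μ := P₀) hev.aemeasurable
  -- Given the data, the multiplier path is a weighted multiplier sum with these weights: their Gram
  -- matrix converges by the law of large numbers for the true influence function, and their size is
  -- controlled since maxima of square-integrable variables are o_p(√n).
  set w : ℕ × Ω → ℕ → Fin m → ℝ := fun q i j =>
    (S.inflHat q.1 i q.2 (s j q.1) - S.inflMean q.1 q.2 (s j q.1)) / Real.sqrt q.1 with hw
  have hF : IsClosed {z : EuclideanSpace ℝ (Fin m) | ∀ j, |z j| ≤ y j} := by
    simp only [Set.ofPred_forall]
    exact isClosed_iInter fun j => isClosed_le (by fun_prop) continuous_const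
  have hsq : ∀ j k, Tendsto (fun q : ℕ × Ω => avg q.1 fun i =>
      M.centredInfl (S.unit i q.2) (t j) * M.centredInfl (S.unit i q.2) (t k)) (probFilter μ)
      (𝓝 (M.covKernel (t j) (t k))) := fun j k =>
    S.tendsto_avg_unit (g := fun u => M.centredInfl u (t j) * M.centredInfl u (t k))
      ((M.measurable_centredInfl _).mul (M.measurable_centredInfl _))
      (M.integrable_centredInfl_mul henvelope _ _)
  have hsq' : ∀ j, Tendsto (fun q : ℕ × Ω => avg q.1 fun i =>
      M.centredInfl (S.unit i q.2) (t j) ^ 2) (probFilter μ)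
      (𝓝 (M.covKernel (t j) (t j))) := fun j => by
    simpa only [sq] using hsq j j
  have key := eventually_measure_multSum_lt hm hind hid h0 h1 (hZ.charFun_fidi t)
    (L := probFilter μ) (N := fun q => q.1) (w := w) (fun j k => ?_) (fun δ hδ => ?_) hF
    (r := r) ?_
  · filter_upwards [key] with q hq
    refine lt_of_le_of_lt (measure_mono ?_) hq
    intro ζ hζ j
    convert hζ j using 2
    simp only [multSum, multPath, hw, Finset.sum_div, mul_comm, mul_div_assoc]
  · refine (tendsto_avg_mul_of_close (hclose j) (hclose k) (hsq' j) (hsq' k) (hsq j k)).congr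
      fun q => ?_
    simp only [hw, avg, div_mul_div_comm, Real.mul_self_sqrt (Nat.cast_nonneg q.1),
      Finset.sum_div]
  · refine eventually_all.2 (fun j => eventually_abs_le_of_close (hclose j) (fun ε hε => ?_) hδ)
      |>.mono fun q hq i hi j => ?_
    · exact eventually_forall_abs_le S.unit_law (M.measurable_centredInfl (t j))
        (M.memLp_centredInfl henvelope _).integrable_sq hε
    · have hpos : 0 < Real.sqrt q.1 :=
        Real.sqrt_pos.2 (by exact_mod_cast Nat.zero_lt_of_lt hi)
      rw [hw]
      simp only
      rw [abs_div, abs_of_pos hpos, div_le_iff₀ hpos]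
      exact hq j i hi
  · rwa [Measure.map_apply hev hF.measurableSet]

section GridBootstrap

variable {Ξ : Type*} [MeasurableSpace Ξ] {Q : Measure Ξ} [IsProbabilityMeasure Q]
  {Ω₀ : Type*} [MeasurableSpace Ω₀] {P₀ : Measure Ω₀}
  {Z : Ω₀ → EllInfty T} {ξ : ℕ → Ξ → ℝ} {grid : ℕ → Finset T} {c : ℝ}

/-- The bootstrap distribution function of the grid maximum asymptotically does not exceed the
limiting distribution function. -/
lemma eventually_gridBootCdf_lt [PseudoMetricSpace T] [TopologicalSpace.SeparableSpace T]
    [Nonempty T] [IsProbabilityMeasure P] [IsProbabilityMeasure μ]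
    [IsProbabilityMeasure P₀] (hZ : IsTightGaussian P₀ Z M.covKernel)
    (hcont : ∀ᵐ ω ∂P₀, Continuous fun t => Z ω t)
    (hm : ∀ i, Measurable (ξ i)) (hind : iIndepFun ξ Q)
    (hid : ∀ i, IdentDistrib (ξ i) (ξ 0) Q Q) (h0 : ∫ ζ, ξ 0 ζ ∂Q = 0)
    (h1 : ∫ ζ, ξ 0 ζ ^ 2 ∂Q = 1) (henvelope : M.HasEnvelope)
    (hinfl : ∀ s : ℕ → T, Tendsto (fun q : ℕ × Ω => avg q.1 fun i =>
      (S.inflHat q.1 i q.2 (s q.1) - M.influence (S.unit i q.2) (s q.1)) ^ 2)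
      (probFilter μ) (𝓝 0))
    (hc : 0 < c) (hσ : ∀ t, c ≤ M.sigma t) (hσc : Continuous M.sigma)
    (hsigmaHat : IsLittleOP μ (fun n ω => supAbs (fun t => S.sigmaHat n ω t - M.sigma t)))
    (hmesh : ∀ δ : ℝ, 0 < δ → ∀ᶠ n in atTop, ∀ t : T, ∃ s ∈ grid n, dist t s < δ)
    {x x' r : ℝ} (hx : x < x') (hr : P₀.real {ω | studNorm M.sigma (Z ω) ≤ x'} < r) :
    ∀ᶠ q in probFilter μ, S.gridBootCdf Q ξ (grid q.1) q.1 q.2 x < r := by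
  have hr' : P₀ {ω | studNorm M.sigma (Z ω) ≤ x'} < ENNReal.ofReal r :=
    (ENNReal.lt_ofReal_iff_toReal_lt (measure_ne_top _ _)).2 hr
  -- Finitely many constraints already bring the probability below r; each time point is then
  -- approached by grid points.
  obtain ⟨m, hm'⟩ := ((hZ.tendsto_measure_fidi hcont hc hσ hσc x').eventually
    (gt_mem_nhds hr')).exists
  set t : Fin m → T := fun j => TopologicalSpace.denseSeq T j with ht
  choose s hs hsg using fun j => exists_seq_mem_grid hmesh (t j)
  have hσ' : ∀ j, Tendsto (fun q : ℕ × Ω => S.sigmaHat q.1 q.2 (s j q.1)) (probFilter μ)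
      (𝓝 (M.sigma (t j))) := by
    intro j
    have e1 : Tendsto (fun q : ℕ × Ω => M.sigma (s j q.1)) (probFilter μ) (𝓝 (M.sigma (t j))) :=
      (hσc.tendsto _).comp ((hs j).comp tendsto_fst_probFilter)
    have e2 : Tendsto (fun q : ℕ × Ω => S.sigmaHat q.1 q.2 (s j q.1) - M.sigma (s j q.1))
        (probFilter μ) (𝓝 0) := by
      rw [tendsto_zero_iff_enorm_tendsto_zero]
      exact tendsto_of_tendsto_of_tendsto_of_le_of_le tendsto_const_nhds
        (isLittleOP_iff.1 hsigmaHat) (fun _ => zero_le) fun q =>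
          le_iSup (fun t => ‖S.sigmaHat q.1 q.2 t - M.sigma t‖ₑ) (s j q.1)
    simpa using e2.add e1
  have hpos : ∀ᶠ q in probFilter μ, ∀ j, 0 < S.sigmaHat q.1 q.2 (s j q.1) :=
    eventually_all.2 fun j => (hσ' j).eventually (lt_mem_nhds (hc.trans_le (hσ _)))
  -- The gap x < x' absorbs the replacement of σ̂ at moving grid points by σ at their limits; σ ≥ c
  -- > 0 keeps it strict.
  have hxs : ∀ᶠ q in probFilter μ, ∀ j, x * S.sigmaHat q.1 q.2 (s j q.1) < x' * M.sigma (t j) :=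
    eventually_all.2 fun j => ((hσ' j).const_mul x).eventually
      (gt_mem_nhds (mul_lt_mul_of_pos_right hx (hc.trans_le (hσ _))))
  have hgr : ∀ᶠ q in probFilter μ, ∀ j, s j q.1 ∈ grid q.1 :=
    tendsto_fst_probFilter.eventually (eventually_all.2 hsg)
  have hlim := S.eventually_measure_multPath_lt hZ hm hind hid h0 h1 henvelope (t := t) (s := s)
    (y := fun j => x' * M.sigma (t j)) (r := ENNReal.ofReal r)
    (fun j => S.tendsto_avg_sq_centred_inflHat_sub henvelope (hinfl (s j))
      ((hZ.tendsto_variance_increment hcont (t j)).comp (hs j))) (by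
        refine lt_of_le_of_lt (measure_mono ?_) hm'
        intro ω hω j hj
        exact hω ⟨j, Finset.mem_range.1 hj⟩)
  filter_upwards [hpos, hxs, hgr, hlim] with q h1 h2 h3 h4
  refine ENNReal.toReal_lt_of_lt_ofReal (lt_of_le_of_lt (measure_mono ?_) h4)
  intro ζ hζ j
  have := hζ ⟨s j q.1, h3 j⟩
  simp only [studMult] at this
  rw [abs_div, abs_of_pos (h1 j), div_le_iff₀ (h1 j)] at this
  exact this.trans (h2 j).le

/-- The bootstrap distribution function of the grid maximum is asymptotically at least the
limiting distribution function. -/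
lemma eventually_lt_gridBootCdf
    (hboot : IsLittleOP μ (fun n ω => ⨆ x : ℝ, ENNReal.ofReal
      |supCdf Q (fun ζ t => S.studMult n ω (fun i => ξ i ζ) t) x -
        supCdf P₀ (fun ω t => Z ω t / M.sigma t) x|))
    {x r : ℝ} (hr : r < supCdf P₀ (fun ω t => Z ω t / M.sigma t) x) :
    ∀ᶠ q in probFilter μ, r < S.gridBootCdf Q ξ (grid q.1) q.1 q.2 x := by
  filter_upwards [(isLittleOP_iff.1 hboot).eventually
    (gt_mem_nhds (ENNReal.ofReal_pos.2 (sub_pos.2 hr)))] with q hq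
  have h1 := (ENNReal.ofReal_lt_ofReal_iff (sub_pos.2 hr)).1 ((le_iSup (fun x : ℝ =>
    ENNReal.ofReal |supCdf Q (fun ζ t => S.studMult q.1 q.2 (fun i => ξ i ζ) t) x -
      supCdf P₀ (fun ω t => Z ω t / M.sigma t) x|) x).trans_lt hq)
  -- The grid imposes fewer constraints than the whole interval.
  have h2 : supCdf Q (fun ζ t => S.studMult q.1 q.2 (fun i => ξ i ζ) t) x ≤
      S.gridBootCdf Q ξ (grid q.1) q.1 q.2 x :=
    measureReal_mono fun ζ hζ t => hζ t
  linarith [(abs_lt.1 h1).1]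

end GridBootstrap

end CrossFitSample

/-! ### Empirical frequencies of bootstrap draws -/

section EmpiricalMeasure

variable {Ξ E : Type*} [MeasurableSpace Ξ] [MeasurableSpace E] {Q : Measure Ξ}
  [IsProbabilityMeasure Q] {Y : ℕ → Ξ → E}

/-- Chebyshev's inequality for empirical frequencies. -/
lemma measure_le_abs_freq_sub_le (hY : ∀ b, Measurable (Y b))
    (hind : Pairwise fun b b' => IndepFun (Y b) (Y b') Q)
    (hid : ∀ b, IdentDistrib (Y b) (Y 0) Q Q) {A : Set E} (hA : MeasurableSet A) {B : ℕ}
    (hB : 0 < B) {ε : ℝ} (hε : 0 < ε) :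
    Q {ζ | ε ≤ |(∑ b ∈ Finset.range B, A.indicator 1 (Y b ζ)) / (B : ℝ) -
      Q.real {ζ | Y 0 ζ ∈ A}|} ≤ ENNReal.ofReal (1 / (B * ε ^ 2)) := by
  have hB' : (0 : ℝ) < B := by exact_mod_cast hB
  have hAm : Measurable (A.indicator (1 : E → ℝ)) := measurable_one.indicator hA
  have h01 : ∀ y, A.indicator (1 : E → ℝ) y ∈ Set.Icc (0 : ℝ) 1 := fun y =>
    ⟨Set.indicator_nonneg (fun _ _ => zero_le_one) y,
      Set.indicator_le_self' (fun _ _ => zero_le_one) y⟩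
  have hmem : ∀ b, MemLp (fun ζ => A.indicator (1 : E → ℝ) (Y b ζ)) 2 Q := fun b =>
    MemLp.of_bound (hAm.comp (hY b)).aestronglyMeasurable 1 (Eventually.of_forall fun ζ => by
      rw [Real.norm_eq_abs, abs_of_nonneg (h01 _).1]
      exact (h01 _).2)
  have hmean : ∀ b, ∫ ζ, A.indicator (1 : E → ℝ) (Y b ζ) ∂Q = Q.real {ζ | Y 0 ζ ∈ A} := by
    intro b
    have h1 : ∫ ζ, A.indicator (1 : E → ℝ) (Y b ζ) ∂Q =
        ∫ ζ, A.indicator (1 : E → ℝ) (Y 0 ζ) ∂Q := ((hid b).comp hAm).integral_eq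
    rw [h1]
    exact integral_indicator_one ((hY 0) hA)
  have hvar : Var[∑ b ∈ Finset.range B, fun ζ => A.indicator (1 : E → ℝ) (Y b ζ); Q] ≤ B := by
    rw [IndepFun.variance_sum (fun b _ => hmem b)
      fun b _ b' _ hbb => (hind hbb).comp hAm hAm]
    calc _ ≤ ∑ b ∈ Finset.range B, (1 : ℝ) := by
          refine Finset.sum_le_sum fun b _ => (variance_le_sq_of_bounded (a := 0) (b := 1)
            (Eventually.of_forall fun ζ => h01 _) (hmem b).1.aemeasurable).trans (by norm_num)
      _ = B := by simp
  have hsum : ∫ ζ, (∑ b ∈ Finset.range B, fun ζ => A.indicator (1 : E → ℝ) (Y b ζ)) ζ ∂Q =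
      B * Q.real {ζ | Y 0 ζ ∈ A} := by
    simp only [Finset.sum_apply]
    rw [integral_finsetSum _ fun b _ => (hmem b).integrable one_le_two]
    simp [hmean]
  have hcheb := meas_ge_le_variance_div_sq
    (memLp_finsetSum' (Finset.range B) fun b _ => hmem b) (mul_pos hB' hε)
  rw [hsum] at hcheb
  refine (measure_mono ?_).trans (hcheb.trans (ENNReal.ofReal_le_ofReal ?_))
  · intro ζ hζ
    simp only [Set.mem_ofPred_eq, Finset.sum_apply] at hζ ⊢
    have : (∑ b ∈ Finset.range B, A.indicator (1 : E → ℝ) (Y b ζ)) - B * Q.real {ζ | Y 0 ζ ∈ A} =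
        B * ((∑ b ∈ Finset.range B, A.indicator (1 : E → ℝ) (Y b ζ)) / B -
          Q.real {ζ | Y 0 ζ ∈ A}) := by
      field_simp
    rw [this, abs_mul, abs_of_pos hB']
    exact mul_le_mul_of_nonneg_left hζ hB'.le
  · calc _ ≤ (B : ℝ) / (B * ε) ^ 2 := by gcongr
      _ = 1 / (B * ε ^ 2) := by field_simp

lemma measurable_measureReal_slice {Ω : Type*} [MeasurableSpace Ω] {g : Ξ → E} (hg : Measurable g)
    {D : Set (Ω × E)} (hD : MeasurableSet D) :
    Measurable fun ω => Q.real {ζ | (ω, g ζ) ∈ D} := by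
  have h : MeasurableSet {q : Ω × Ξ | (q.1, g q.2) ∈ D} :=
    (measurable_fst.prodMk (hg.comp measurable_snd)) hD
  exact (measurable_measure_prodMk_left h).ennreal_toReal

/-- Chebyshev's inequality for empirical frequencies of an event that depends on independent
data. -/
lemma measure_prod_le_abs_freq_sub_le {Ω : Type*} [MeasurableSpace Ω] {μ : Measure Ω}
    [IsProbabilityMeasure μ] (hY : ∀ b, Measurable (Y b))
    (hind : Pairwise fun b b' => IndepFun (Y b) (Y b') Q)
    (hid : ∀ b, IdentDistrib (Y b) (Y 0) Q Q) {D : Set (Ω × E)} (hD : MeasurableSet D) {B : ℕ}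
    (hB : 0 < B) {ε : ℝ} (hε : 0 < ε) :
    (μ.prod Q) {q | ε ≤ |(∑ b ∈ Finset.range B, D.indicator 1 (q.1, Y b q.2)) / (B : ℝ) -
      Q.real {ζ | (q.1, Y 0 ζ) ∈ D}|} ≤ ENNReal.ofReal (1 / (B * ε ^ 2)) := by
  have hDm : Measurable (D.indicator (1 : Ω × E → ℝ)) := measurable_one.indicator hD
  have hms : MeasurableSet {q : Ω × Ξ | ε ≤ |(∑ b ∈ Finset.range B,
      D.indicator 1 (q.1, Y b q.2)) / (B : ℝ) - Q.real {ζ | (q.1, Y 0 ζ) ∈ D}|} := by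
    refine measurableSet_le measurable_const (Measurable.abs (Measurable.sub ?_ ?_))
    · exact (Finset.measurable_fun_sum _ fun b _ => hDm.comp
        (measurable_fst.prodMk ((hY b).comp measurable_snd))).div_const _
    · exact (measurable_measureReal_slice (hY 0) hD).comp measurable_fst
  -- With the data fixed, the bound of the previous inequality holds for the section of D and does
  -- not depend on ω, so it survives integration.
  rw [Measure.prod_apply hms]
  calc _ ≤ ∫⁻ _ : Ω, ENNReal.ofReal (1 / (B * ε ^ 2)) ∂μ := lintegral_mono fun ω =>
        measure_le_abs_freq_sub_le hY hind hid (measurable_prodMk_left hD : MeasurableSet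
          (Prod.mk ω ⁻¹' D)) hB hε
    _ = _ := by simp

/-- Adjoining independent randomness turns an exceptional set into a cylinder, whose outer
probability is unchanged even when the set is not measurable. -/
lemma tendsto_fst_probFilter_prod {Ω : Type*} [MeasurableSpace Ω] {μ : Measure Ω} [SFinite μ] :
    Tendsto (fun q : ℕ × (Ω × Ξ) => (q.1, q.2.1)) (probFilter (μ.prod Q)) (probFilter μ) := by
  intro s hs
  rw [mem_map]
  refine Tendsto.congr (fun n => ?_) (show Tendsto (fun n => μ {ω | (n, ω) ∉ s}) atTop (𝓝 0)
    from hs)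
  have : {q : Ω × Ξ | (n, q) ∉ (fun q : ℕ × (Ω × Ξ) => (q.1, q.2.1)) ⁻¹' s} =
      {ω | (n, ω) ∉ s} ×ˢ Set.univ := by
    ext q
    simp
  rw [this, Measure.prod_prod, measure_univ, mul_one]

end EmpiricalMeasure

/-! ### Rows of the multiplier array -/

namespace IsMultiplierArray

variable {Ξ : Type*} [MeasurableSpace Ξ] {Q : Measure Ξ} {ξ : ℕ → ℕ → Ξ → ℝ}

lemma iIndepFun_row (h : IsMultiplierArray Q ξ) (b : ℕ) : iIndepFun (ξ b) Q :=
  h.indep.precomp (g := fun i => (b, i)) fun _ _ hij => (Prod.mk.inj hij).2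

lemma measurable_row (h : IsMultiplierArray Q ξ) (b : ℕ) : Measurable fun ζ i => ξ b i ζ :=
  measurable_pi_lambda _ fun i => h.measurable b i

lemma identDistrib_row (h : IsMultiplierArray Q ξ) (b : ℕ) :
    IdentDistrib (fun ζ i => ξ b i ζ) (fun ζ i => ξ 0 i ζ) Q Q :=
  IdentDistrib.pi (fun i => (h.identDistrib b i).trans (h.identDistrib 0 i).symm)
    (h.iIndepFun_row b) (h.iIndepFun_row 0)

/-- Different rows are generated by disjoint index blocks of an independent family. -/
lemma indepFun_row (h : IsMultiplierArray Q ξ) {b b' : ℕ} (hb : b ≠ b') :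
    IndepFun (fun ζ i => ξ b i ζ) (fun ζ i => ξ b' i ζ) Q := by
  set m : ℕ × ℕ → MeasurableSpace Ξ := fun q =>
    MeasurableSpace.comap (ξ q.1 q.2) inferInstance with hm
  have hle : ∀ b, MeasurableSpace.comap (fun ζ i => ξ b i ζ) inferInstance ≤
      ⨆ q ∈ {q : ℕ × ℕ | q.1 = b}, m q := by
    intro b
    rw [← measurable_iff_comap_le]
    refine @measurable_pi_lambda _ _ _ (_) _ _ fun i => ?_
    rw [measurable_iff_comap_le]
    exact le_iSup₂_of_le (b, i) rfl le_rfl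
  have := indep_iSup_of_disjoint (m := m) (fun q => (h.measurable q.1 q.2).comap_le) h.indep
    (S := {q | q.1 = b}) (T := {q | q.1 = b'})
    (Set.disjoint_left.2 fun q h1 h2 => hb (Eq.trans (Eq.symm h1) h2))
  exact indep_of_indep_of_le_left (indep_of_indep_of_le_right this (hle b')) (hle b)

end IsMultiplierArray

/-! ### Measurability of the estimators and the empirical bootstrap distribution -/

namespace CrossFitSample

variable {𝒰 T : Type*} [MeasurableSpace 𝒰] {P : Measure 𝒰} {d : ℕ} {M : Population P T d}
  {Ω : Type*} [mΩ : MeasurableSpace Ω] {μ : Measure Ω} {K : ℕ} (S : CrossFitSample M μ K)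

lemma measurable_eval_X_unit {n i : ℕ} {k : Fin K} {f : Ω × (Fin d → ℝ) → ℝ}
    (hf : Measurable[(S.train n k).prod inferInstance] f) :
    Measurable fun ω => f (ω, M.X (S.unit i ω)) :=
  hf.comp (@Measurable.prodMk _ mΩ _ _ (S.train n k) _ _ _
    (measurable_id'' (S.train_le n k)) (S.measurable_X_unit i))

lemma measurable_D_unit (i : ℕ) : Measurable fun ω => M.D (S.unit i ω) :=
  M.measurable_D.comp (S.unit_law i).measurable

lemma measurable_pHat (n : ℕ) : Measurable (S.pHat n) :=
  (Finset.measurable_fun_sum _ fun i _ => S.measurable_D_unit i).div_const _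

lemma measurable_scoreHat (n i : ℕ) (t : T) : Measurable fun ω => S.scoreHat n i ω t := by
  have h1 := S.measurable_pHat n
  have h2 := S.measurable_D_unit i
  have h3 := S.measurable_changeHat n i t
  have h4 := S.measurable_eval_X_unit (i := i) (S.measurable_propHat n (S.fold n i))
  have h5 := S.measurable_eval_X_unit (i := i) (S.measurable_reg0Hat n (S.fold n i) t)
  unfold scoreHat drScore
  exact ((h2.div h1).mul (h3.sub h5)).sub
    (((((measurable_const.sub h2).mul h4)).div (h1.mul (measurable_const.sub h4))).mul (h3.sub h5))

lemma measurable_tauHat (n : ℕ) (t : T) : Measurable fun ω => S.tauHat n ω t :=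
  (Finset.measurable_fun_sum _ fun i _ => S.measurable_scoreHat n i t).div_const _

lemma measurable_inflHat (n i : ℕ) (t : T) : Measurable fun ω => S.inflHat n i ω t :=
  (S.measurable_scoreHat n i t).sub
    (((S.measurable_D_unit i).div (S.measurable_pHat n)).mul (S.measurable_tauHat n t))

lemma measurable_inflMean (n : ℕ) (t : T) : Measurable fun ω => S.inflMean n ω t :=
  (Finset.measurable_fun_sum _ fun i _ => S.measurable_inflHat n i t).div_const _

lemma measurable_sigmaHat (n : ℕ) (t : T) : Measurable fun ω => S.sigmaHat n ω t :=
  ((Finset.measurable_fun_sum _ fun i _ => ((S.measurable_inflHat n i t).sub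
    (S.measurable_inflMean n t)).pow_const 2).div_const _).sqrt

lemma measurable_studMult (n : ℕ) (t : T) :
    Measurable fun q : Ω × (ℕ → ℝ) => S.studMult n q.1 q.2 t :=
  ((Finset.measurable_fun_sum _ fun i _ =>
    ((measurable_pi_apply i).comp measurable_snd).mul (((S.measurable_inflHat n i t).comp
      measurable_fst).sub ((S.measurable_inflMean n t).comp measurable_fst))).div_const _).div
    ((S.measurable_sigmaHat n t).comp measurable_fst)

/-- The empirical distribution function of the bootstrap draws consistently estimates the
conditional distribution function. -/
lemma eventually_abs_gridBootEcdf_sub_lt [IsProbabilityMeasure μ] {Ξ : Type*}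
    [MeasurableSpace Ξ] {Q : Measure Ξ} [IsProbabilityMeasure Q] {ξ : ℕ → ℕ → Ξ → ℝ}
    (hξ : IsMultiplierArray Q ξ) (grid : ℕ → Finset T) {B : ℕ → ℕ} (hB : Tendsto B atTop atTop)
    (x : ℝ) {ε : ℝ} (hε : 0 < ε) :
    ∀ᶠ q in probFilter (μ.prod Q),
      |S.gridBootEcdf (grid q.1) (B q.1) q.1 q.2.1 (fun b i => ξ b i q.2.2) x -
        S.gridBootCdf Q (ξ 0) (grid q.1) q.1 q.2.1 x| < ε := by
  rw [eventually_probFilter]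
  have hlim : Tendsto (fun n => ENNReal.ofReal (1 / (B n * ε ^ 2))) atTop (𝓝 0) := by
    rw [← ENNReal.ofReal_zero]
    refine (ENNReal.continuous_ofReal.tendsto 0).comp (tendsto_const_nhds.div_atTop ?_)
    exact (tendsto_natCast_atTop_atTop.comp hB).atTop_mul_const (pow_pos hε 2)
  refine tendsto_of_tendsto_of_tendsto_of_le_of_le' tendsto_const_nhds hlim
    (Eventually.of_forall fun _ => zero_le) ?_
  filter_upwards [hB.eventually_gt_atTop 0] with n hn
  -- A finite grid makes this event jointly measurable in the data and one row of multipliers, as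
  -- conditional Chebyshev requires.
  set D : Set (Ω × (ℕ → ℝ)) := {q | ∀ t ∈ grid n, |S.studMult n q.1 q.2 t| ≤ x} with hDdef
  have hD : MeasurableSet D := by
    simp only [hDdef, Set.ofPred_forall]
    exact Finset.measurableSet_biInter _ fun t _ =>
      measurableSet_le (S.measurable_studMult n t).abs measurable_const
  refine (measure_mono ?_).trans (measure_prod_le_abs_freq_sub_le (Y := fun b ζ i => ξ b i ζ)
    hξ.measurable_row (fun b b' hb => hξ.indepFun_row hb) hξ.identDistrib_row hD hn hε)
  intro q hq
  simp only [Set.mem_ofPred_eq, not_lt] at hq ⊢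
  have e1 : S.gridBootEcdf (grid n) (B n) n q.1 (fun b i => ξ b i q.2) x =
      (∑ b ∈ Finset.range (B n), D.indicator 1 (q.1, fun i => ξ b i q.2)) / (B n : ℝ) := by
    classical
    rw [gridBootEcdf, Finset.card_filter]
    push_cast
    congr 1
    exact Finset.sum_congr rfl fun b _ => by simp [Set.indicator_apply, hDdef]
  have e2 : S.gridBootCdf Q (ξ 0) (grid n) n q.1 x =
      Q.real {ζ | (q.1, fun i => ξ 0 i ζ) ∈ D} := by
    unfold gridBootCdf supCdf
    congr 1
    ext ζ
    simp [hDdef]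
  rwa [e1, e2] at hq

end CrossFitSample

/-! ### Quantiles and the limiting distribution function -/

section Quantile

variable {F : ℝ → ℝ} {p : ℝ}

/-- Here x is a lower bound and x' an element of the set whose infimum is taken. Evaluating a random
distribution function at two levels thus locates its quantile. -/
lemma quantile_mem_Icc (hF : Monotone F) {x x' : ℝ} (hx : F x < p) (hx' : p ≤ F x') :
    quantile F p ∈ Set.Icc x x' := by
  have hlb : ∀ y ∈ {x | p ≤ F x}, x ≤ y := fun y hy =>
    le_of_lt (hF.reflect_lt (hx.trans_le hy))
  exact ⟨le_csInf ⟨x', hx'⟩ hlb, csInf_le ⟨x, hlb⟩ hx'⟩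

/-- Vanishing on the negatives bounds the set below, so that `sInf` is a true infimum. -/
lemma lt_of_lt_quantile (hF : Monotone F) (hneg : ∀ y < 0, F y = 0) (hp : 0 < p) {x : ℝ}
    (hx : x < quantile F p) : F x < p := by
  refine not_le.1 fun h => absurd hx (not_lt.2 (csInf_le ⟨-1, fun y hy => ?_⟩ h))
  refine le_of_lt (hF.reflect_lt ?_)
  rw [hneg (-1) (by norm_num)]
  exact hp.trans_le hy

/-- Values to the left of the quantile are below p and values to the right are at least p;
continuity equates both one-sided limits with the value. -/
lemma apply_quantile (hF : Monotone F) (hneg : ∀ y < 0, F y = 0)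
    (hlim : Tendsto F atTop (𝓝 1)) (hp : 0 < p) (hp1 : p < 1)
    (hcont : ContinuousAt F (quantile F p)) : F (quantile F p) = p := by
  refine le_antisymm ?_ ?_
  · refine le_of_tendsto (hcont.tendsto.mono_left nhdsWithin_le_nhds :
      Tendsto F (𝓝[<] quantile F p) _) ?_
    filter_upwards [self_mem_nhdsWithin] with x hx
    exact (lt_of_lt_quantile hF hneg hp hx).le
  · refine ge_of_tendsto (hcont.tendsto.mono_left nhdsWithin_le_nhds :
      Tendsto F (𝓝[>] quantile F p) _) ?_
    filter_upwards [self_mem_nhdsWithin] with x hx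
    have hne : {x | p ≤ F x}.Nonempty :=
      ((hlim.eventually (lt_mem_nhds hp1)).exists).imp fun y hy => le_of_lt hy
    obtain ⟨y, hy, hyx⟩ := exists_lt_of_csInf_lt hne hx
    exact le_trans hy (hF hyx.le)

/-- At a nonpositive quantile continuity from the left would force the value 0 instead of p.
Positivity allows the relative error of σ̂ to be absorbed by rescaling the level. -/
lemma quantile_pos (hF : Monotone F) (hneg : ∀ y < 0, F y = 0)
    (hlim : Tendsto F atTop (𝓝 1)) (hp : 0 < p) (hp1 : p < 1)
    (hcont : ContinuousAt F (quantile F p)) : 0 < quantile F p := by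
  by_contra h
  have h0 : F (quantile F p) = 0 := by
    refine tendsto_nhds_unique (hcont.tendsto.mono_left nhdsWithin_le_nhds :
      Tendsto F (𝓝[<] quantile F p) _) (tendsto_const_nhds.congr' ?_)
    filter_upwards [self_mem_nhdsWithin] with x hx
    exact (hneg x (lt_of_lt_of_le hx (not_lt.1 h))).symm
  exact hp.ne (h0.symm.trans (apply_quantile hF hneg hlim hp hp1 hcont))

end Quantile

lemma supCdf_mono {Ω T : Type*} [MeasurableSpace Ω] (P : Measure Ω) [IsFiniteMeasure P]
    (S : Ω → T → ℝ) : Monotone (supCdf P S) := fun _ _ hxy =>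
  measureReal_mono fun _ h t => (h t).trans hxy

lemma supCdf_of_neg {Ω T : Type*} [MeasurableSpace Ω] (P : Measure Ω) [Nonempty T]
    (S : Ω → T → ℝ) {y : ℝ} (hy : y < 0) : supCdf P S y = 0 := by
  have : {ω | ∀ t, |S ω t| ≤ y} = ∅ := Set.eq_empty_of_forall_notMem fun ω hω =>
    absurd ((abs_nonneg _).trans (hω (Classical.arbitrary T))) (not_le.2 hy)
  rw [supCdf, this, measureReal_empty]

section SupCdf

variable {Ω₀ T : Type*} [MeasurableSpace Ω₀] {P₀ : Measure Ω₀} [IsProbabilityMeasure P₀]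
  [Nonempty T] {Z : Ω₀ → EllInfty T} {C : T → T → ℝ} {σ : T → ℝ} {c : ℝ}

lemma tendsto_supCdf_atTop (hc : 0 < c) (hσ : ∀ t, c ≤ σ t) :
    Tendsto (supCdf P₀ (fun ω t => Z ω t / σ t)) atTop (𝓝 1) := by
  have hmono : Monotone fun x : ℝ => {ω | studNorm σ (Z ω) ≤ x} :=
    fun x y hxy ω (hω : _ ≤ x) => hω.trans hxy
  have h := tendsto_measure_iUnion_atTop (μ := P₀) hmono
  have hU : ⋃ x : ℝ, {ω | studNorm σ (Z ω) ≤ x} = Set.univ :=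
    Set.eq_univ_of_forall fun ω => Set.mem_iUnion.2 ⟨studNorm σ (Z ω), le_refl (studNorm σ (Z ω))⟩
  rw [hU, measure_univ] at h
  have h' := (ENNReal.tendsto_toReal ENNReal.one_ne_top).comp h
  refine h'.congr fun x => ?_
  rw [supCdf_eq_measureReal_studNorm hc hσ]
  rfl

end SupCdf

/-! ### Coverage probabilities -/

/-- A family of events that is sandwiched between the events `A x` for `x` close to a continuity
point `x₀` of the limit of their probabilities. -/
lemma probTendsto_of_sandwich {Ω : Type*} [MeasurableSpace Ω] {μ : Measure Ω}
    [IsProbabilityMeasure μ] {E : ℕ → Set Ω} {A : ℝ → ℕ → Set Ω} {F : ℝ → ℝ} {x₀ : ℝ}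
    (hx₀ : 0 < x₀) (hF : ContinuousAt F x₀)
    (hupper : ∀ x r, F x < r → ∀ᶠ n in atTop, μ.real (A x n) < r)
    (hlower : ∀ x y r, x < y → 1 - F x < r → ∀ᶠ n in atTop, μ.real (A y n)ᶜ < r)
    (hsub : ∀ x, x₀ < x → ∀ᶠ q in probFilter μ, q.2 ∈ E q.1 → q.2 ∈ A x q.1)
    (hsup : ∀ x, 0 < x → x < x₀ → ∀ᶠ q in probFilter μ, q.2 ∈ A x q.1 → q.2 ∈ E q.1) :
    ProbTendsto μ E (F x₀) := by
  have hbad : ∀ {p : ℕ × Ω → Prop}, (∀ᶠ q in probFilter μ, p q) → ∀ ε > 0,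
      ∀ᶠ n in atTop, μ.real {ω | ¬ p (n, ω)} < ε := fun hp ε hε =>
    ((ENNReal.tendsto_toReal ENNReal.zero_ne_top).comp (eventually_probFilter.1 hp)).eventually
      (gt_mem_nhds (by simpa using hε))
  have hup : ∀ r, F x₀ < r → ∀ᶠ n in atTop, μ.real (E n) < r := by
    intro r hr
    obtain ⟨r', hr1, hr2⟩ := exists_between hr
    have hev : ∀ᶠ x in 𝓝[>] x₀, F x < r' :=
      (hF.eventually (gt_mem_nhds hr1)).filter_mono nhdsWithin_le_nhds
    obtain ⟨x, hx, hx0⟩ := (hev.and self_mem_nhdsWithin).exists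
    filter_upwards [hupper x r' hx, hbad (hsub x hx0) (r - r') (sub_pos.2 hr2)] with n h1 h2
    have : E n ⊆ A x n ∪ {ω | ¬ (ω ∈ E n → ω ∈ A x n)} := fun ω hω => by
      by_cases h : ω ∈ A x n
      · exact Or.inl h
      · exact Or.inr fun h' => h (h' hω)
    have h3 := (measureReal_mono this (measure_ne_top μ _)).trans (measureReal_union_le _ _)
    linarith
  have hlo : ∀ r, 1 - F x₀ < r → ∀ᶠ n in atTop, μ.real (E n)ᶜ < r := by
    intro r hr
    obtain ⟨r', hr1, hr2⟩ := exists_between hr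
    have hev : ∀ᶠ x in 𝓝[<] x₀, 1 - F x < r' :=
      ((continuousAt_const.sub hF).eventually (gt_mem_nhds hr1)).filter_mono nhdsWithin_le_nhds
    obtain ⟨x, ⟨hx, hx0⟩, hxp⟩ := ((hev.and self_mem_nhdsWithin).and
      ((lt_mem_nhds hx₀).filter_mono nhdsWithin_le_nhds)).exists
    obtain ⟨y, hxy, hy⟩ := exists_between (show x < x₀ from hx0)
    filter_upwards [hlower x y r' hxy hx,
      hbad (hsup y (hxp.trans hxy) hy) (r - r') (sub_pos.2 hr2)] with n h1 h2
    have : (E n)ᶜ ⊆ (A y n)ᶜ ∪ {ω | ¬ (ω ∈ A y n → ω ∈ E n)} := fun ω hω => by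
      by_cases h : ω ∈ A y n
      · exact Or.inr fun h' => hω (h' h)
      · exact Or.inl h
    have h3 := (measureReal_mono this (measure_ne_top μ _)).trans (measureReal_union_le _ _)
    linarith
  -- Subadditivity of outer measure turns the upper bounds for E and its complement into lower
  -- bounds, so both limits follow without measurability.
  have hone : ∀ n, 1 ≤ μ.real (E n) + μ.real (E n)ᶜ := fun n => by
    refine le_trans (le_of_eq ?_) (measureReal_union_le (E n) (E n)ᶜ)
    rw [Set.union_compl_self, probReal_univ]
  constructor
  · refine tendsto_order.2 ⟨fun r hr => ?_, hup⟩
    filter_upwards [hlo (1 - r) (by linarith)] with n hn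
    linarith [hone n]
  · refine tendsto_order.2 ⟨fun r hr => ?_, hlo⟩
    filter_upwards [hup (1 - r) (by linarith)] with n hn
    linarith [hone n]

namespace CrossFitSample

variable {𝒰 T : Type*} [MeasurableSpace 𝒰] {P : Measure 𝒰} {d : ℕ} {M : Population P T d}
  {Ω : Type*} [mΩ : MeasurableSpace Ω] {μ : Measure Ω} {K : ℕ} (S : CrossFitSample M μ K)

lemma covers_iff {n : ℕ} (hn : 0 < n) (ω : Ω) (c : ℝ) :
    S.Covers n ω c ↔ ∀ t, |S.rootError n ω t| ≤ c * S.sigmaHat n ω t := by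
  have hs : 0 < Real.sqrt n := Real.sqrt_pos.2 (by exact_mod_cast hn)
  refine forall_congr' fun t => ?_
  rw [rootError, abs_mul, abs_of_pos hs, ← le_div_iff₀' hs, abs_le, Set.mem_Icc]
  constructor <;> rintro ⟨h1, h2⟩ <;> constructor <;> linarith

lemma eventually_abs_sigmaHat_sub_le
    (hsigmaHat : IsLittleOP μ (fun n ω => supAbs (fun t => S.sigmaHat n ω t - M.sigma t)))
    {η : ℝ} (hη : 0 < η) :
    ∀ᶠ q in probFilter μ, ∀ t, |S.sigmaHat q.1 q.2 t - M.sigma t| ≤ η := by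
  filter_upwards [(isLittleOP_iff.1 hsigmaHat).eventually
    (gt_mem_nhds (ENNReal.ofReal_pos.2 hη))] with q hq t
  have h := (le_iSup (fun t => ‖S.sigmaHat q.1 q.2 t - M.sigma t‖ₑ) t).trans hq.le
  rw [Real.enorm_eq_ofReal_abs] at h
  exact (ENNReal.ofReal_le_ofReal_iff hη.le).1 h

lemma gridBootEcdf_mono (G : Finset T) (B n : ℕ) (ω : Ω) (e : ℕ → ℕ → ℝ) :
    Monotone (S.gridBootEcdf G B n ω e) := fun x y hxy => by
  unfold gridBootEcdf
  refine div_le_div_of_nonneg_right ?_ (Nat.cast_nonneg B)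
  refine Nat.cast_le.2 (Finset.card_le_card fun b hb => ?_)
  rw [Finset.mem_filter] at hb ⊢
  exact ⟨hb.1, fun t ht => (hb.2 t ht).trans hxy⟩

/-- Asymptotically exact coverage of the equal-precision band, for any critical value that
converges in probability to a continuity point of the limiting distribution function. The critical
value may depend on additional randomness, the data being recovered through `π`. -/
lemma probTendsto_covers [Nonempty T] [IsProbabilityMeasure μ] {Ω₀ : Type*}
    [MeasurableSpace Ω₀] {P₀ : Measure Ω₀} [IsProbabilityMeasure P₀] {Z : Ω₀ → EllInfty T}
    (hZ : IsTightGaussian P₀ Z M.covKernel) (hweak : WeakConvEllInfty μ S.rootError P₀ Z)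
    {c : ℝ} (hc : 0 < c) (hσ : ∀ t, c ≤ M.sigma t)
    (hsigmaHat : IsLittleOP μ (fun n ω => supAbs (fun t => S.sigmaHat n ω t - M.sigma t)))
    {x₀ : ℝ} (hx₀ : 0 < x₀)
    (hcont : ContinuousAt (supCdf P₀ (fun ω t => Z ω t / M.sigma t)) x₀)
    {Ω' : Type*} [MeasurableSpace Ω'] {μ' : Measure Ω'} [IsProbabilityMeasure μ'] {π : Ω' → Ω}
    (hπ : Tendsto (fun q : ℕ × Ω' => (q.1, π q.2)) (probFilter μ') (probFilter μ))
    (hπ' : ∀ A : Set Ω, μ'.real (π ⁻¹' A) = μ.real A) {crit : ℕ → Ω' → ℝ}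
    (hcrit : ∀ x x', x < x₀ → x₀ < x' →
      ∀ᶠ q in probFilter μ', crit q.1 q.2 ∈ Set.Icc x x') :
    ProbTendsto μ' (fun n => {ω | S.Covers n (π ω) (crit n ω)})
      (supCdf P₀ (fun ω t => Z ω t / M.sigma t) x₀) := by
  have hσHat : ∀ η : ℝ, 0 < η → ∀ᶠ q in probFilter μ', ∀ t,
      |S.sigmaHat q.1 (π q.2) t - M.sigma t| ≤ η * M.sigma t := by
    intro η hη
    filter_upwards [hπ.eventually
      (S.eventually_abs_sigmaHat_sub_le hsigmaHat (mul_pos hη hc))] with q hq t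
    exact (hq t).trans (mul_le_mul_of_nonneg_left (hσ t) hη.le)
  refine probTendsto_of_sandwich
    (A := fun x n => π ⁻¹' {ω | ∀ t, |S.rootError n ω t| ≤ x * M.sigma t}) hx₀ hcont
    (fun x r hr => ?_) (fun x y r hxy hr => ?_) (fun x hx => ?_) fun x hx0 hx => ?_
  · simp only [hπ']
    rw [supCdf_eq_measureReal_studNorm hc hσ] at hr
    exact hweak.eventually_measureReal_forall_lt hZ.measurable hc hσ hr
  · simp only [← Set.preimage_compl, hπ']
    rw [supCdf_eq_measureReal_studNorm hc hσ] at hr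
    refine hweak.eventually_measureReal_not_forall_lt hZ.measurable hc hσ (lt_of_le_of_lt ?_ hr)
    have hms : MeasurableSet {ω | studNorm M.sigma (Z ω) ≤ x} :=
      hZ.measurableSet_studNorm hc hσ measurableSet_Iic
    rw [← probReal_compl_eq_one_sub hms]
    exact measureReal_mono fun ω (hω : y ≤ _) => not_le.2 (hxy.trans_le hω)
  -- The critical value is at most x₁ < x, and the relative error (x - x₁)/x₁ allowed for σ̂ makes
  -- x₁(1 + error) equal to x. The other inclusion takes x < x₁ < x₀ and error (x₁ - x)/x₁, so that
  -- x₁(1 - error) = x.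
  · obtain ⟨x₁, h01, h1x⟩ := exists_between hx
    have hx1 : 0 < x₁ := hx₀.trans h01
    filter_upwards [hcrit (x₀ - 1) x₁ (by linarith) h01,
      hσHat ((x - x₁) / x₁) (div_pos (sub_pos.2 h1x) hx1),
      tendsto_fst_probFilter.eventually_gt_atTop 0] with q h1 h2 h3 h4 t
    have h5 := (S.covers_iff h3 _ _).1 h4 t
    have h6 : x₁ * S.sigmaHat q.1 (π q.2) t ≤ x * M.sigma t := by
      have := mul_le_mul_of_nonneg_left ((abs_le.1 (h2 t)).2) hx1.le
      have e : x₁ * ((x - x₁) / x₁ * M.sigma t) = (x - x₁) * M.sigma t := by field_simp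
      rw [e] at this
      linarith
    exact h5.trans ((mul_le_mul_of_nonneg_right h1.2 (Real.sqrt_nonneg _)).trans h6)
  · obtain ⟨x₁, h1x, h01⟩ := exists_between hx
    have hx1 : 0 < x₁ := hx0.trans h1x
    filter_upwards [hcrit x₁ (x₀ + 1) h01 (by linarith),
      hσHat ((x₁ - x) / x₁) (div_pos (sub_pos.2 h1x) hx1),
      tendsto_fst_probFilter.eventually_gt_atTop 0] with q h1 h2 h3 h4
    refine (S.covers_iff h3 _ _).2 fun t => ?_
    have h6 : x * M.sigma t ≤ x₁ * S.sigmaHat q.1 (π q.2) t := by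
      have := mul_le_mul_of_nonneg_left ((abs_le.1 (h2 t)).1) hx1.le
      have e : x₁ * -((x₁ - x) / x₁ * M.sigma t) = -((x₁ - x) * M.sigma t) := by field_simp
      rw [e] at this
      linarith
    exact (h4 t).trans (h6.trans (mul_le_mul_of_nonneg_right h1.1 (Real.sqrt_nonneg _)))

end CrossFitSample

end FunctionalDiD

/-! ### Convergence of the critical values and coverage -/

theorem theorem4
    -- the compact interval, the population and the sample
    {a b : ℝ} (hab : a ≤ b) {d K : ℕ}
    {𝒰 : Type*} [MeasurableSpace 𝒰] (P : Measure 𝒰) [IsProbabilityMeasure P]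
    (M : FunctionalDiD.Population P (Set.Icc a b) d)
    {Ω : Type*} [MeasurableSpace Ω] (μ : Measure Ω) [IsProbabilityMeasure μ]
    (S : FunctionalDiD.CrossFitSample M μ K)
    -- overlap, consistency of the nuisance fits and of the reconstruction, envelope
    (hoverlap : M.Overlap)
    (hfitted : S.FittedOverlap)
    (hprop : ∀ k, FunctionalDiD.IsLittleOP μ (fun n ω =>
      eLpNorm (fun x => S.propHat n k ω x - M.prop x) 2 (P.map M.X)))
    (hreg0 : ∀ k, FunctionalDiD.IsLittleOP μ (fun n ω =>
      FunctionalDiD.normTwoInfty (P.map M.X) (fun x t => S.reg0Hat n k ω x t - M.reg0 x t)))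
    (hrecon : FunctionalDiD.IsLittleOP μ (fun n ω =>
      ENNReal.ofReal (Real.sqrt n) * ⨆ i : Fin n,
        FunctionalDiD.supAbs (fun t => S.changeHat n i ω t - M.change (S.unit i ω) t)))
    (henvelope : M.HasEnvelope)
    -- weak convergence to a tight Gaussian process with uniformly continuous paths
    {Ω₀ : Type*} [MeasurableSpace Ω₀] (P₀ : Measure Ω₀) [IsProbabilityMeasure P₀]
    (Z : Ω₀ → FunctionalDiD.EllInfty (Set.Icc a b))
    (hZ : FunctionalDiD.IsTightGaussian P₀ Z M.covKernel)
    (hZcont : ∀ᵐ ω ∂P₀, UniformContinuous (fun t => Z ω t))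
    (hweak : FunctionalDiD.WeakConvEllInfty μ S.rootError P₀ Z)
    -- variance bounded away from zero and uniformly consistent standard deviation estimator
    (hsigma : ∃ c : ℝ, 0 < c ∧ ∀ t, c ≤ M.sigma t)
    (hsigmaHat : FunctionalDiD.IsLittleOP μ (fun n ω =>
      FunctionalDiD.supAbs (fun t => S.sigmaHat n ω t - M.sigma t)))
    -- the law of the studentized supremum is continuous at its quantile
    {α : ℝ} (hα₀ : 0 < α) (hα₁ : α < 1)
    (hcont : ContinuousAt (FunctionalDiD.supCdf P₀ (fun ω t => Z ω t / M.sigma t))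
      (FunctionalDiD.quantile
        (FunctionalDiD.supCdf P₀ (fun ω t => Z ω t / M.sigma t)) (1 - α)))
    -- multipliers, independent of the data, and consistency of the multiplier bootstrap
    {Ξ : Type*} [MeasurableSpace Ξ] (Q : Measure Ξ) [IsProbabilityMeasure Q]
    (ξ : ℕ → ℕ → Ξ → ℝ) (hξ : FunctionalDiD.IsMultiplierArray Q ξ)
    (hboot : FunctionalDiD.IsLittleOP μ (fun n ω => ⨆ x : ℝ, ENNReal.ofReal
      |FunctionalDiD.supCdf Q (fun ζ t => S.studMult n ω (fun i => ξ 0 i ζ) t) x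
        - FunctionalDiD.supCdf P₀ (fun ω t => Z ω t / M.sigma t) x|))
    -- the evaluation grid has mesh tending to zero and approximates the studentized supremum
    (grid : ℕ → Finset (Set.Icc a b))
    (hmesh : ∀ δ : ℝ, 0 < δ → ∀ᶠ n in atTop, ∀ t : Set.Icc a b, ∃ s ∈ grid n, dist t s < δ)
    (hgrid : FunctionalDiD.IsLittleOP μ (fun n ω =>
      FunctionalDiD.supAbs (fun t => S.rootError n ω t / S.sigmaHat n ω t)
        - FunctionalDiD.supAbs (fun t : grid n => S.rootError n ω t / S.sigmaHat n ω t))) :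
    -- coverage with the critical value equal to the conditional bootstrap quantile
    FunctionalDiD.ProbTendsto μ
      (fun n => {ω | S.Covers n ω
        (FunctionalDiD.quantile (S.gridBootCdf Q (ξ 0) (grid n) n ω) (1 - α))}) (1 - α) ∧
    -- coverage with the empirical quantile of `B n → ∞` bootstrap draws
    ∀ B : ℕ → ℕ, Tendsto B atTop atTop →
      FunctionalDiD.ProbTendsto (μ.prod Q)
        (fun n => {q : Ω × Ξ | S.Covers n q.1
          (FunctionalDiD.quantile
            (S.gridBootEcdf (grid n) (B n) n q.1 (fun b i => ξ b i q.2)) (1 - α))})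
        (1 - α) := by
  have : Nonempty (Set.Icc a b) := ⟨⟨a, Set.left_mem_Icc.2 hab⟩⟩
  obtain ⟨c, hc, hσ⟩ := hsigma
  have hZc : ∀ᵐ ω ∂P₀, Continuous fun t => Z ω t := hZcont.mono fun ω h => h.continuous
  have hσc : Continuous M.sigma := continuous_iff_continuousAt.2 fun t =>
    (hZ.tendsto_covariance_diag hZc t).sqrt
  set F := FunctionalDiD.supCdf P₀ (fun ω t => Z ω t / M.sigma t) with hFdef
  have hF : Monotone F := FunctionalDiD.supCdf_mono _ _
  have hneg : ∀ y < 0, F y = 0 := fun y hy => FunctionalDiD.supCdf_of_neg _ _ hy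
  have hlim : Tendsto F atTop (𝓝 1) := FunctionalDiD.tendsto_supCdf_atTop hc hσ
  have hp : 0 < 1 - α := by linarith
  have hp1 : 1 - α < 1 := by linarith
  set x₀ := FunctionalDiD.quantile F (1 - α) with hx₀def
  have hx₀ : 0 < x₀ := FunctionalDiD.quantile_pos hF hneg hlim hp hp1 hcont
  have hFx₀ : F x₀ = 1 - α := FunctionalDiD.apply_quantile hF hneg hlim hp hp1 hcont
  have hFlt : ∀ x < x₀, F x < 1 - α := fun x hx =>
    FunctionalDiD.lt_of_lt_quantile hF hneg hp hx
  -- Strict increase beyond the quantile prevents the critical value from drifting along a flat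
  -- stretch of F; where F has reached 1 there is nothing to prove.
  have hFgt : ∀ x, x₀ < x → 1 - α < F x := by
    intro x hx
    rcases lt_or_ge (F x) 1 with h1 | h1
    · rw [← hFx₀]
      rw [hFdef, FunctionalDiD.supCdf_eq_measureReal_studNorm hc hσ] at h1 hFx₀ ⊢
      rw [FunctionalDiD.supCdf_eq_measureReal_studNorm hc hσ]
      refine (ENNReal.toReal_lt_toReal (measure_ne_top _ _) (measure_ne_top _ _)).2
        (hZ.measure_studNorm_lt hZc hc hσ hσc hx ?_ ?_)
      · exact (ENNReal.toReal_pos_iff.1 (hp.trans_eq hFx₀.symm)).1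
      · exact (ENNReal.toReal_lt_toReal (measure_ne_top _ _) ENNReal.one_ne_top).1
          (by rw [ENNReal.toReal_one]; exact h1)
    · exact hp1.trans_le h1
  have htau := fun η (hη : 0 < η) => S.eventually_abs_tauHat_sub_le hZ.measurable hweak hη
  have hinfl := S.tendsto_avg_sq_inflHat_sub hoverlap hfitted hprop hreg0 hrecon
    (fun n ω i hi t => S.enorm_changeHat_sub_le hi ω t) henvelope htau
  have hlower : ∀ x r, F x < r → ∀ y < x,
      ∀ᶠ q in FunctionalDiD.probFilter μ, S.gridBootCdf Q (ξ 0) (grid q.1) q.1 q.2 y < r := by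
    intro x r hr y hy
    rw [hFdef, FunctionalDiD.supCdf_eq_measureReal_studNorm hc hσ] at hr
    exact S.eventually_gridBootCdf_lt hZ hZc (hξ.measurable 0) (hξ.iIndepFun_row 0)
      (hξ.identDistrib 0) hξ.mean_zero hξ.second_moment henvelope hinfl hc hσ hσc hsigmaHat
      hmesh hy hr
  have hupper : ∀ x r, r < F x →
      ∀ᶠ q in FunctionalDiD.probFilter μ, r < S.gridBootCdf Q (ξ 0) (grid q.1) q.1 q.2 x :=
    fun x r hr => S.eventually_lt_gridBootCdf hboot hr
  -- An intermediate level y between x and x₀ pays for the loss of level in the bootstrap bound, and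
  -- r leaves a margin below 1 - α for the simulation error of the empirical quantile.
  have hlower' : ∀ x < x₀, ∃ r < 1 - α,
      ∀ᶠ q in FunctionalDiD.probFilter μ, S.gridBootCdf Q (ξ 0) (grid q.1) q.1 q.2 x < r := by
    intro x hx
    obtain ⟨y, hxy, hy⟩ := exists_between hx
    obtain ⟨r, hr, hr'⟩ := exists_between (hFlt y hy)
    exact ⟨r, hr', hlower y r hr x hxy⟩
  rw [← hFx₀]
  refine ⟨?_, fun B hB => ?_⟩
  · refine S.probTendsto_covers hZ hweak hc hσ hsigmaHat hx₀ hcont (π := id) tendsto_id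
      (fun A => rfl) fun x x' hx hx' => ?_
    obtain ⟨r, hr, hev⟩ := hlower' x hx
    filter_upwards [hev, hupper x' _ (hFgt x' hx')] with q h1 h2
    rw [hFx₀]
    exact FunctionalDiD.quantile_mem_Icc (FunctionalDiD.supCdf_mono _ _) (h1.trans hr) h2.le
  · have hfst := FunctionalDiD.tendsto_fst_probFilter_prod (μ := μ) (Q := Q)
    refine S.probTendsto_covers hZ hweak hc hσ hsigmaHat hx₀ hcont (π := Prod.fst) hfst
      (fun A => ?_) fun x x' hx hx' => ?_
    -- The preimage is a cylinder, so its outer probability is that of A for arbitrary A.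
    · rw [← Set.prod_univ, measureReal_prod_prod, probReal_univ, mul_one]
    · obtain ⟨r, hr, hev⟩ := hlower' x hx
      -- The margins (1 - α) - r at x and r' - (1 - α) at x' are the tolerances granted to the
      -- empirical distribution function.
      obtain ⟨r', hr1, hr2⟩ := exists_between (hFgt x' hx')
      filter_upwards [hfst.eventually hev, hfst.eventually (hupper x' _ hr2),
        S.eventually_abs_gridBootEcdf_sub_lt hξ grid hB x (sub_pos.2 hr),
        S.eventually_abs_gridBootEcdf_sub_lt hξ grid hB x' (sub_pos.2 hr1)] with q h1 h2 h3 h4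
      rw [hFx₀]
      refine FunctionalDiD.quantile_mem_Icc (S.gridBootEcdf_mono _ _ _ _ _) ?_ ?_
      · linarith [(abs_lt.1 h3).2]
      · linarith [(abs_lt.1 h4).1]
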